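/- **Definitions.** For $s\ge 0$, an *$s$-local function* is a measurable function $g(H,\mathbf x)\in\{0,1\}$ of a finite rooted graph $H$ of depth at most $s$ and labels $\mathbf x\in[0,1]^{V(H)}$, depending only on the isomorphism class of the rooted labelled graph. It is applied to a vertex $v$ of a (locally finite) graph $G$ with labels $\mathbf x\in[0,1]^{V(G)}$ by evaluating it at the ball of radius $s$ around $v$, rooted at $v$, with the restricted labels. A pair $(g_\ell,g_r)$ of $s$-local functions is *compatible* (a *bipartite $s$-local algorithm*) if for every bipartite graph $G$ with bipartition $(L,R)$ and every $\mathbf x\in[0,1]^{V(G)}$, the set of vertices $v\in L$ at which $g_\ell$ outputs $1$ together with the vertices $v\in R$ at which $g_r$ outputs $1$ is an independent set of $G$. For real $d>0$ let $\mathbf T$ be the rooted $\mathrm{Pois}(d)$ Galton–Watson tree, with independent $\mathrm{Uniform}[0,1]$ labels $\mathbf x$ on its vertices, and write $\mathbb E[g(\mathbf T,\mathbf x)]$ for the expected output of $g$ at the root. For $\gamma\in(0,1/2]$ put $$\alpha_{d,\gamma}(g_\ell,g_r)=\frac12\min\Big\{\frac1\gamma\,\mathbb E[g_\ell(\mathbf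 T,\mathbf x)],\ \frac1{1-\gamma}\,\mathbb E[g_r(\mathbf T,\mathbf x)]\Big\},$$ and let $\hat\alpha_{d,\gamma}$ be the supremum of $\alpha_{d,\gamma}(g_\ell,g_r)$ over all $s\ge0$ and all compatible pairs of $s$-local functions. **Theorem.** Fix $\gamma\in(0,1/2]$. As $d\to\infty$, $$\hat\alpha_{d,\gamma}=\Big(\frac1{2\gamma}+o_d(1)\Big)\frac{\log d}{d}.$$ Moreover, the lower bound is achieved by a bipartite $1$-local algorithm: for $p\in[0,1]$ let $g_\ell^{p}$ output $1$ if and only if the label of the root is at most $p$, and let $g_r^{p}$ output $1$ if and only if all neighbours of the root have labels larger than $p$. Then $(g_\ell^{p},g_r^{p})$ is a compatible pair of $1$-local functions for every $p\in[0,1]$, and for a suitable choice of $p=p(d)\in[0,1]$, $$\alpha_{d,\gamma}\big(g_\ell^{p(d)},g_r^{p(d)}\big)=\Big(\frac1{2\gamma}+o_d(1)\Big)\frac{\log d}{d}.$$ Finally, for every $\varepsilon>0$ there is $d_0$ such that for all $d\ge d_0$, all $s\ge0$ and all compatible pairs $(g_\ell,g_r)$ of $s$-local functions, the inequalities $\mathbb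 E[g_\ell(\mathbf T,\mathbf x)]\ge(1+\varepsilon)\frac{\log d}{d}$ and $\mathbb E[g_r(\mathbf T,\mathbf x)]\ge(1+\varepsilon)\frac{\log d}{d}$ do not both hold. -/

import Mathlib

open MeasureTheory ProbabilityTheory Filter Topology
open scoped NNReal unitInterval

namespace BipLocal

/-- The set of vertices at graph distance at most `s` from `v`. -/
def ball {V : Type} (G : SimpleGraph V) (s : ℕ) (v : V) : Set V :=
  {u | G.edist v u ≤ (s : ℕ∞)}

lemma mem_ball_self {V : Type} (G : SimpleGraph V) (s : ℕ) (v : V) : v ∈ ball G s v := by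
  simp [ball]

/-- A measurable `{0,1}`-valued function of a rooted graph `H` with root `r` and labels
`x ∈ [0,1]^V(H)`. It depends only on the isomorphism class of the rooted labelled graph. Such a
function is used as an `s`-local function by evaluating it at balls of radius `s`, see `eval`; it is
only ever evaluated at the (finite) balls of locally finite graphs, so measurability in the labels
is asked for finite `H`. -/
structure LocalFunction where
  toFun : ∀ {V : Type}, SimpleGraph V → V → (V → I) → Bool
  measurable_toFun : ∀ {V : Type} [Finite V] (H : SimpleGraph V) (r : V),
    Measurable (fun x : V → I => toFun H r x)
  toFun_iso : ∀ {V W : Type} (H : SimpleGraph V) (K : SimpleGraph W) (e : H ≃g K) (r : V)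
    (x : W → I), toFun H r (fun v => x (e v)) = toFun K (e r) x

/-- The output at the vertex `v` of the labelled graph `(G, x)` of the `s`-local algorithm given by
`g`: evaluate `g` at the depth-`s` neighbourhood of `v`, rooted at `v`, with the restricted
labels. -/
def LocalFunction.eval (g : LocalFunction) (s : ℕ) {V : Type} (G : SimpleGraph V) (v : V)
    (x : V → I) : Bool :=
  g.toFun (G.induce (ball G s v)) ⟨v, mem_ball_self G s v⟩ (fun u => x u.1)

/-- The set of vertices chosen in the graph `G` with left side `L` and right side `Lᶜ`, when `gl`
is applied to the left vertices and `gr` to the right vertices. -/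
def output (s : ℕ) (gl gr : LocalFunction) {V : Type} (G : SimpleGraph V) (L : Set V)
    (x : V → I) : Set V :=
  {v | (v ∈ L ∧ gl.eval s G v x = true) ∨ (v ∈ Lᶜ ∧ gr.eval s G v x = true)}

/-- The pair `(gl, gr)`, used as `s`-local functions, is a bipartite `s`-local algorithm for
independent sets: on every (locally finite) bipartite graph and for all labels, the output is an
independent set. -/
def Compatible (s : ℕ) (gl gr : LocalFunction) : Prop :=
  ∀ (V : Type) (G : SimpleGraph V) (L : Set V), (∀ v, (G.neighborSet v).Finite) →
    G.IsBipartiteWith L Lᶜ → ∀ x : V → I, G.IsIndepSet (output s gl gr G L x)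

/-- The vertices of the Galton--Watson tree with offspring numbers `N`: the root is `[]`, and the
children of a vertex `v` of the tree are `i :: v` for `i < N v`. -/
def InTree (N : List ℕ → ℕ) : List ℕ → Prop
  | [] => True
  | i :: v => InTree N v ∧ i < N v

/-- The Galton--Watson tree with offspring numbers `N`, rooted at `[]`: each vertex of the tree is
adjacent to its children. The words that are not vertices of the tree are isolated, so they lie in
no ball around the root. -/
def gwTree (N : List ℕ → ℕ) : SimpleGraph (List ℕ) :=
  SimpleGraph.fromRel (fun u v => InTree N v ∧ ∃ i, v = i :: u)

/-- The joint law of independent `Pois(d)` offspring numbers and independent uniform labels. -/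
noncomputable def gwMeasure (d : ℝ≥0) : Measure ((List ℕ → ℕ) × (List ℕ → I)) :=
  (Measure.infinitePi (fun _ : List ℕ => poissonMeasure d)).prod
    (Measure.infinitePi (fun _ : List ℕ => (volume : Measure I)))

/-- The expectation of the `s`-local function `g` at the root of the `Pois(d)` Galton--Watson tree
with independent uniform labels. -/
noncomputable def gwExp (d : ℝ≥0) (s : ℕ) (g : LocalFunction) : ℝ :=
  ∫ ω, (if g.eval s (gwTree ω.1) [] ω.2 = true then (1 : ℝ) else 0) ∂(gwMeasure d)

/-- The `γ`-balanced value of a pair of `s`-local functions on the `Pois(d)` tree. -/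
noncomputable def balValue (d : ℝ≥0) (γ : ℝ) (s : ℕ) (gl gr : LocalFunction) : ℝ :=
  1 / 2 * min (1 / γ * gwExp d s gl) (1 / (1 - γ) * gwExp d s gr)

/-- The optimal `γ`-balanced value over all compatible pairs of `s`-local functions, `s ≥ 0`. -/
noncomputable def optBalValue (d : ℝ≥0) (γ : ℝ) : ℝ :=
  sSup {a : ℝ | ∃ (s : ℕ) (gl gr : LocalFunction),
    Compatible s gl gr ∧ a = balValue d γ s gl gr}

/-- The function that chooses the root if its label is at most `p`. -/
noncomputable def simpleLeft (p : I) : LocalFunction where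
  toFun _ r x := by classical exact decide (x r ≤ p)
  measurable_toFun H r := by
    classical
    refine measurable_to_bool ?_
    have : MeasurableSet {x : _ → I | x r ≤ p} :=
      measurableSet_le (measurable_pi_apply r) measurable_const
    convert this using 1
    ext x
    simp
  toFun_iso H K e r x := rfl

/-- The function that chooses the root if all its neighbours have labels larger than `p`. -/
noncomputable def simpleRight (p : I) : LocalFunction where
  toFun H r x := by classical exact decide (∀ u, H.Adj r u → p < x u)
  measurable_toFun {V} _ H r := by
    classical
    refine measurable_to_bool ?_
    have : MeasurableSet (⋂ u : V, ⋂ _ : H.Adj r u, {x : V → I | p < x u}) :=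
      MeasurableSet.iInter fun u => MeasurableSet.iInter fun _ =>
        measurableSet_lt measurable_const (measurable_pi_apply u)
    convert this using 1
    ext x
    simp
  toFun_iso H K e r x := by
    classical
    refine decide_eq_decide.2 ⟨fun h u hu => ?_, fun h u hu => h _ (e.map_adj_iff.2 hu)⟩
    obtain ⟨v, rfl⟩ := e.surjective u
    exact h v (e.map_adj_iff.1 hu)

end BipLocal

/-! Write `κ = log d / d`.

The lower bound comes from the explicit pair with `p = (log d - 2 log log d) / d`. The left density
is `p`. The right density is `exp (-d p) = (log d)^2 / d`, which is larger by a factor that tends to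
infinity, so for large `d` the minimum is the left term for every `γ`.

The upper bound reduces to `not_both_dense`: both expectations cannot be at least `(1 + ε) κ`. Since
`γ ≤ 1/2`, the weaker factor `1/γ` then bounds the minimum (`balValue_le`).

For `not_both_dense`, run the pair on the random bipartite graph with `n + n` vertices and edge
probability `d / n`. By `local_limit` every vertex is chosen with probability almost at least its
expectation on the tree. One copy of the graph is not enough: a first moment count only says that `d
α β` is at most about `(α + β) log d`, which permits both densities to be as large as `2 κ`. Hence
one uses boundedly many correlated copies, each obtained from copy `0` by resampling some of its
sites (the edge variables and the labels).

Give every vertex the pattern of its outputs over the copies. A left and a right vertex clash if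
some copy chooses both; that copy must then lack the edge between them. Prescribed patterns with `N`
clashes therefore have probability at most `exp (-(d/n) N)` (`prob_patterns_le`), and comparison
with a product law on patterns bounds the expected number of clashes by an entropy
(`expected_forbidden_le`). Conversely, the patterns of typical opposite vertices are almost
independent because their explored neighbourhoods are disjoint (`pattern_decorrelation`,
`sum_prob_not_disjoint_le`), so the number of clashes is bounded below through the densities `x k`,
`y k` of vertices first chosen by copy `k` (`prob_clash_ge`). Together these give
`density_inequality`.

Raising the resampling rate continuously from no change to full independence lets each new copy
contribute exactly `x k + y k = e κ` (`exists_copies`). If both densities are at least `(1 + e) κ`,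
each such copy gains at least `d κ^2 e^2 / 2` more clashes than entropy, while copy `0` costs at
most `4 d κ^2`. Enough copies contradict the inequality (`density_contradiction`). -/

namespace BipLocal

/-! ### Balls and the locality of outputs -/

lemma ball_zero {V : Type} (G : SimpleGraph V) (v : V) : ball G 0 v = {v} := by
  ext u
  simp only [ball, Nat.cast_zero, nonpos_iff_eq_zero, SimpleGraph.edist_eq_zero_iff,
    Set.mem_ofPred_eq, Set.mem_singleton_iff]
  exact eq_comm

lemma mem_ball_iff_exists_walk {V : Type} {G : SimpleGraph V} {s : ℕ} {v u : V} :
    u ∈ ball G s v ↔ ∃ p : G.Walk v u, p.length ≤ s := by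
  constructor
  · intro h
    have h' : G.edist v u ≤ s := h
    have hne : G.edist v u ≠ ⊤ := fun ht => by simp [ht] at h'
    obtain ⟨p, hp⟩ := SimpleGraph.exists_walk_of_edist_ne_top hne
    refine ⟨p, ?_⟩
    rw [← hp] at h'
    exact_mod_cast h'
  · rintro ⟨p, hp⟩
    exact (SimpleGraph.edist_le p).trans (by exact_mod_cast hp)

lemma mem_ball_comm {V : Type} {G : SimpleGraph V} {s : ℕ} {v u : V} :
    u ∈ ball G s v ↔ v ∈ ball G s u := by
  simp [ball, SimpleGraph.edist_comm]

lemma ball_mono {V : Type} {G : SimpleGraph V} {s t : ℕ} (h : s ≤ t) (v : V) :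
    ball G s v ⊆ ball G t v := fun u hu =>
  show G.edist v u ≤ t from le_trans (show G.edist v u ≤ s from hu) (by exact_mod_cast h)

lemma ball_mono_graph {V : Type} {G H : SimpleGraph V} (h : G ≤ H) (s : ℕ) (v : V) :
    ball G s v ⊆ ball H s v := fun u hu => by
  obtain ⟨p, hp⟩ := mem_ball_iff_exists_walk.1 hu
  exact mem_ball_iff_exists_walk.2 ⟨p.mapLe h, by simpa using hp⟩

lemma mem_ball_succ {V : Type} {G : SimpleGraph V} {s : ℕ} {v u : V} :
    u ∈ ball G (s + 1) v ↔ u ∈ ball G s v ∨ ∃ w ∈ ball G s v, G.Adj w u := by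
  constructor
  · intro h
    obtain ⟨p, hp⟩ := mem_ball_iff_exists_walk.1 h
    obtain ⟨p', hp'⟩ : ∃ p' : G.Walk u v, p'.length ≤ s + 1 := ⟨p.reverse, by simpa using hp⟩
    cases p' with
    | nil => exact Or.inl (mem_ball_self G s v)
    | @cons _ w _ h' p'' =>
      refine Or.inr ⟨w, mem_ball_iff_exists_walk.2 ⟨p''.reverse, ?_⟩, h'.symm⟩
      simp at hp' ⊢
      omega
  · rintro (h | ⟨w, hw, hwu⟩)
    · exact ball_mono (Nat.le_succ s) v h
    · obtain ⟨p, hp⟩ := mem_ball_iff_exists_walk.1 hw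
      exact mem_ball_iff_exists_walk.2 ⟨p.concat hwu, by simp; omega⟩

/-- A map that is injective on a ball, preserves adjacency there, and maps the neighbourhoods of the
vertices inside the ball onto the neighbourhoods of their images, carries balls to balls. -/
lemma ball_image_of_localIso {V W : Type} {G : SimpleGraph V} {H : SimpleGraph W} {ψ : V → W}
    {v : V} {s : ℕ}
    (hnb : ∀ r < s, ∀ u ∈ ball G r v, ∀ w, H.Adj (ψ u) w → ∃ u', G.Adj u u' ∧ ψ u' = w)
    (hadj : ∀ u ∈ ball G s v, ∀ u' ∈ ball G s v, (G.Adj u u' ↔ H.Adj (ψ u) (ψ u')))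
    (r : ℕ) (hr : r ≤ s) : ball H r (ψ v) = ψ '' ball G r v := by
  induction r with
  | zero => simp [ball_zero]
  | succ r ih =>
    have ih := ih (by omega)
    ext w
    rw [mem_ball_succ, ih]
    constructor
    · rintro (⟨u, hu, rfl⟩ | ⟨_, ⟨u, hu, rfl⟩, hw⟩)
      · exact ⟨u, ball_mono (Nat.le_succ r) v hu, rfl⟩
      · obtain ⟨u', hu', rfl⟩ := hnb r (by omega) u hu w hw
        exact ⟨u', mem_ball_succ.2 (Or.inr ⟨u, hu, hu'⟩), rfl⟩
    · rintro ⟨u, hu, rfl⟩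
      rcases mem_ball_succ.1 hu with h | ⟨u', hu', h⟩
      · exact Or.inl ⟨u, h, rfl⟩
      · exact Or.inr ⟨_, ⟨u', hu', rfl⟩,
          (hadj u' (ball_mono (by omega) v hu') u (ball_mono hr v hu)).1 h⟩

/-- Under these hypotheses the map restricts to a root-preserving isomorphism of the two labelled
balls, to which isomorphism invariance applies. Neighbourhoods need to match only strictly inside
the ball: a boundary vertex may have further neighbours, which the ball does not see. -/
lemma LocalFunction.eval_eq_of_localIso (g : LocalFunction) {s : ℕ} {V W : Type}
    {G : SimpleGraph V} {H : SimpleGraph W} {ψ : V → W} {v : V} {x : V → I} {y : W → I}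
    (hinj : Set.InjOn ψ (ball G s v))
    (hnb : ∀ r < s, ∀ u ∈ ball G r v, ∀ w, H.Adj (ψ u) w → ∃ u', G.Adj u u' ∧ ψ u' = w)
    (hadj : ∀ u ∈ ball G s v, ∀ u' ∈ ball G s v, (G.Adj u u' ↔ H.Adj (ψ u) (ψ u')))
    (hx : ∀ u ∈ ball G s v, x u = y (ψ u)) :
    g.eval s G v x = g.eval s H (ψ v) y := by
  have him := ball_image_of_localIso hnb hadj s le_rfl
  have hbij : Set.BijOn ψ (ball G s v) (ball H s (ψ v)) :=
    ⟨fun u hu => him ▸ ⟨u, hu, rfl⟩, hinj, fun w hw => him ▸ hw⟩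
  let e : G.induce (ball G s v) ≃g H.induce (ball H s (ψ v)) :=
    { toEquiv := hbij.equiv ψ
      map_rel_iff' := fun {a b} => (hadj a.1 a.2 b.1 b.2).symm }
  have := g.toFun_iso (G.induce (ball G s v)) (H.induce (ball H s (ψ v))) e
    ⟨v, mem_ball_self G s v⟩ (fun u => y u.1)
  unfold LocalFunction.eval
  rw [show (⟨ψ v, mem_ball_self H s (ψ v)⟩ : ball H s (ψ v)) = e ⟨v, mem_ball_self G s v⟩ from rfl,
    ← this]
  congr 1
  ext u
  rw [hx u.1 u.2]
  rfl

lemma LocalFunction.measurable_eval (g : LocalFunction) (s : ℕ) {V : Type} (G : SimpleGraph V)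
    (v : V) [Finite (ball G s v)] : Measurable (fun x : V → I => g.eval s G v x) :=
  (g.measurable_toFun _ _).comp (measurable_pi_lambda _ fun u => measurable_pi_apply u.1)

end BipLocal

/-! ### The random bipartite graph and the entropy form of the first moment bound -/

namespace BipLocal

/-- The pair of indices `(left, right)` of two vertices on different sides. -/
def pairSite {n : ℕ} (a b : Bool × Fin n) : Fin n × Fin n :=
  if a.1 = false then (a.2, b.2) else (b.2, a.2)

lemma pairSite_comm {n : ℕ} {a b : Bool × Fin n} (h : a.1 ≠ b.1) : pairSite a b = pairSite b a := by
  obtain ⟨a, i⟩ := a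
  obtain ⟨b, j⟩ := b
  cases a <;> cases b <;> simp_all [pairSite]

/-- The bipartite graph on two copies of `Fin n` with the given set of edges. -/
def bipGraph {n : ℕ} (E : Fin n × Fin n → Prop) : SimpleGraph (Bool × Fin n) where
  Adj a b := a.1 ≠ b.1 ∧ E (pairSite a b)
  symm := ⟨fun _ _ h => ⟨h.1.symm, pairSite_comm h.1 ▸ h.2⟩⟩
  loopless := ⟨fun _ h => h.1 rfl⟩

lemma bipGraph_adj {n : ℕ} {E : Fin n × Fin n → Prop} {a b : Bool × Fin n} :
    (bipGraph E).Adj a b ↔ a.1 ≠ b.1 ∧ E (pairSite a b) := Iff.rfl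

lemma bipGraph_isBipartiteWith {n : ℕ} (E : Fin n × Fin n → Prop) :
    (bipGraph E).IsBipartiteWith {v | v.1 = false} {v | v.1 = false}ᶜ := by
  refine ⟨disjoint_compl_right, fun a b h => ?_⟩
  obtain ⟨a, i⟩ := a
  obtain ⟨b, j⟩ := b
  have := h.1
  cases a <;> cases b <;> simp_all

/-- The sources of randomness of the random bipartite graph: the pairs of opposite vertices and the
vertices. -/
abbrev Site (n : ℕ) : Type := (Fin n × Fin n) ⊕ (Bool × Fin n)

/-- The bipartite graph in which a pair is an edge if its variable is below `q`. -/
def siteGraph {n : ℕ} (q : ℝ) (ξ : Site n → I) : SimpleGraph (Bool × Fin n) :=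
  bipGraph fun p => (ξ (.inl p) : ℝ) < q

/-- The output at `v` of the local function `g` on `siteGraph q ξ` with the vertex labels of `ξ`. -/
def out (g : LocalFunction) (s : ℕ) {n : ℕ} (q : ℝ) (v : Bool × Fin n) (ξ : Site n → I) : Bool :=
  g.eval s (siteGraph q ξ) v fun w => ξ (.inr w)

/-- Only finitely many edge sets occur, and for a fixed one the output is measurable in the labels.
-/
lemma measurable_out (g : LocalFunction) (s : ℕ) {n : ℕ} (q : ℝ) (v : Bool × Fin n) :
    Measurable (out g s q v) := by
  have h1 : Measurable fun p : (Fin n × Fin n → Prop) × (Bool × Fin n → I) =>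
      g.eval s (bipGraph p.1) v p.2 :=
    measurable_from_prod_countable_right fun E => g.measurable_eval s (bipGraph E) v
  have h2 : Measurable fun ξ : Site n → I =>
      ((fun p => (ξ (.inl p) : ℝ) < q, fun w => ξ (.inr w)) :
        (Fin n × Fin n → Prop) × (Bool × Fin n → I)) := by
    refine Measurable.prodMk (measurable_pi_lambda _ fun p => ?_)
      (measurable_pi_lambda _ fun w => measurable_pi_apply _)
    refine measurableSet_setOfPred.1 (measurableSet_lt ?_ measurable_const)
    exact measurable_subtype_coe.comp (measurable_pi_apply _)
  have h3 := h1.comp h2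
  simp only [Function.comp_def] at h3
  exact h3

lemma Compatible.not_lt {s : ℕ} {gl gr : LocalFunction} (h : Compatible s gl gr) {n : ℕ} {q : ℝ}
    {ξ : Site n → I} {i j : Fin n} (hi : out gl s q (false, i) ξ = true)
    (hj : out gr s q (true, j) ξ = true) : ¬ (ξ (.inl (i, j)) : ℝ) < q := by
  intro hlt
  have := h _ (siteGraph q ξ) {v | v.1 = false} (fun v => Set.toFinite _)
    (bipGraph_isBipartiteWith _) (fun w => ξ (.inr w))
  refine this (x := (false, i)) (Or.inl ⟨rfl, hi⟩) (y := (true, j)) (Or.inr ⟨by simp, hj⟩)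
    (by simp) ?_
  exact ⟨by simp, hlt⟩

lemma expect_eq_sum {Ω T : Type*} [MeasurableSpace Ω] (P : Measure Ω) [IsProbabilityMeasure P]
    [Fintype T] [MeasurableSpace T] [MeasurableSingletonClass T] {X : Ω → T} (hX : Measurable X)
    (φ : T → ℝ) : ∫ ω, φ (X ω) ∂P = ∑ t, P.real {ω | X ω = t} * φ t := by
  rw [← integral_map (φ := X) (f := φ) hX.aemeasurable
    (Measurable.of_discrete.aestronglyMeasurable), integral_fintype Integrable.of_finite]
  refine Finset.sum_congr rfl fun t _ => ?_
  rw [smul_eq_mul, map_measureReal_apply hX (measurableSet_singleton t)]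
  rfl

/-- The first moment bound, in expectation: if the patterns `A i`, `B j` are unlikely to have many
forbidden pairs, then the expected number of forbidden pairs is at most their entropy. -/
lemma expected_forbidden_le {Ω S : Type} [MeasurableSpace Ω] (P : Measure Ω)
    [IsProbabilityMeasure P] [Fintype S] [DecidableEq S] [MeasurableSpace S]
    [MeasurableSingletonClass S] {n : ℕ} {A B : Fin n → Ω → S} (hA : ∀ i, Measurable (A i))
    (hB : ∀ i, Measurable (B i)) (Forb : S → S → Prop) [DecidableRel Forb] (c : ℝ)
    (hP : ∀ α β : Fin n → S, P.real {ω | (∀ i, A i ω = α i) ∧ ∀ j, B j ω = β j} ≤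
      Real.exp (-(c * ∑ i, ∑ j, if Forb (α i) (β j) then 1 else 0)))
    (Q : S → ℝ) (hQ : ∀ a, 0 < Q a) (hQ1 : ∑ a, Q a = 1) :
    c * ∑ i, ∑ j, P.real {ω | Forb (A i ω) (B j ω)} ≤
      ∑ i, ∫ ω, -Real.log (Q (A i ω)) ∂P + ∑ j, ∫ ω, -Real.log (Q (B j ω)) ∂P := by
  let T := (Fin n → S) × (Fin n → S)
  let X : Ω → T := fun ω => (fun i => A i ω, fun j => B j ω)
  have hX : Measurable X :=
    (measurable_pi_lambda _ hA).prodMk (measurable_pi_lambda _ hB)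
  let p : T → ℝ := fun t => P.real {ω | X ω = t}
  have hp0 : ∀ t, 0 ≤ p t := fun t => measureReal_nonneg
  have hp1 : ∑ t, p t = 1 := by
    have := expect_eq_sum P hX (fun _ => 1)
    simpa using this.symm
  let N : T → ℝ := fun t => ∑ i, ∑ j, if Forb (t.1 i) (t.2 j) then 1 else 0
  let W : T → ℝ := fun t => (∏ i, Q (t.1 i)) * ∏ j, Q (t.2 j)
  have hW0 : ∀ t, 0 < W t := fun t =>
    mul_pos (Finset.prod_pos fun _ _ => hQ _) (Finset.prod_pos fun _ _ => hQ _)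
  have hW1 : ∑ t, W t = 1 := by
    have h1 : ∑ α : Fin n → S, ∏ i, Q (α i) = 1 := by
      rw [← Fintype.piFinset_univ, Finset.sum_prod_piFinset]
      simp [hQ1]
    rw [Fintype.sum_prod_type]
    simp only [W, ← Finset.mul_sum, h1, mul_one]
  have hpN : ∀ t, p t ≤ Real.exp (-(c * N t)) := fun t => by
    have : {ω | X ω = t} = {ω | (∀ i, A i ω = t.1 i) ∧ ∀ j, B j ω = t.2 j} := by
      ext ω
      change X ω = t ↔ _
      rw [Prod.ext_iff, funext_iff, funext_iff]
      exact Iff.rfl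
    simp only [p, this]
    exact hP t.1 t.2
  -- Gibbs' inequality with an exponential tilt: apply `log z ≤ z - 1` to `z = W t * exp (c N t)`.
  -- The bound `p t * exp (c N t) ≤ 1` removes the tilt, and `W` and `p` have the same total mass.
  have key : ∑ t, p t * (Real.log (W t) + c * N t) ≤ 0 := by
    have h1 : ∀ t, p t * (Real.log (W t) + c * N t) ≤ W t - p t := fun t => by
      have h2 : Real.log (W t) + c * N t ≤ W t * Real.exp (c * N t) - 1 := by
        have := Real.add_one_le_exp (Real.log (W t) + c * N t)
        rw [Real.exp_add, Real.exp_log (hW0 t)] at this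
        linarith
      have h3 : p t * Real.exp (c * N t) ≤ 1 := by
        calc p t * Real.exp (c * N t) ≤ Real.exp (-(c * N t)) * Real.exp (c * N t) :=
              mul_le_mul_of_nonneg_right (hpN t) (Real.exp_pos _).le
          _ = 1 := by rw [← Real.exp_add]; simp
      calc p t * (Real.log (W t) + c * N t) ≤ p t * (W t * Real.exp (c * N t) - 1) :=
            mul_le_mul_of_nonneg_left h2 (hp0 t)
        _ = W t * (p t * Real.exp (c * N t)) - p t := by ring
        _ ≤ W t * 1 - p t := by gcongr; exact (hW0 t).le
        _ = _ := by ring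
    calc _ ≤ ∑ t, (W t - p t) := Finset.sum_le_sum fun t _ => h1 t
      _ = 0 := by rw [Finset.sum_sub_distrib, hW1, hp1, sub_self]
  have hforb : ∀ i j, P.real {ω | Forb (A i ω) (B j ω)} =
      ∑ t, p t * (if Forb (t.1 i) (t.2 j) then 1 else 0) := fun i j => by
    rw [← expect_eq_sum P hX (fun t : T => if Forb (t.1 i) (t.2 j) then (1 : ℝ) else 0)]
    have hm : MeasurableSet {ω | Forb (A i ω) (B j ω)} :=
      hX ((Set.toFinite {t : T | Forb (t.1 i) (t.2 j)}).measurableSet)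
    rw [← integral_indicator_one hm]
    refine integral_congr_ae (Eventually.of_forall fun ω => ?_)
    simp [Set.indicator, X]
  have hlogA : ∀ i, ∫ ω, -Real.log (Q (A i ω)) ∂P = ∑ t, p t * -Real.log (Q (t.1 i)) := fun i =>
    expect_eq_sum P hX (fun t : T => -Real.log (Q (t.1 i)))
  have hlogB : ∀ i, ∫ ω, -Real.log (Q (B i ω)) ∂P = ∑ t, p t * -Real.log (Q (t.2 i)) := fun i =>
    expect_eq_sum P hX (fun t : T => -Real.log (Q (t.2 i)))
  have hlogW : ∀ t, Real.log (W t) =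
      ∑ i, Real.log (Q (t.1 i)) + ∑ j, Real.log (Q (t.2 j)) := fun t => by
    rw [Real.log_mul (Finset.prod_pos fun _ _ => hQ _).ne' (Finset.prod_pos fun _ _ => hQ _).ne',
      Real.log_prod fun _ _ => (hQ _).ne', Real.log_prod fun _ _ => (hQ _).ne']
  have e1 : c * ∑ i, ∑ j, P.real {ω | Forb (A i ω) (B j ω)} = ∑ t, p t * (c * N t) := by
    simp only [hforb]
    have : ∀ i, ∑ j, ∑ t, p t * (if Forb (t.1 i) (t.2 j) then (1 : ℝ) else 0) =
        ∑ t, p t * ∑ j, (if Forb (t.1 i) (t.2 j) then (1 : ℝ) else 0) := fun i => by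
      rw [Finset.sum_comm]
      simp only [Finset.mul_sum]
    simp only [this]
    rw [Finset.sum_comm, Finset.mul_sum]
    refine Finset.sum_congr rfl fun t _ => ?_
    rw [← Finset.mul_sum]
    ring
  have e2 : ∑ i, ∫ ω, -Real.log (Q (A i ω)) ∂P + ∑ j, ∫ ω, -Real.log (Q (B j ω)) ∂P =
      -∑ t, p t * Real.log (W t) := by
    simp only [hlogA, hlogB, hlogW]
    rw [Finset.sum_comm, add_comm, Finset.sum_comm, ← Finset.sum_add_distrib,
      ← Finset.sum_neg_distrib]
    refine Finset.sum_congr rfl fun t _ => ?_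
    rw [← Finset.mul_sum, ← Finset.mul_sum, Finset.sum_neg_distrib, Finset.sum_neg_distrib]
    ring
  rw [e1, e2]
  have : ∑ t, p t * (Real.log (W t) + c * N t) =
      ∑ t, p t * Real.log (W t) + ∑ t, p t * (c * N t) := by
    rw [← Finset.sum_add_distrib]
    exact Finset.sum_congr rfl fun t _ => by ring
  linarith

end BipLocal

/-! ### Patterns of correlated copies: clash probabilities and decorrelation -/

namespace BipLocal

lemma volume_real_lt {q : ℝ} (h0 : 0 ≤ q) (h1 : q ≤ 1) :
    (volume : Measure I).real {x : I | (x : ℝ) < q} = q := by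
  have : {x : I | (x : ℝ) < q} = Set.Iio ⟨q, h0, h1⟩ := by
    ext x
    exact Iff.rfl
  rw [this, Measure.real, unitInterval.volume_Iio, ENNReal.toReal_ofReal h0]

lemma measurableSet_lt_I (q : ℝ) : MeasurableSet {x : I | (x : ℝ) < q} :=
  measurableSet_lt measurable_subtype_coe measurable_const

lemma volume_real_not_lt {q : ℝ} (h0 : 0 ≤ q) (h1 : q ≤ 1) :
    (volume : Measure I).real {x : I | ¬ (x : ℝ) < q} = 1 - q := by
  have := probReal_compl_eq_one_sub (μ := (volume : Measure I)) (measurableSet_lt_I q)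
  rw [volume_real_lt h0 h1] at this
  exact this

lemma pi_real_box {ι Y : Type*} [Fintype ι] [MeasurableSpace Y] (ρ : Measure Y)
    [IsProbabilityMeasure ρ] (J : Finset ι) (t : ι → Set Y) :
    (Measure.pi fun _ : ι => ρ).real {ω | ∀ z ∈ J, ω z ∈ t z} = ∏ z ∈ J, ρ.real (t z) := by
  have := Measure.pi_pi_finset (μ := fun _ : ι => ρ) t J
  rw [Measure.real, show {ω : ι → Y | ∀ z ∈ J, ω z ∈ t z} = (J : Set ι).pi t from rfl, this,
    ENNReal.toReal_prod]
  rfl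

variable {Y : Type}

/-- The law of independent site variables with law `ρ`. -/
noncomputable abbrev siteLaw [MeasurableSpace Y] (n : ℕ) (ρ : Measure Y) : Measure (Site n → Y) :=
  Measure.pi fun _ => ρ

/-- The outputs at `v` on the first `m` copies, the `k`-th copy having the site variables
`f k (ω z)`. -/
def pattern (g : LocalFunction) (s : ℕ) {n : ℕ} (q : ℝ) (f : ℕ → Y → I) (m : ℕ) (v : Bool × Fin n)
    (ω : Site n → Y) : Fin m → Bool :=
  fun k => out g s q v fun z => f k (ω z)

lemma pattern_apply (g : LocalFunction) (s : ℕ) {n : ℕ} (q : ℝ) (f : ℕ → Y → I) (m : ℕ)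
    (v : Bool × Fin n) (ω : Site n → Y) (k : Fin m) :
    pattern g s q f m v ω k = out g s q v fun z => f k (ω z) := rfl

/-- Two patterns clash if some copy chooses both vertices. -/
def Clash {m : ℕ} (a b : Fin m → Bool) : Prop := ∃ k, a k = true ∧ b k = true

instance {m : ℕ} : DecidableRel (Clash (m := m)) := fun a b => by
  unfold Clash
  infer_instance

lemma measurable_pattern [MeasurableSpace Y] (g : LocalFunction) (s : ℕ) {n : ℕ} (q : ℝ) {f : ℕ → Y → I}
    (hf : ∀ k, Measurable (f k)) (m : ℕ) (v : Bool × Fin n) :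
    Measurable (pattern g s q f m v) :=
  measurable_pi_lambda _ fun k => (measurable_out g s q v).comp
    (measurable_pi_lambda _ fun z => (hf k).comp (measurable_pi_apply z))

/-- A clash of `α i` and `β j` forces the edge `(i, j)` to be absent in a copy that depends only on
the two patterns. Different pairs use different, independent sites, so each clash costs a factor `1
- q`. The copies may be arbitrarily correlated: only one copy is inspected at each pair. -/
lemma prob_patterns_le [MeasurableSpace Y] {s : ℕ} {gl gr : LocalFunction} (hc : Compatible s gl gr) {n : ℕ} {q : ℝ}
    (h0 : 0 ≤ q) (h1 : q ≤ 1) (ρ : Measure Y) [IsProbabilityMeasure ρ] {f : ℕ → Y → I}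
    (hf : ∀ k, MeasurePreserving (f k) ρ volume) {m : ℕ} (α β : Fin n → Fin m → Bool) :
    (siteLaw n ρ).real {ω | (∀ i, pattern gl s q f m (false, i) ω = α i) ∧
        ∀ j, pattern gr s q f m (true, j) ω = β j} ≤
      Real.exp (-(q * ∑ i, ∑ j, if Clash (α i) (β j) then 1 else 0)) := by
  classical
  -- One clashing copy for each pair; the default `0` is never used, since only the pairs in `J` are
  -- constrained.
  let K : Fin n × Fin n → ℕ := fun p =>
    if h : Clash (α p.1) (β p.2) then (h.choose : ℕ) else 0
  let J : Finset (Fin n × Fin n) := Finset.univ.filter fun p => Clash (α p.1) (β p.2)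
  let J' : Finset (Site n) := J.map Function.Embedding.inl
  let t : Site n → Set Y := Sum.elim (fun p => {y | ¬ (f (K p) y : ℝ) < q}) fun _ => Set.univ
  have hsub : {ω : Site n → Y | (∀ i, pattern gl s q f m (false, i) ω = α i) ∧
      ∀ j, pattern gr s q f m (true, j) ω = β j} ⊆ {ω | ∀ z ∈ J', ω z ∈ t z} := by
    rintro ω ⟨hα, hβ⟩ z hz
    obtain ⟨p, hp, rfl⟩ := Finset.mem_map.1 hz
    have hp' : Clash (α p.1) (β p.2) := (Finset.mem_filter.1 hp).2
    have hK : K p = (hp'.choose : ℕ) := dif_pos hp'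
    change ¬ (f (K p) (ω (.inl p)) : ℝ) < q
    rw [hK]
    refine hc.not_lt (ξ := fun z => f hp'.choose (ω z)) (i := p.1) (j := p.2) ?_ ?_
    · rw [← pattern_apply gl s q f m, hα]
      exact hp'.choose_spec.1
    · rw [← pattern_apply gr s q f m, hβ]
      exact hp'.choose_spec.2
  have ht : ∀ z ∈ J', ρ.real (t z) = 1 - q := by
    intro z hz
    obtain ⟨p, hp, rfl⟩ := Finset.mem_map.1 hz
    rw [← volume_real_not_lt h0 h1, ← (hf (K p)).map_eq,
      map_measureReal_apply (hf (K p)).measurable (show MeasurableSet {x : I | ¬ (x : ℝ) < q} from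
        (measurableSet_lt_I q).compl)]
    rfl
  have hJ : (J.card : ℝ) = ∑ i, ∑ j, if Clash (α i) (β j) then 1 else 0 := by
    rw [Finset.card_filter, ← Fintype.sum_prod_type']
    push_cast
    rfl
  calc _ ≤ (siteLaw n ρ).real {ω | ∀ z ∈ J', ω z ∈ t z} := measureReal_mono hsub
    _ = (1 - q) ^ J.card := by
      rw [pi_real_box, Finset.prod_congr rfl ht, Finset.prod_const, Finset.card_map]
    _ ≤ Real.exp (-q) ^ J.card := by
      have := Real.add_one_le_exp (-q)
      exact pow_le_pow_left₀ (by linarith) (by linarith) _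
    _ = _ := by
      rw [← Real.exp_nat_mul, hJ]
      ring_nf

section Hybrid

variable [MeasurableSpace Y] {Z : Type} [Fintype Z]

/-- For a fixed set `c` the splice acts site by site, as a coordinate projection of a product law.
-/
lemma measurePreserving_splice (ρ : Measure Y) [IsProbabilityMeasure ρ] (c : Set Z)
    [DecidablePred (· ∈ c)] :
    MeasurePreserving (fun (p : (Z → Y) × (Z → Y)) z => if z ∈ c then p.1 z else p.2 z)
      ((Measure.pi fun _ => ρ).prod (Measure.pi fun _ => ρ)) (Measure.pi fun _ => ρ) := by
  have h1 := (measurePreserving_arrowProdEquivProdArrow Y Y Z (fun _ => ρ) (fun _ => ρ)).symm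
  have h2 : MeasurePreserving (fun (p : Z → Y × Y) z => if z ∈ c then (p z).1 else (p z).2)
      (Measure.pi fun _ => ρ.prod ρ) (Measure.pi fun _ => ρ) := by
    refine measurePreserving_pi (f := fun z (y : Y × Y) => if z ∈ c then y.1 else y.2)
      (fun _ => ρ.prod ρ) (fun _ => ρ) fun z => ?_
    by_cases hz : z ∈ c
    · simpa [hz] using measurePreserving_fst
    · simpa [hz] using measurePreserving_snd
  exact h2.comp h1

open Classical in
/-- Replacing the variables outside a stopping set by those of an independent copy does not change
the law. -/
lemma measurePreserving_hybrid (ρ : Measure Y) [IsProbabilityMeasure ρ] (C : (Z → Y) → Set Z)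
    (hCm : ∀ c, MeasurableSet {ω | C ω = c})
    (hstable : ∀ ω ω' : Z → Y, (∀ z ∈ C ω, ω z = ω' z) → C ω' = C ω) :
    MeasurePreserving (fun (p : (Z → Y) × (Z → Y)) z => if z ∈ C p.1 then p.1 z else p.2 z)
      ((Measure.pi fun _ => ρ).prod (Measure.pi fun _ => ρ)) (Measure.pi fun _ => ρ) := by
  let h : (Z → Y) × (Z → Y) → Z → Y := fun p z => if z ∈ C p.1 then p.1 z else p.2 z
  let sp : Set Z → (Z → Y) × (Z → Y) → Z → Y := fun c p z => if z ∈ c then p.1 z else p.2 z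
  have hsp := fun c => measurePreserving_splice (Z := Z) ρ c
  -- By the stopping property `C p.1 = c` holds exactly when `C (sp c p) = c`. Hence on each of
  -- these pieces the hybrid is the splice along a fixed set, and the spliced configuration itself
  -- tells which piece it belongs to.
  have hpre : ∀ A : Set (Z → Y), h ⁻¹' A = ⋃ c, sp c ⁻¹' (A ∩ {ω | C ω = c}) := by
    intro A
    ext p
    have key : ∀ c, C (sp c p) = c → C p.1 = c := fun c hc => by
      have := hstable (sp c p) p.1 fun z hz => by
        rw [hc] at hz
        simp [sp, hz]
      rw [this, hc]
    have key' : C (sp (C p.1) p) = C p.1 := hstable p.1 _ fun z hz => by simp [sp, hz]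
    simp only [Set.mem_preimage, Set.mem_iUnion, Set.mem_inter_iff]
    constructor
    · intro hp
      exact ⟨C p.1, hp, key'⟩
    · rintro ⟨c, hp, hc⟩
      have := key c hc
      subst this
      exact hp
  have hdisj : ∀ A : Set (Z → Y), Pairwise (Function.onFun Disjoint
      fun c => sp c ⁻¹' (A ∩ {ω | C ω = c})) := by
    intro A c c' hcc
    refine Set.disjoint_left.2 fun p hp hp' => hcc ?_
    have key : ∀ c, C (sp c p) = c → C p.1 = c := fun c hc => by
      have := hstable (sp c p) p.1 fun z hz => by
        rw [hc] at hz
        simp [sp, hz]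
      rw [this, hc]
    rw [← key c hp.2, ← key c' hp'.2]
  have hmeas : Measurable h := fun A hA => by
    rw [hpre]
    exact MeasurableSet.iUnion fun c => (hsp c).measurable (hA.inter (hCm c))
  refine ⟨hmeas, Measure.ext fun A hA => ?_⟩
  rw [Measure.map_apply hmeas hA, hpre, measure_iUnion (hdisj A)
    fun c => (hsp c).measurable (hA.inter (hCm c))]
  have : A = ⋃ c, A ∩ {ω | C ω = c} := by
    ext ω
    simp
  conv_rhs => rw [this]
  rw [measure_iUnion _ fun c => hA.inter (hCm c)]
  · refine tsum_congr fun c => ?_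
    exact (hsp c).measure_preimage (hA.inter (hCm c)).nullMeasurableSet
  · intro c c' hcc
    refine Set.disjoint_left.2 fun p hp hp' => hcc ?_
    rw [← show C p = c from hp.2, ← show C p = c' from hp'.2]

end Hybrid

/-- The union of the first `m` copies of the random graph. -/
def unionGraph {n : ℕ} (q : ℝ) (f : ℕ → Y → I) (m : ℕ) (ω : Site n → Y) :
    SimpleGraph (Bool × Fin n) :=
  bipGraph fun p => ∃ k < m, (f k (ω (.inl p)) : ℝ) < q

/-- The sites that are explored to find the ball of radius `s` around `u`. -/
def explored {n : ℕ} (H : SimpleGraph (Bool × Fin n)) (s : ℕ) (u : Bool × Fin n) : Set (Site n) :=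
  {z | (∃ p, z = .inl p ∧ ((false, p.1) ∈ ball H s u ∨ (true, p.2) ∈ ball H s u)) ∨
    ∃ v, z = .inr v ∧ v ∈ ball H s u}

lemma inl_mem_explored {n : ℕ} {H : SimpleGraph (Bool × Fin n)} {s : ℕ} {u a b : Bool × Fin n}
    (hab : a.1 ≠ b.1) :
    (.inl (pairSite a b) : Site n) ∈ explored H s u ↔ a ∈ ball H s u ∨ b ∈ ball H s u := by
  obtain ⟨a, i⟩ := a
  obtain ⟨b, j⟩ := b
  cases a <;> cases b <;> simp_all [explored, pairSite, or_comm]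

lemma inr_mem_explored {n : ℕ} {H : SimpleGraph (Bool × Fin n)} {s : ℕ} {u a : Bool × Fin n} :
    (.inr a : Site n) ∈ explored H s u ↔ a ∈ ball H s u := by
  constructor
  · rintro (⟨p, hp, _⟩ | ⟨v, hv, hb⟩)
    · cases hp
    · cases hv
      exact hb
  · exact fun h => Or.inr ⟨a, rfl, h⟩

lemma ball_eq_of_agree {V : Type} {H H' : SimpleGraph V} {s : ℕ} {u : V}
    (h : ∀ a ∈ ball H s u, ∀ b, H.Adj a b ↔ H'.Adj a b) : ball H' s u = ball H s u := by
  have := ball_image_of_localIso (G := H) (H := H') (ψ := id) (v := u) (s := s)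
    (fun r hr a ha w hw => ⟨w, (h a (ball_mono hr.le u ha) w).2 hw, rfl⟩)
    (fun a ha b _ => h a ha b) s le_rfl
  simpa using this

lemma siteGraph_le_unionGraph {n : ℕ} {q : ℝ} {f : ℕ → Y → I} {m k : ℕ} (hk : k < m)
    (ω : Site n → Y) : siteGraph q (fun z => f k (ω z)) ≤ unionGraph q f m ω :=
  fun _ _ h => ⟨h.1, k, hk, h.2⟩

/-- Every copy is a subgraph of the union graph, so a single ball of the union graph contains what
all the copies look at around `u`. -/
lemma pattern_congr (g : LocalFunction) {s n : ℕ} {q : ℝ} {f : ℕ → Y → I} {m : ℕ}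
    {u : Bool × Fin n} {ω ω' : Site n → Y}
    (hadj : ∀ a ∈ ball (unionGraph q f m ω) s u, ∀ b, ∀ k < m,
      (siteGraph q (fun z => f k (ω z))).Adj a b ↔ (siteGraph q (fun z => f k (ω' z))).Adj a b)
    (hlab : ∀ a ∈ ball (unionGraph q f m ω) s u, ω (.inr a) = ω' (.inr a)) :
    pattern g s q f m u ω = pattern g s q f m u ω' := by
  funext k
  have hb := ball_mono_graph (siteGraph_le_unionGraph (q := q) (f := f) k.2 ω)
  rw [pattern_apply, pattern_apply, out, out]
  refine g.eval_eq_of_localIso (ψ := id) (v := u) (Function.injective_id.injOn) ?_ ?_ ?_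
  · intro r hr a ha w hw
    exact ⟨w, (hadj a (hb s u (ball_mono hr.le u ha)) w k k.2).2 hw, rfl⟩
  · intro a ha b _
    exact hadj a (hb s u ha) b k k.2
  · intro a ha
    simp [hlab a (hb s u ha)]

lemma measurableSet_unionGraph [MeasurableSpace Y] {n : ℕ} (q : ℝ) {f : ℕ → Y → I} (hf : ∀ k, Measurable (f k)) (m : ℕ)
    (P : SimpleGraph (Bool × Fin n) → Prop) :
    MeasurableSet {ω : Site n → Y | P (unionGraph q f m ω)} := by
  have h : Measurable fun (ω : Site n → Y) (p : Fin n × Fin n) =>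
      ∃ k < m, (f k (ω (.inl p)) : ℝ) < q := by
    refine measurable_pi_lambda _ fun p => measurableSet_setOfPred.1 ?_
    have : {ω : Site n → Y | ∃ k < m, (f k (ω (.inl p)) : ℝ) < q} =
        ⋃ k, ⋃ _ : k < m, {ω | (f k (ω (.inl p)) : ℝ) < q} := by
      ext ω
      simp
    rw [this]
    refine MeasurableSet.iUnion fun k => MeasurableSet.iUnion fun _ =>
      measurableSet_lt ?_ measurable_const
    exact measurable_subtype_coe.comp ((hf k).comp (measurable_pi_apply _))
  exact h ((Set.toFinite {E : Fin n × Fin n → Prop | P (bipGraph E)}).measurableSet)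

/-- Couple two independent configurations to one: keep those sites of the first that its exploration
from `u` reveals, and take all other sites from the second. The hybrid has the law of one
configuration (`measurePreserving_hybrid`), and if the two explored regions are disjoint it shows
the first pattern at `u` and the second at `v`. -/
lemma pattern_decorrelation [MeasurableSpace Y] (gl gr : LocalFunction) {s n : ℕ} (q : ℝ) (ρ : Measure Y)
    [IsProbabilityMeasure ρ] {f : ℕ → Y → I} (hf : ∀ k, Measurable (f k)) (m : ℕ)
    (u v : Bool × Fin n) (F : (Fin m → Bool) → (Fin m → Bool) → Prop) :
    ((siteLaw n ρ).prod (siteLaw n ρ)).real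
        {p | F (pattern gl s q f m u p.1) (pattern gr s q f m v p.2)} ≤
      (siteLaw n ρ).real {ω | F (pattern gl s q f m u ω) (pattern gr s q f m v ω)} +
      ((siteLaw n ρ).prod (siteLaw n ρ)).real
        {p | ¬ Disjoint (ball (unionGraph q f m p.1) (s + 1) u)
          (ball (unionGraph q f m p.2) (s + 1) v)} := by
  classical
  let C : (Site n → Y) → Set (Site n) := fun ω => explored (unionGraph q f m ω) s u
  have hadj : ∀ (ω ω' : Site n → Y), (∀ z ∈ C ω, ω z = ω' z) →
      ∀ a ∈ ball (unionGraph q f m ω) s u, ∀ b, a.1 ≠ b.1 →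
        ω (.inl (pairSite a b)) = ω' (.inl (pairSite a b)) := fun ω ω' h a ha b hab =>
    h _ ((inl_mem_explored hab).2 (Or.inl ha))
  have hstable : ∀ ω ω' : Site n → Y, (∀ z ∈ C ω, ω z = ω' z) → C ω' = C ω := by
    intro ω ω' h
    have : ball (unionGraph q f m ω') s u = ball (unionGraph q f m ω) s u := by
      refine ball_eq_of_agree fun a ha b => ?_
      simp only [unionGraph, bipGraph_adj]
      refine and_congr_right fun hab => ?_
      rw [hadj ω ω' h a ha b hab]
    simp only [C, explored, this]
  have hyb := measurePreserving_hybrid ρ C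
    (fun c => measurableSet_unionGraph q hf m (fun H => explored H s u = c)) hstable
  have hS : MeasurableSet {ω | F (pattern gl s q f m u ω) (pattern gr s q f m v ω)} :=
    ((measurable_pattern gl s q hf m u).prodMk (measurable_pattern gr s q hf m v))
      ((Set.toFinite {t : (Fin m → Bool) × (Fin m → Bool) | F t.1 t.2}).measurableSet)
  have hmeq := hyb.measureReal_preimage hS.nullMeasurableSet
  rw [← hmeq]
  refine le_trans (measureReal_mono ?_) (measureReal_union_le _ _)
  rintro ⟨ω, ω'⟩ hF
  by_cases hd : Disjoint (ball (unionGraph q f m ω) (s + 1) u)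
    (ball (unionGraph q f m ω') (s + 1) v)
  swap
  · exact Or.inr hd
  left
  set ω₂ : Site n → Y := fun z => if z ∈ C ω then ω z else ω' z with hω₂
  change F (pattern gl s q f m u ω₂) (pattern gr s q f m v ω₂)
  have hag : ∀ z ∈ C ω, ω z = ω₂ z := fun z hz => by simp [hω₂, hz]
  have e1 : pattern gl s q f m u ω = pattern gl s q f m u ω₂ := by
    refine pattern_congr gl (fun a ha b k hk => ?_) fun a ha => ?_
    · simp only [siteGraph, bipGraph_adj]
      refine and_congr_right fun hab => ?_
      rw [hadj ω ω₂ hag a ha b hab]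
    · exact hag _ (inr_mem_explored.2 ha)
  have e2 : pattern gr s q f m v ω' = pattern gr s q f m v ω₂ := by
    refine pattern_congr gr (fun a ha b k hk => ?_) fun a ha => ?_
    · simp only [siteGraph, bipGraph_adj]
      refine and_congr_right fun hab => ?_
      have ha' : a ∈ ball (unionGraph q f m ω') (s + 1) v := ball_mono (Nat.le_succ s) v ha
      -- A site near `v` may still be overwritten, but only if its other end `b` lies in the ball of
      -- `u`. Then neither configuration has an edge there, since that edge would put `a` or `b`
      -- into both balls of radius `s + 1`. This is why disjointness is required at radius `s + 1`.
      by_cases hz : (.inl (pairSite a b) : Site n) ∈ C ω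
      · have h2 : ω₂ (.inl (pairSite a b)) = ω (.inl (pairSite a b)) := by simp [hω₂, hz]
        have hb : b ∈ ball (unionGraph q f m ω) s u := by
          rcases (inl_mem_explored hab).1 hz with h | h
          · exact (Set.disjoint_left.1 hd (ball_mono (Nat.le_succ s) u h) ha').elim
          · exact h
        rw [h2]
        constructor
        · intro h
          exact (Set.disjoint_left.1 hd (ball_mono (Nat.le_succ s) u hb)
            (mem_ball_succ.2 (Or.inr ⟨a, ha, hab, k, hk, h⟩))).elim
        · intro h
          refine (Set.disjoint_left.1 hd (mem_ball_succ.2 (Or.inr ⟨b, hb, hab.symm, k, hk, ?_⟩))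
            ha').elim
          rwa [← pairSite_comm hab]
      · simp [hω₂, hz]
    · have : (.inr a : Site n) ∉ C ω := fun h =>
        Set.disjoint_left.1 hd (ball_mono (Nat.le_succ s) u (inr_mem_explored.1 h))
          (ball_mono (Nat.le_succ s) v ha)
      simp [hω₂, this]
  rw [← e1, ← e2]
  exact hF

end BipLocal

/-! ### Sparsity: balls around two vertices rarely meet -/

namespace BipLocal

variable {Y : Type}

lemma eq_or_eq_of_pairSite_eq {n : ℕ} {a b c d : Bool × Fin n} (hab : a.1 ≠ b.1) (hcd : c.1 ≠ d.1)
    (h : pairSite a b = pairSite c d) : (a = c ∧ b = d) ∨ (a = d ∧ b = c) := by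
  obtain ⟨a, i⟩ := a
  obtain ⟨b, j⟩ := b
  obtain ⟨c, k⟩ := c
  obtain ⟨d, l⟩ := d
  cases a <;> cases b <;> cases c <;> cases d <;> simp_all [pairSite]

lemma prob_union_lt_le [MeasurableSpace Y] (ρ : Measure Y) [IsProbabilityMeasure ρ]
    {f : ℕ → Y → I} (hf : ∀ k, MeasurePreserving (f k) ρ volume) {q : ℝ} (h0 : 0 ≤ q) (h1 : q ≤ 1)
    (m : ℕ) : ρ.real {y | ∃ k < m, (f k y : ℝ) < q} ≤ m * q := by
  have : {y | ∃ k < m, (f k y : ℝ) < q} = ⋃ k ∈ Finset.range m, {y | (f k y : ℝ) < q} := by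
    ext y
    simp
  rw [this]
  refine (measureReal_biUnion_finset_le _ _).trans (le_of_eq ?_)
  have h : ∀ k, ρ.real {y | (f k y : ℝ) < q} = q := fun k => by
    conv_rhs => rw [← volume_real_lt h0 h1, ← (hf k).map_eq,
      map_measureReal_apply (hf k).measurable (measurableSet_lt_I q)]
    rfl
  simp [h]

/-- Injectivity of the path makes its edges distinct sites, hence independent; each is present in
some copy with probability at most `m q`. -/
lemma prob_path_le [MeasurableSpace Y] (ρ : Measure Y) [IsProbabilityMeasure ρ]
    {f : ℕ → Y → I} (hf : ∀ k, MeasurePreserving (f k) ρ volume) {n : ℕ} {q : ℝ} (h0 : 0 ≤ q)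
    (h1 : q ≤ 1) (m : ℕ) {l : ℕ} (p : Fin (l + 1) → Bool × Fin n) (hp : Function.Injective p) :
    (siteLaw n ρ).real {ω | ∀ i : Fin l, (unionGraph q f m ω).Adj (p i.castSucc) (p i.succ)} ≤
      (m * q) ^ l := by
  have hmq : 0 ≤ m * q := by positivity
  by_cases hside : ∀ i : Fin l, (p i.castSucc).1 ≠ (p i.succ).1
  swap
  · push Not at hside
    obtain ⟨i, hi⟩ := hside
    have : {ω : Site n → Y | ∀ i : Fin l, (unionGraph q f m ω).Adj (p i.castSucc) (p i.succ)} = ∅ :=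
      Set.eq_empty_of_forall_notMem fun ω h => (h i).1 hi
    rw [this, measureReal_empty]
    positivity
  have hinj : Function.Injective fun i : Fin l =>
      (.inl (pairSite (p i.castSucc) (p i.succ)) : Site n) := by
    intro i j hij
    rcases eq_or_eq_of_pairSite_eq (hside i) (hside j) (Sum.inl_injective hij) with h | h
    · exact Fin.castSucc_injective _ (hp h.1)
    · have e1 := congrArg Fin.val (hp h.1)
      have e2 := congrArg Fin.val (hp h.2)
      simp at e1 e2
      omega
  let J : Finset (Site n) := Finset.univ.map ⟨_, hinj⟩
  let t : Site n → Set Y := fun _ => {y | ∃ k < m, (f k y : ℝ) < q}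
  calc _ ≤ (siteLaw n ρ).real {ω | ∀ z ∈ J, ω z ∈ t z} := by
        refine measureReal_mono fun ω h z hz => ?_
        obtain ⟨i, -, rfl⟩ := Finset.mem_map.1 hz
        exact (h i).2
    _ = ∏ z ∈ J, ρ.real (t z) := pi_real_box ρ J t
    _ ≤ ∏ _z ∈ J, (m * q) :=
        Finset.prod_le_prod (fun _ _ => measureReal_nonneg) fun _ _ => prob_union_lt_le ρ hf h0 h1 m
    _ = _ := by simp [J]

lemma exists_path_of_mem_ball {V : Type} {G : SimpleGraph V} {r : ℕ} {w u : V}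
    (h : u ∈ ball G r w) : ∃ l ≤ r, ∃ t : Fin l → V,
      Function.Injective (Fin.cons w t : Fin (l + 1) → V) ∧
      (Fin.cons w t : Fin (l + 1) → V) (Fin.last l) = u ∧
      ∀ i : Fin l, G.Adj ((Fin.cons w t : Fin (l + 1) → V) i.castSucc)
        ((Fin.cons w t : Fin (l + 1) → V) i.succ) := by
  classical
  obtain ⟨p, hp⟩ := mem_ball_iff_exists_walk.1 h
  let p' := p.bypass
  have hpath : p'.IsPath := p.bypass_isPath
  have hlen : p'.length ≤ r := p.length_bypass_le_length.trans hp
  have hcons : (Fin.cons w (fun i : Fin p'.length => p'.getVert (i + 1)) :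
      Fin (p'.length + 1) → V) = fun i : Fin (p'.length + 1) => p'.getVert i := by
    funext i
    refine Fin.cases ?_ (fun i => ?_) i
    · simp
    · simp
  refine ⟨p'.length, hlen, fun i => p'.getVert (i + 1), ?_, ?_, ?_⟩
  · rw [hcons]
    intro i j hij
    exact Fin.ext (hpath.getVert_injOn (Nat.lt_succ_iff.1 i.2) (Nat.lt_succ_iff.1 j.2) hij)
  · rw [hcons]
    simp
  · rw [hcons]
    intro i
    simpa using p'.adj_getVert_succ i.2

/-- Union bound over the paths from `w`: there are at most `(2n)^l` of length `l`, each present with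
probability at most `(m q)^l`. For `q = d / n` the bound does not depend on `n`. -/
lemma expected_ball_le [MeasurableSpace Y] (ρ : Measure Y) [IsProbabilityMeasure ρ]
    {f : ℕ → Y → I} (hf : ∀ k, MeasurePreserving (f k) ρ volume) {n : ℕ} {q : ℝ} (h0 : 0 ≤ q)
    (h1 : q ≤ 1) (m r : ℕ) (w : Bool × Fin n) :
    ∑ u, (siteLaw n ρ).real {ω | u ∈ ball (unionGraph q f m ω) r w} ≤
      ∑ l ∈ Finset.range (r + 1), (2 * n * (m * q)) ^ l := by
  classical
  let P : (l : ℕ) → (Fin l → Bool × Fin n) → Fin (l + 1) → Bool × Fin n := fun l t => Fin.cons w t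
  let E : (l : ℕ) → (Fin l → Bool × Fin n) → Set (Site n → Y) := fun l t =>
    {ω | ∀ i : Fin l, (unionGraph q f m ω).Adj (P l t i.castSucc) (P l t i.succ)}
  have hmq : 0 ≤ m * q := by positivity
  have hu : ∀ u, (siteLaw n ρ).real {ω | u ∈ ball (unionGraph q f m ω) r w} ≤
      ∑ l ∈ Finset.range (r + 1), ∑ t : Fin l → Bool × Fin n,
        if P l t (Fin.last l) = u then (m * q) ^ l else 0 := by
    intro u
    have hsub : {ω : Site n → Y | u ∈ ball (unionGraph q f m ω) r w} ⊆
        ⋃ l ∈ Finset.range (r + 1), ⋃ t ∈ (Finset.univ.filter fun t : Fin l → Bool × Fin n =>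
          Function.Injective (P l t) ∧ P l t (Fin.last l) = u), E l t := by
      intro ω h
      obtain ⟨l, hl, t, ht1, ht2, ht3⟩ := exists_path_of_mem_ball h
      simp only [Set.mem_iUnion]
      exact ⟨l, by simpa using Nat.lt_succ_iff.2 hl, t, by simpa using ⟨ht1, ht2⟩, ht3⟩
    refine (measureReal_mono hsub (measure_ne_top _ _)).trans ((measureReal_biUnion_finset_le _ _).trans
      (Finset.sum_le_sum fun l _ => (measureReal_biUnion_finset_le _ _).trans ?_))
    rw [Finset.sum_filter]
    refine Finset.sum_le_sum fun t _ => ?_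
    by_cases h2 : P l t (Fin.last l) = u
    · by_cases h3 : Function.Injective (P l t)
      · simp only [h2, h3, and_self, if_true]
        exact prob_path_le ρ hf h0 h1 m (P l t) h3
      · simp only [h2, h3, false_and, if_true, if_false]
        positivity
    · simp [h2]
  calc _ ≤ ∑ u, ∑ l ∈ Finset.range (r + 1), ∑ t : Fin l → Bool × Fin n,
        if P l t (Fin.last l) = u then (m * q) ^ l else 0 := Finset.sum_le_sum fun u _ => hu u
    _ = ∑ l ∈ Finset.range (r + 1), ∑ t : Fin l → Bool × Fin n, (m * q) ^ l := by
      rw [Finset.sum_comm]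
      refine Finset.sum_congr rfl fun l _ => ?_
      rw [Finset.sum_comm]
      simp
    _ = _ := by
      refine Finset.sum_congr rfl fun l _ => ?_
      simp [mul_pow]

/-- If the balls meet at `w`, then both endpoints lie in balls around `w`, in two independent
configurations. Summing over the endpoints therefore gives a product of two expected ball sizes for
each of the `2n` choices of `w`. For `q = d / n` this is of order `n`, against `n^2` pairs. -/
lemma sum_prob_not_disjoint_le [MeasurableSpace Y] (ρ : Measure Y) [IsProbabilityMeasure ρ]
    {f : ℕ → Y → I} (hf : ∀ k, MeasurePreserving (f k) ρ volume) {n : ℕ} {q : ℝ} (h0 : 0 ≤ q)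
    (h1 : q ≤ 1) (m r : ℕ) :
    ∑ i, ∑ j, ((siteLaw n ρ).prod (siteLaw n ρ)).real
        {p | ¬ Disjoint (ball (unionGraph q f m p.1) r (false, i))
          (ball (unionGraph q f m p.2) r (true, j))} ≤
      2 * n * (∑ l ∈ Finset.range (r + 1), (2 * n * (m * q)) ^ l) ^ 2 := by
  set C := ∑ l ∈ Finset.range (r + 1), (2 * n * (m * q)) ^ l
  let b : Bool × Fin n → Bool × Fin n → ℝ := fun w u =>
    (siteLaw n ρ).real {ω | u ∈ ball (unionGraph q f m ω) r w}
  have hb0 : ∀ w u, 0 ≤ b w u := fun _ _ => measureReal_nonneg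
  have hC : ∀ w, ∑ u, b w u ≤ C := expected_ball_le ρ hf h0 h1 m r
  have hside : ∀ w c, ∑ i, b w (c, i) ≤ C := fun w c => by
    refine le_trans ?_ (hC w)
    rw [Fintype.sum_prod_type]
    exact Finset.single_le_sum (f := fun c => ∑ i, b w (c, i))
      (fun c _ => Finset.sum_nonneg fun i _ => hb0 _ _) (Finset.mem_univ c)
  have hij : ∀ i j, ((siteLaw n ρ).prod (siteLaw n ρ)).real
        {p | ¬ Disjoint (ball (unionGraph q f m p.1) r (false, i))
          (ball (unionGraph q f m p.2) r (true, j))} ≤ ∑ w, b w (false, i) * b w (true, j) := by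
    intro i j
    have hsub : {p : (Site n → Y) × (Site n → Y) |
        ¬ Disjoint (ball (unionGraph q f m p.1) r (false, i))
          (ball (unionGraph q f m p.2) r (true, j))} ⊆
        ⋃ w ∈ (Finset.univ : Finset (Bool × Fin n)),
          {ω | (false, i) ∈ ball (unionGraph q f m ω) r w} ×ˢ
          {ω | (true, j) ∈ ball (unionGraph q f m ω) r w} := by
      intro p hp
      obtain ⟨w, hw1, hw2⟩ := Set.not_disjoint_iff.1 hp
      simp only [Set.mem_iUnion]
      exact ⟨w, Finset.mem_univ w, mem_ball_comm.1 hw1, mem_ball_comm.1 hw2⟩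
    refine (measureReal_mono hsub (measure_ne_top _ _)).trans ((measureReal_biUnion_finset_le _ _).trans (le_of_eq ?_))
    exact Finset.sum_congr rfl fun w _ => measureReal_prod_prod _ _
  calc _ ≤ ∑ i, ∑ j, ∑ w, b w (false, i) * b w (true, j) :=
        Finset.sum_le_sum fun i _ => Finset.sum_le_sum fun j _ => hij i j
    _ = ∑ w, (∑ i, b w (false, i)) * ∑ j, b w (true, j) := by
      simp only [Finset.sum_mul_sum]
      rw [Finset.sum_comm (s := (Finset.univ : Finset (Bool × Fin n)))]
      exact Finset.sum_congr rfl fun i _ => Finset.sum_comm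
    _ ≤ ∑ _w : Bool × Fin n, C * C := by
      refine Finset.sum_le_sum fun w _ => mul_le_mul (hside w _) (hside w _)
        (Finset.sum_nonneg fun _ _ => hb0 _ _) ?_
      exact (Finset.sum_nonneg fun _ _ => hb0 w _).trans (hC w)
    _ = _ := by
      rw [Finset.sum_const, Finset.card_univ, Fintype.card_prod, Fintype.card_bool,
        Fintype.card_fin, nsmul_eq_mul]
      push_cast
      ring

end BipLocal

/-! ### Densities of newly chosen vertices and the main inequality -/

namespace BipLocal

variable {Y : Type}

/-- The event that copy `k` chooses `v`. -/
def chosen (g : LocalFunction) (s : ℕ) {n : ℕ} (q : ℝ) (f : ℕ → Y → I) (v : Bool × Fin n) (k : ℕ) :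
    Set (Site n → Y) :=
  {ω | out g s q v (fun z => f k (ω z)) = true}

/-- The event that copy `k` is the first one to choose `v`. -/
def newlyChosen (g : LocalFunction) (s : ℕ) {n : ℕ} (q : ℝ) (f : ℕ → Y → I) (v : Bool × Fin n)
    (k : ℕ) : Set (Site n → Y) :=
  {ω | ω ∈ chosen g s q f v k ∧ ∀ j < k, ω ∉ chosen g s q f v j}

lemma newlyChosen_subset (g : LocalFunction) (s : ℕ) {n : ℕ} (q : ℝ) (f : ℕ → Y → I)
    (v : Bool × Fin n) (k : ℕ) : newlyChosen g s q f v k ⊆ chosen g s q f v k := fun _ h => h.1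

lemma newlyChosen_eq_of_mem {g : LocalFunction} {s n : ℕ} {q : ℝ} {f : ℕ → Y → I}
    {v : Bool × Fin n} {k l : ℕ} {ω : Site n → Y} (hk : ω ∈ newlyChosen g s q f v k)
    (hl : ω ∈ newlyChosen g s q f v l) : k = l := by
  rcases lt_trichotomy k l with h | h | h
  · exact (hl.2 k h hk.1).elim
  · exact h
  · exact (hk.2 l h hl.1).elim

/-- The average over the vertices of side `c` of the probability to be chosen. -/
noncomputable def avgChosen (g : LocalFunction) (s n : ℕ) (q : ℝ) (c : Bool) : ℝ :=
  (∑ i : Fin n, (siteLaw n volume).real {ξ | out g s q (c, i) ξ = true}) / n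

/-- The average over the vertices of side `c` of the probability to be chosen first by copy `k`. -/
noncomputable def avgNew [MeasurableSpace Y] (g : LocalFunction) (s n : ℕ) (q : ℝ) (ρ : Measure Y)
    (f : ℕ → Y → I) (c : Bool) (k : ℕ) : ℝ :=
  (∑ i : Fin n, (siteLaw n ρ).real (newlyChosen g s q f (c, i) k)) / n

section

variable [MeasurableSpace Y]

lemma avgNew_nonneg (g : LocalFunction) (s n : ℕ) (q : ℝ) (ρ : Measure Y)
    (f : ℕ → Y → I) (c : Bool) (k : ℕ) : 0 ≤ avgNew g s n q ρ f c k :=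
  div_nonneg (Finset.sum_nonneg fun _ _ => measureReal_nonneg) (Nat.cast_nonneg n)

lemma measurableSet_chosen (g : LocalFunction) (s : ℕ) {n : ℕ} (q : ℝ) {f : ℕ → Y → I}
    (hf : ∀ k, Measurable (f k)) (v : Bool × Fin n) (k : ℕ) :
    MeasurableSet (chosen g s q f v k) :=
  ((measurable_out g s q v).comp (measurable_pi_lambda (fun (ω : Site n → Y) z => f k (ω z))
    fun z => (hf k).comp (measurable_pi_apply z))) (measurableSet_singleton true)

lemma measurableSet_newlyChosen (g : LocalFunction) (s : ℕ) {n : ℕ} (q : ℝ) {f : ℕ → Y → I}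
    (hf : ∀ k, Measurable (f k)) (v : Bool × Fin n) (k : ℕ) :
    MeasurableSet (newlyChosen g s q f v k) := by
  have : newlyChosen g s q f v k =
      chosen g s q f v k ∩ ⋂ j, ⋂ _ : j < k, (chosen g s q f v j)ᶜ := by
    ext ω
    simp [newlyChosen]
  rw [this]
  exact (measurableSet_chosen g s q hf v k).inter (MeasurableSet.iInter fun j =>
    MeasurableSet.iInter fun _ => (measurableSet_chosen g s q hf v j).compl)

lemma prob_chosen (g : LocalFunction) (s : ℕ) {n : ℕ} (q : ℝ) (ρ : Measure Y)
    [IsProbabilityMeasure ρ] {f : ℕ → Y → I} (hf : ∀ k, MeasurePreserving (f k) ρ volume)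
    (v : Bool × Fin n) (k : ℕ) :
    (siteLaw n ρ).real (chosen g s q f v k) =
      (siteLaw n volume).real {ξ | out g s q v ξ = true} := by
  have h := measurePreserving_pi (ι := Site n) (fun _ => ρ) (fun _ => (volume : Measure I))
    (f := fun _ => f k) fun _ => hf k
  have hm : MeasurableSet {ξ : Site n → I | out g s q v ξ = true} :=
    measurable_out g s q v (measurableSet_singleton true)
  exact h.measureReal_preimage hm.nullMeasurableSet

lemma avgNew_zero (g : LocalFunction) (s n : ℕ) (q : ℝ) (ρ : Measure Y) [IsProbabilityMeasure ρ]
    {f : ℕ → Y → I} (hf : ∀ k, MeasurePreserving (f k) ρ volume) (c : Bool) :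
    avgNew g s n q ρ f c 0 = avgChosen g s n q c := by
  unfold avgNew avgChosen
  congr 1
  refine Finset.sum_congr rfl fun i _ => ?_
  rw [← prob_chosen g s q ρ hf (c, i) 0]
  congr 1
  ext ω
  simp [newlyChosen]

/-- A nonzero pattern has a unique first copy that chooses the vertex. -/
lemma prob_pattern_ne (g : LocalFunction) (s : ℕ) {n : ℕ} (q : ℝ) (ρ : Measure Y)
    [IsProbabilityMeasure ρ] {f : ℕ → Y → I} (hf : ∀ k, Measurable (f k)) (m : ℕ)
    (v : Bool × Fin n) :
    (siteLaw n ρ).real {ω | pattern g s q f m v ω ≠ fun _ => false} =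
      ∑ k ∈ Finset.range m, (siteLaw n ρ).real (newlyChosen g s q f v k) := by
  classical
  rw [← measureReal_biUnion_finset (fun k _ l _ hkl => Set.disjoint_left.2 fun ω hk hl =>
    hkl (newlyChosen_eq_of_mem hk hl)) (fun k _ => measurableSet_newlyChosen g s q hf v k)]
  congr 1
  ext ω
  simp only [Set.mem_iUnion, Finset.mem_range]
  constructor
  · intro h
    have h' : ∃ k, k < m ∧ ω ∈ chosen g s q f v k := by
      by_contra hcon
      push Not at hcon
      refine h (funext fun k => ?_)
      have := hcon k k.2
      simpa [chosen, pattern] using this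
    refine ⟨Nat.find h', (Nat.find_spec h').1, (Nat.find_spec h').2, fun j hj hjc => ?_⟩
    exact Nat.find_min h' hj ⟨hj.trans (Nat.find_spec h').1, hjc⟩
  · rintro ⟨k, hk, hnew⟩ h
    have := congrFun h ⟨k, hk⟩
    have h2 : out g s q v (fun z => f k (ω z)) = true := hnew.1
    rw [pattern_apply] at this
    simp [h2] at this

/-- Count a clash at copy `k` only if `k` is the first copy to choose one of the two vertices. These
events are disjoint: after a clash at `k` neither vertex can be newly chosen later.
Inclusion–exclusion under independence gives the three terms. -/
lemma prob_clash_ge (gl gr : LocalFunction) (s : ℕ) {n : ℕ} (q : ℝ) (ρ : Measure Y)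
    [IsProbabilityMeasure ρ] {f : ℕ → Y → I} (hf : ∀ k, MeasurePreserving (f k) ρ volume) (m : ℕ)
    (u v : Bool × Fin n) :
    ∑ k ∈ Finset.range m,
      ((siteLaw n ρ).real (newlyChosen gl s q f u k) *
          (siteLaw n volume).real {ξ | out gr s q v ξ = true} +
        (siteLaw n volume).real {ξ | out gl s q u ξ = true} *
          (siteLaw n ρ).real (newlyChosen gr s q f v k) -
        (siteLaw n ρ).real (newlyChosen gl s q f u k) *
          (siteLaw n ρ).real (newlyChosen gr s q f v k)) ≤
      ((siteLaw n ρ).prod (siteLaw n ρ)).real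
        {p | Clash (pattern gl s q f m u p.1) (pattern gr s q f m v p.2)} := by
  have hm := fun k => (hf k).measurable
  let A := newlyChosen gl s q f u
  let A' := chosen gl s q f u
  let B := newlyChosen gr s q f v
  let B' := chosen gr s q f v
  have hA := measurableSet_newlyChosen gl s q hm u
  have hA' := measurableSet_chosen gl s q hm u
  have hB := measurableSet_newlyChosen gr s q hm v
  have hB' := measurableSet_chosen gr s q hm v
  let F : ℕ → Set ((Site n → Y) × (Site n → Y)) := fun k => A k ×ˢ B' k ∪ A' k ×ˢ B k
  have hF : ∀ k, ((siteLaw n ρ).prod (siteLaw n ρ)).real (F k) =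
      (siteLaw n ρ).real (A k) * (siteLaw n volume).real {ξ | out gr s q v ξ = true} +
        (siteLaw n volume).real {ξ | out gl s q u ξ = true} * (siteLaw n ρ).real (B k) -
        (siteLaw n ρ).real (A k) * (siteLaw n ρ).real (B k) := by
    intro k
    have h := measureReal_union_add_inter (μ := (siteLaw n ρ).prod (siteLaw n ρ))
      (s := A k ×ˢ B' k) (t := A' k ×ˢ B k) ((hA' k).prod (hB k))
    rw [Set.prod_inter_prod, Set.inter_eq_left.2 (newlyChosen_subset gl s q f u k),
      Set.inter_eq_right.2 (newlyChosen_subset gr s q f v k), measureReal_prod_prod,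
      measureReal_prod_prod, measureReal_prod_prod] at h
    rw [← prob_chosen gr s q ρ hf v k, ← prob_chosen gl s q ρ hf u k]
    exact eq_sub_of_add_eq h
  rw [← Finset.sum_congr rfl fun k _ => hF k, ← measureReal_biUnion_finset]
  · refine measureReal_mono (fun p hp => ?_) (measure_ne_top _ _)
    simp only [Set.mem_iUnion, Finset.mem_range] at hp
    obtain ⟨k, hk, hp⟩ := hp
    have : p.1 ∈ A' k ∧ p.2 ∈ B' k := by
      rcases hp with h | h
      · exact ⟨h.1.1, h.2⟩
      · exact ⟨h.1, h.2.1⟩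
    exact ⟨⟨k, hk⟩, this.1, this.2⟩
  · have key : ∀ k l, k < l → Disjoint (F k) (F l) := by
      intro k l hkl
      refine Set.disjoint_left.2 fun p hk hl => ?_
      have h1 : p.1 ∈ A' k ∧ p.2 ∈ B' k := by
        rcases hk with h | h
        · exact ⟨h.1.1, h.2⟩
        · exact ⟨h.1, h.2.1⟩
      rcases hl with h | h
      · exact h.1.2 k hkl h1.1
      · exact h.2.2 k hkl h1.2
    intro k _ l _ hkl
    rcases lt_or_gt_of_ne hkl with h | h
    · exact key k l h
    · exact (key l k h).symm
  · intro k _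
    exact ((hA k).prod (hB' k)).union ((hA' k).prod (hB k))

/-- The weights used in the first moment bound. -/
noncomputable def patternWeight (d : ℝ) (m : ℕ) (a : Fin m → Bool) : ℝ :=
  if a = fun _ => false then 1 - (2 ^ m - 1) / (d * 2 ^ m) else 1 / (d * 2 ^ m)

lemma patternWeight_sum (d : ℝ) (m : ℕ) : ∑ a, patternWeight d m a = 1 := by
  unfold patternWeight
  rw [← Finset.add_sum_erase _ _ (Finset.mem_univ fun _ : Fin m => false), if_pos rfl,
    Finset.sum_congr rfl fun a ha => if_neg (Finset.ne_of_mem_erase ha), Finset.sum_const,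
    Finset.card_erase_of_mem (Finset.mem_univ _)]
  have : (Finset.univ : Finset (Fin m → Bool)).card = 2 ^ m := by simp
  rw [this, nsmul_eq_mul, Nat.cast_sub Nat.one_le_two_pow]
  push_cast
  ring

lemma one_sub_le_patternWeight {d : ℝ} (hd : 2 ≤ d) (m : ℕ) :
    1 - 1 / d ≤ patternWeight d m fun _ => false := by
  rw [patternWeight, if_pos rfl]
  have h2 : (0 : ℝ) < 2 ^ m := by positivity
  have : (2 ^ m - 1) / (d * 2 ^ m) ≤ 1 / d := by
    rw [div_le_div_iff₀ (by positivity) (by positivity)]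
    nlinarith
  linarith

lemma patternWeight_pos {d : ℝ} (hd : 2 ≤ d) (m : ℕ) (a : Fin m → Bool) :
    0 < patternWeight d m a := by
  by_cases h : a = fun _ => false
  · rw [h]
    have : 1 / d ≤ 1 / 2 := one_div_le_one_div_of_le (by norm_num) hd
    linarith [one_sub_le_patternWeight hd m]
  · rw [patternWeight, if_neg h]
    positivity

/-- The weights are tuned so that a nonzero pattern costs `log d + m log 2` and the zero pattern
costs only `O(1/d)`. With boundedly many copies, choosing a vertex thus costs about `log d`, no
matter how many copies choose it. -/
lemma neg_log_patternWeight_le {d : ℝ} (hd : 2 ≤ d) (m : ℕ) (a : Fin m → Bool) :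
    -Real.log (patternWeight d m a) ≤
      (Real.log d + m * Real.log 2) * (if a = fun _ => false then 0 else 1) + 2 / d := by
  have hd0 : 0 < d := by linarith
  by_cases h : a = fun _ => false
  · rw [if_pos h, h, mul_zero, zero_add]
    have hpos := patternWeight_pos hd m fun _ => false
    have h1 := one_sub_le_patternWeight hd m
    have h2 : (1 : ℝ) - 1 / d = (d - 1) / d := by field_simp
    have h3 : 0 < (d - 1) / d := div_pos (by linarith) hd0
    have h4 := Real.log_le_log (h2 ▸ h3) h1
    have h5 := Real.one_sub_inv_le_log_of_pos h3
    rw [h2] at h4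
    -- The left side is `1 / (d - 1)`, so this is where `2 ≤ d` enters.
    have h6 : ((d - 1) / d)⁻¹ - 1 ≤ 2 / d := by
      rw [inv_div, div_sub_one (by linarith), div_le_div_iff₀ (by linarith) hd0]
      linarith
    linarith
  · rw [if_neg h, patternWeight, if_neg h, one_div, Real.log_inv, neg_neg,
      Real.log_mul hd0.ne' (by positivity), Real.log_pow, mul_one]
    have : 0 ≤ 2 / d := by positivity
    linarith

lemma integral_neg_log_patternWeight_le {d : ℝ} (hd : 2 ≤ d) (g : LocalFunction) (s : ℕ) {n : ℕ}
    (q : ℝ) (ρ : Measure Y) [IsProbabilityMeasure ρ] {f : ℕ → Y → I} (hf : ∀ k, Measurable (f k))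
    (m : ℕ) (v : Bool × Fin n) :
    ∫ ω, -Real.log (patternWeight d m (pattern g s q f m v ω)) ∂(siteLaw n ρ) ≤
      (Real.log d + m * Real.log 2) *
        (∑ k ∈ Finset.range m, (siteLaw n ρ).real (newlyChosen g s q f v k)) + 2 / d := by
  classical
  have hX := measurable_pattern g s q hf m v
  rw [expect_eq_sum _ hX (fun a => -Real.log (patternWeight d m a)),
    ← prob_pattern_ne g s q ρ hf m v]
  have hset : MeasurableSet {ω | pattern g s q f m v ω ≠ fun _ => false} :=
    hX (Set.toFinite {a : Fin m → Bool | a ≠ fun _ => false}).measurableSet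
  have h1 := expect_eq_sum (siteLaw n ρ) hX (fun a => if a = fun _ => false then (0 : ℝ) else 1)
  have h2 : ∫ ω, (if pattern g s q f m v ω = fun _ => false then (0 : ℝ) else 1) ∂(siteLaw n ρ) =
      (siteLaw n ρ).real {ω | pattern g s q f m v ω ≠ fun _ => false} := by
    rw [← integral_indicator_one hset]
    refine integral_congr_ae (Eventually.of_forall fun ω => ?_)
    by_cases h : pattern g s q f m v ω = fun _ => false <;> simp [h, Set.indicator]
  have h3 := expect_eq_sum (siteLaw n ρ) hX (fun _ => (1 : ℝ))
  simp only [integral_const, probReal_univ, smul_eq_mul, mul_one] at h3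
  rw [← h2, h1]
  calc _ ≤ ∑ a, (siteLaw n ρ).real {ω | pattern g s q f m v ω = a} *
        ((Real.log d + m * Real.log 2) * (if a = fun _ => false then 0 else 1) + 2 / d) :=
        Finset.sum_le_sum fun a _ =>
          mul_le_mul_of_nonneg_left (neg_log_patternWeight_le hd m a) measureReal_nonneg
    _ = (Real.log d + m * Real.log 2) * (∑ a, (siteLaw n ρ).real
          {ω | pattern g s q f m v ω = a} * (if a = fun _ => false then 0 else 1)) +
        2 / d * ∑ a, (siteLaw n ρ).real {ω | pattern g s q f m v ω = a} := by
      rw [Finset.mul_sum, Finset.mul_sum, ← Finset.sum_add_distrib]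
      exact Finset.sum_congr rfl fun a _ => by ring
    _ = _ := by rw [← h3, mul_one]

/-- The main inequality between the densities of the correlated copies. -/
lemma density_inequality {s : ℕ} {gl gr : LocalFunction} (hc : Compatible s gl gr) {n : ℕ}
    (hn : 0 < n) {d : ℝ} (hd : 2 ≤ d) (hdn : d ≤ n) (ρ : Measure Y) [IsProbabilityMeasure ρ]
    {f : ℕ → Y → I} (hf : ∀ k, MeasurePreserving (f k) ρ volume) (m : ℕ) :
    d * (∑ k ∈ Finset.range m,
        (avgNew gl s n (d / n) ρ f false k * avgChosen gr s n (d / n) true +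
          avgChosen gl s n (d / n) false * avgNew gr s n (d / n) ρ f true k -
          avgNew gl s n (d / n) ρ f false k * avgNew gr s n (d / n) ρ f true k)) ≤
      (∑ k ∈ Finset.range m, (avgNew gl s n (d / n) ρ f false k +
        avgNew gr s n (d / n) ρ f true k)) * (Real.log d + m * Real.log 2) + 4 / d +
      d * (2 * (∑ l ∈ Finset.range (s + 2), (2 * m * d) ^ l) ^ 2 / n) := by
  classical
  have hm := fun k => (hf k).measurable
  have hn' : (0 : ℝ) < n := by exact_mod_cast hn
  set q := d / n with hq
  have h0 : 0 ≤ q := by positivity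
  have h1 : q ≤ 1 := div_le_one_of_le₀ hdn hn'.le
  have hqn : n * q = d := by rw [hq]; field_simp
  set P := siteLaw n ρ
  have first := expected_forbidden_le P (fun i => measurable_pattern gl s q hm m (false, i))
    (fun i => measurable_pattern gr s q hm m (true, i)) Clash q
    (prob_patterns_le hc h0 h1 ρ hf) (patternWeight d m) (patternWeight_pos hd m)
    (patternWeight_sum d m)
  let x : Fin n → ℕ → ℝ := fun i k => P.real (newlyChosen gl s q f (false, i) k)
  let y : Fin n → ℕ → ℝ := fun i k => P.real (newlyChosen gr s q f (true, i) k)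
  let a : Fin n → ℝ := fun i => (siteLaw n volume).real {ξ | out gl s q (false, i) ξ = true}
  let b : Fin n → ℝ := fun i => (siteLaw n volume).real {ξ | out gr s q (true, i) ξ = true}
  set E := ∑ l ∈ Finset.range (s + 2), (2 * m * d) ^ l with hE
  set L := Real.log d + m * Real.log 2
  have hsum : ∀ z : Fin n → ℝ, ∑ i, z i = n * ((∑ i, z i) / n) := fun z => by field_simp
  have upL : ∑ i, ∫ ω, -Real.log (patternWeight d m (pattern gl s q f m (false, i) ω)) ∂P ≤
      n * (L * ∑ k ∈ Finset.range m, avgNew gl s n q ρ f false k + 2 / d) := by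
    calc _ ≤ ∑ i, (L * (∑ k ∈ Finset.range m, x i k) + 2 / d) :=
          Finset.sum_le_sum fun i _ => integral_neg_log_patternWeight_le hd gl s q ρ hm m (false, i)
      _ = _ := by
        rw [Finset.sum_add_distrib, ← Finset.mul_sum, Finset.sum_comm,
          Finset.sum_congr rfl fun k _ => hsum fun i => x i k, ← Finset.mul_sum]
        simp only [Finset.sum_const, Finset.card_univ, Fintype.card_fin, nsmul_eq_mul]
        rw [mul_add, mul_left_comm]
        rfl
  have upR : ∑ i, ∫ ω, -Real.log (patternWeight d m (pattern gr s q f m (true, i) ω)) ∂P ≤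
      n * (L * ∑ k ∈ Finset.range m, avgNew gr s n q ρ f true k + 2 / d) := by
    calc _ ≤ ∑ i, (L * (∑ k ∈ Finset.range m, y i k) + 2 / d) :=
          Finset.sum_le_sum fun i _ => integral_neg_log_patternWeight_le hd gr s q ρ hm m (true, i)
      _ = _ := by
        rw [Finset.sum_add_distrib, ← Finset.mul_sum, Finset.sum_comm,
          Finset.sum_congr rfl fun k _ => hsum fun i => y i k, ← Finset.mul_sum]
        simp only [Finset.sum_const, Finset.card_univ, Fintype.card_fin, nsmul_eq_mul]
        rw [mul_add, mul_left_comm]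
        rfl
  -- Sum over all pairs the clash bound for independent configurations, transferred to one
  -- configuration at the price of the pairs whose balls meet.
  have low : n ^ 2 * (∑ k ∈ Finset.range m,
        (avgNew gl s n q ρ f false k * avgChosen gr s n q true +
          avgChosen gl s n q false * avgNew gr s n q ρ f true k -
          avgNew gl s n q ρ f false k * avgNew gr s n q ρ f true k)) ≤
      ∑ i, ∑ j, P.real {ω | Clash (pattern gl s q f m (false, i) ω)
        (pattern gr s q f m (true, j) ω)} + 2 * n * E ^ 2 := by
    have e1 : ∀ i j, ∑ k ∈ Finset.range m, (x i k * b j + a i * y j k - x i k * y j k) ≤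
        P.real {ω | Clash (pattern gl s q f m (false, i) ω) (pattern gr s q f m (true, j) ω)} +
        (P.prod P).real {p | ¬ Disjoint (ball (unionGraph q f m p.1) (s + 1) (false, i))
          (ball (unionGraph q f m p.2) (s + 1) (true, j))} := fun i j =>
      (prob_clash_ge gl gr s q ρ hf m (false, i) (true, j)).trans
        (pattern_decorrelation gl gr q ρ hm m (false, i) (true, j) Clash)
    have e2 := Finset.sum_le_sum fun i (_ : i ∈ Finset.univ) =>
      Finset.sum_le_sum fun j (_ : j ∈ Finset.univ) => e1 i j
    have e3 := sum_prob_not_disjoint_le ρ hf (n := n) h0 h1 m (s + 1)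
    have e4 : 2 * (n : ℝ) * (m * q) = 2 * m * d := by rw [← hqn]; ring
    rw [e4] at e3
    simp only [Finset.sum_add_distrib] at e2
    refine le_trans (le_of_eq ?_) (e2.trans (add_le_add_right e3 _))
    have e5 : ∀ k, ∑ i, ∑ j, (x i k * b j + a i * y j k - x i k * y j k) =
        n ^ 2 * (avgNew gl s n q ρ f false k * avgChosen gr s n q true +
          avgChosen gl s n q false * avgNew gr s n q ρ f true k -
          avgNew gl s n q ρ f false k * avgNew gr s n q ρ f true k) := fun k => by
      have h : ∀ i, ∑ j, (x i k * b j + a i * y j k - x i k * y j k) =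
          x i k * (∑ j, b j) + a i * (∑ j, y j k) - x i k * ∑ j, y j k := fun i => by
        rw [Finset.sum_sub_distrib, Finset.sum_add_distrib, ← Finset.mul_sum, ← Finset.mul_sum,
          ← Finset.mul_sum]
      simp only [h]
      rw [Finset.sum_sub_distrib, Finset.sum_add_distrib, ← Finset.sum_mul, ← Finset.sum_mul,
        ← Finset.sum_mul, hsum fun i => x i k, hsum b, hsum a, hsum fun i => y i k]
      simp only [avgNew, avgChosen, x, y, a, b, P]
      ring
    rw [Finset.mul_sum, ← Finset.sum_congr rfl fun k _ => e5 k, Finset.sum_comm]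
    exact Finset.sum_congr rfl fun i _ => Finset.sum_comm
  set S := ∑ k ∈ Finset.range m,
        (avgNew gl s n q ρ f false k * avgChosen gr s n q true +
          avgChosen gl s n q false * avgNew gr s n q ρ f true k -
          avgNew gl s n q ρ f false k * avgNew gr s n q ρ f true k)
  set T := ∑ i, ∑ j, P.real {ω | Clash (pattern gl s q f m (false, i) ω)
        (pattern gr s q f m (true, j) ω)}
  rw [Finset.sum_add_distrib]
  set X := ∑ k ∈ Finset.range m, avgNew gl s n q ρ f false k
  set W := ∑ k ∈ Finset.range m, avgNew gr s n q ρ f true k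
  have h2 : q * (n ^ 2 * S) ≤ q * T + q * (2 * n * E ^ 2) := by
    rw [← mul_add]
    exact mul_le_mul_of_nonneg_left low h0
  have h3 : n * (d * S) ≤ n * ((X + W) * L + 4 / d + d * (2 * E ^ 2 / n)) := by
    calc n * (d * S) = q * (n ^ 2 * S) := by rw [← hqn]; ring
      _ ≤ n * (L * X + 2 / d) + n * (L * W + 2 / d) + q * (2 * n * E ^ 2) := by linarith
      _ = _ := by
        have : q * (2 * n * E ^ 2) = n * (d * (2 * E ^ 2 / n)) := by
          rw [← hqn]; field_simp
        rw [this]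
        ring
  exact le_of_mul_le_mul_left h3 hn'

end

end BipLocal

/-! ### Interpolating between an identical and an independent copy -/

namespace BipLocal

variable {Y : Type}

/-- Add a copy `k` to a family of copies, a site of which is resampled with probability `t` and
agrees with that of copy `0` otherwise. -/
noncomputable def addCopy (f : ℕ → Y → I) (k : ℕ) (t : ℝ) (j : ℕ) (y : Y × I × I) : I :=
  if j = k then (if (y.2.2 : ℝ) < t then y.2.1 else f 0 y.1) else f j y.1

lemma chosen_addCopy_of_ne (g : LocalFunction) (s : ℕ) {n : ℕ} (q : ℝ) (f : ℕ → Y → I) {k j : ℕ}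
    (hj : j ≠ k) (t : ℝ) (v : Bool × Fin n) :
    chosen g s q (addCopy f k t) v j =
      (fun (ω : Site n → Y × I × I) z => (ω z).1) ⁻¹' chosen g s q f v j := by
  ext ω
  simp [chosen, addCopy, hj]

lemma newlyChosen_addCopy_of_lt (g : LocalFunction) (s : ℕ) {n : ℕ} (q : ℝ) (f : ℕ → Y → I)
    {k j : ℕ} (hj : j < k) (t : ℝ) (v : Bool × Fin n) :
    newlyChosen g s q (addCopy f k t) v j =
      (fun (ω : Site n → Y × I × I) z => (ω z).1) ⁻¹' newlyChosen g s q f v j := by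
  ext ω
  simp only [newlyChosen, Set.mem_preimage]
  refine and_congr ?_ (forall₂_congr fun i hi => not_congr ?_)
  · rw [chosen_addCopy_of_ne g s q f hj.ne t v]
    rfl
  · rw [chosen_addCopy_of_ne g s q f (hi.trans hj).ne t v]
    rfl

/-- At rate `0` the added copy repeats copy `0`, so it is never the first to choose. -/
lemma newlyChosen_addCopy_zero (g : LocalFunction) (s : ℕ) {n : ℕ} (q : ℝ)
    (f : ℕ → Y → I) {k : ℕ} (hk : 0 < k) (v : Bool × Fin n) :
    newlyChosen g s q (addCopy f k 0) v k = ∅ := by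
  refine Set.eq_empty_of_forall_notMem fun ω hω => hω.2 0 hk ?_
  have h := hω.1
  have hz : ∀ z, ¬ ((ω z).2.2 : ℝ) < 0 := fun z => not_lt.2 (ω z).2.2.2.1
  simpa [chosen, addCopy, hz, hk.ne] using h

variable [MeasurableSpace Y]

/-- Either source of the new value is uniform, and the switch is independent of both. -/
lemma measurePreserving_addCopy (ρ : Measure Y) [IsProbabilityMeasure ρ] {f : ℕ → Y → I}
    (hf : ∀ k, MeasurePreserving (f k) ρ volume) (k : ℕ) (t : ℝ) (j : ℕ) :
    MeasurePreserving (addCopy f k t j) (ρ.prod (volume : Measure (I × I))) volume := by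
  by_cases hj : j = k
  swap
  · have : addCopy f k t j = f j ∘ Prod.fst := by
      funext y
      simp [addCopy, hj]
    rw [this]
    exact (hf j).comp measurePreserving_fst
  have hB : MeasurableSet {b : I | (b : ℝ) < t} := measurableSet_lt_I t
  have hmeas : Measurable (addCopy f k t j) := by
    have : addCopy f k t j = fun y => if (y.2.2 : ℝ) < t then y.2.1 else f 0 y.1 := by
      funext y
      simp [addCopy, hj]
    rw [this]
    exact Measurable.ite (measurable_snd.comp measurable_snd hB) (measurable_fst.comp measurable_snd)
      ((hf 0).measurable.comp measurable_fst)
  refine ⟨hmeas, Measure.ext fun A hA => ?_⟩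
  rw [Measure.map_apply hmeas hA]
  have hpre : addCopy f k t j ⁻¹' A = Set.univ ×ˢ (A ×ˢ {b : I | (b : ℝ) < t}) ∪
      (f 0 ⁻¹' A) ×ˢ (Set.univ ×ˢ {b : I | (b : ℝ) < t}ᶜ) := by
    ext y
    by_cases hy : (y.2.2 : ℝ) < t <;> simp [addCopy, hj, hy]
  rw [hpre, measure_union]
  · rw [Measure.prod_prod, Measure.prod_prod, Measure.volume_eq_prod, Measure.prod_prod,
      Measure.prod_prod, (hf 0).measure_preimage hA.nullMeasurableSet, measure_univ, measure_univ,
      one_mul, one_mul, ← mul_add, measure_add_measure_compl hB, measure_univ, mul_one]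
  · refine Set.disjoint_left.2 fun y h1 h2 => h2.2.2 h1.2.2
  · exact ((hf 0).measurable hA).prod (MeasurableSet.univ.prod hB.compl)

lemma avgNew_addCopy_of_lt (g : LocalFunction) (s n : ℕ) (q : ℝ) (ρ : Measure Y)
    [IsProbabilityMeasure ρ] {f : ℕ → Y → I} (hf : ∀ k, Measurable (f k)) {k j : ℕ} (hj : j < k)
    (t : ℝ) (c : Bool) :
    avgNew g s n q (ρ.prod (volume : Measure (I × I))) (addCopy f k t) c j =
      avgNew g s n q ρ f c j := by
  unfold avgNew
  congr 1
  refine Finset.sum_congr rfl fun i _ => ?_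
  rw [newlyChosen_addCopy_of_lt g s q f hj]
  have h := measurePreserving_pi (ι := Site n) (fun _ => ρ.prod (volume : Measure (I × I)))
    (fun _ => ρ) (f := fun _ => Prod.fst) fun _ => measurePreserving_fst
  exact h.measureReal_preimage (measurableSet_newlyChosen g s q hf (c, i) j).nullMeasurableSet

lemma volume_real_Ico_le (t t' : ℝ) (h : t ≤ t') :
    (volume : Measure I).real {b : I | t ≤ b ∧ (b : ℝ) < t'} ≤ t' - t := by
  rw [Measure.real, unitInterval.volume_apply]
  have hsub : Subtype.val '' {b : I | t ≤ b ∧ (b : ℝ) < t'} ⊆ Set.Ico t t' := by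
    rintro _ ⟨b, hb, rfl⟩
    exact hb
  have := measure_mono (μ := (volume : Measure ℝ)) hsub
  rw [Real.volume_Ico] at this
  exact ENNReal.toReal_le_of_le_ofReal (by linarith) this

/-- Use the same switch variables for both rates: the configurations agree unless some switch falls
between `t` and `t'`. This gives a Lipschitz bound in the rate, hence the continuity needed for the
intermediate value theorem. -/
lemma prob_newlyChosen_addCopy_le (g : LocalFunction) (s : ℕ) {n : ℕ} (q : ℝ) (ρ : Measure Y)
    [IsProbabilityMeasure ρ] (f : ℕ → Y → I) (k : ℕ) (v : Bool × Fin n) (t t' : ℝ) :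
    (siteLaw n (ρ.prod (volume : Measure (I × I)))).real (newlyChosen g s q (addCopy f k t) v k) ≤
      (siteLaw n (ρ.prod (volume : Measure (I × I)))).real
        (newlyChosen g s q (addCopy f k t') v k) + Fintype.card (Site n) * |t - t'| := by
  let N : Set (Site n → Y × I × I) := ⋃ z ∈ (Finset.univ : Finset (Site n)),
    {ω | ∀ z' ∈ ({z} : Finset (Site n)), ω z' ∈ (Set.univ : Set Y) ×ˢ (Set.univ : Set I) ×ˢ
      {b : I | min t t' ≤ b ∧ (b : ℝ) < max t t'}}
  have hN : (siteLaw n (ρ.prod (volume : Measure (I × I)))).real N ≤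
      Fintype.card (Site n) * |t - t'| := by
    refine (measureReal_biUnion_finset_le _ _).trans ?_
    rw [← Finset.card_univ, ← nsmul_eq_mul]
    refine Finset.sum_le_card_nsmul _ _ _ fun z _ => ?_
    rw [pi_real_box, Finset.prod_singleton, measureReal_prod_prod, Measure.volume_eq_prod,
      measureReal_prod_prod, probReal_univ, probReal_univ, one_mul, one_mul]
    refine (volume_real_Ico_le _ _ min_le_max).trans (le_of_eq ?_)
    rw [max_sub_min_eq_abs, abs_sub_comm]
  refine le_trans (measureReal_mono (s₂ := newlyChosen g s q (addCopy f k t') v k ∪ N) ?_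
    (measure_ne_top _ _)) ((measureReal_union_le _ _).trans (add_le_add_right hN _))
  intro ω hω
  by_cases hωN : ω ∈ N
  · exact Or.inr hωN
  left
  have hb : ∀ z, ((ω z).2.2 : ℝ) < t ↔ ((ω z).2.2 : ℝ) < t' := by
    intro z
    by_contra hcon
    refine hωN ?_
    simp only [N, Set.mem_iUnion]
    refine ⟨z, Finset.mem_univ z, fun z' hz' => ?_⟩
    rw [Finset.mem_singleton.1 hz']
    refine ⟨trivial, trivial, ?_⟩
    rcases le_or_gt t ((ω z).2.2 : ℝ) with h1 | h1 <;>
      rcases le_or_gt t' ((ω z).2.2 : ℝ) with h2 | h2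
    · exact (hcon (by simp [not_lt.2 h1, not_lt.2 h2])).elim
    · exact ⟨(min_le_left _ _).trans h1, h2.trans_le (le_max_right _ _)⟩
    · exact ⟨(min_le_right _ _).trans h2, h1.trans_le (le_max_left _ _)⟩
    · exact (hcon (by simp [h1, h2])).elim
  have he : ∀ j, (fun z => addCopy f k t j (ω z)) = fun z => addCopy f k t' j (ω z) := by
    intro j
    funext z
    simp only [addCopy, hb]
  have hch : ∀ j, ω ∈ chosen g s q (addCopy f k t) v j ↔
      ω ∈ chosen g s q (addCopy f k t') v j := by
    intro j
    change out g s q v (fun z => addCopy f k t j (ω z)) = true ↔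
      out g s q v (fun z => addCopy f k t' j (ω z)) = true
    rw [he j]
  exact ⟨(hch k).1 hω.1, fun j hj h => hω.2 j hj ((hch j).2 h)⟩

lemma continuous_avgNew_addCopy (g : LocalFunction) (s n : ℕ) (q : ℝ) (ρ : Measure Y)
    [IsProbabilityMeasure ρ] (f : ℕ → Y → I) (k : ℕ) (c : Bool) :
    Continuous fun t =>
      avgNew g s n q (ρ.prod (volume : Measure (I × I))) (addCopy f k t) c k := by
  unfold avgNew
  refine (continuous_finsetSum _ fun i _ => ?_).div_const _
  refine (LipschitzWith.of_dist_le_mul (K := Fintype.card (Site n)) fun t t' => ?_).continuous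
  have h1 := prob_newlyChosen_addCopy_le g s q ρ f k (c, i) t t'
  have h2 := prob_newlyChosen_addCopy_le g s q ρ f k (c, i) t' t
  rw [abs_sub_comm] at h2
  rw [Real.dist_eq, Real.dist_eq, abs_le]
  push_cast
  constructor <;> linarith

/-- Switches are at most `1`, so at rate `2` every site is resampled, including those with switch
exactly `1`. The new copy is independent of the earlier ones, hence the product of its probability
to choose with the probability that no earlier copy has chosen. -/
lemma prob_newlyChosen_addCopy_two (g : LocalFunction) (s : ℕ) {n : ℕ} (q : ℝ) (ρ : Measure Y)
    [IsProbabilityMeasure ρ] {f : ℕ → Y → I} (hf : ∀ k, Measurable (f k)) (k : ℕ)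
    (v : Bool × Fin n) :
    (siteLaw n (ρ.prod (volume : Measure (I × I)))).real (newlyChosen g s q (addCopy f k 2) v k) =
      (siteLaw n volume).real {ξ | out g s q v ξ = true} *
        (1 - ∑ j ∈ Finset.range k, (siteLaw n ρ).real (newlyChosen g s q f v j)) := by
  let S : Set (Site n → Y) := {ω | pattern g s q f k v ω ≠ fun _ => false}ᶜ
  let T : Set (Site n → I × I) := {ζ | out g s q v (fun z => (ζ z).1) = true}
  have hSm : MeasurableSet {ω | pattern g s q f k v ω ≠ fun _ => false} :=
    (measurable_pattern g s q hf k v)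
      (Set.toFinite {a : Fin k → Bool | a ≠ fun _ => false}).measurableSet
  have hOm : MeasurableSet {ξ : Site n → I | out g s q v ξ = true} :=
    measurable_out g s q v (measurableSet_singleton true)
  have hfst := measurePreserving_pi (ι := Site n) (fun _ => (volume : Measure (I × I)))
    (fun _ => (volume : Measure I)) (f := fun _ => Prod.fst) fun _ => by
      rw [Measure.volume_eq_prod]
      exact measurePreserving_fst
  have hTm : MeasurableSet T := hfst.measurable hOm
  have hT : (siteLaw n (volume : Measure (I × I))).real T =
      (siteLaw n volume).real {ξ | out g s q v ξ = true} :=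
    hfst.measureReal_preimage hOm.nullMeasurableSet
  have hS : (siteLaw n ρ).real S =
      1 - ∑ j ∈ Finset.range k, (siteLaw n ρ).real (newlyChosen g s q f v j) := by
    rw [← prob_pattern_ne g s q ρ hf k v, ← probReal_compl_eq_one_sub hSm]
  have harr := measurePreserving_arrowProdEquivProdArrow Y (I × I) (Site n) (fun _ => ρ)
    (fun _ => volume)
  have hset : newlyChosen g s q (addCopy f k 2) v k =
      MeasurableEquiv.arrowProdEquivProdArrow Y (I × I) (Site n) ⁻¹' (S ×ˢ T) := by
    ext ω
    have h2 : ∀ z, ((ω z).2.2 : ℝ) < 2 := fun z => (ω z).2.2.2.2.trans_lt (by norm_num)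
    have e1 : ω ∈ chosen g s q (addCopy f k 2) v k ↔ (fun z => (ω z).2) ∈ T := by
      simp [chosen, addCopy, h2, T]
    have e2 : (∀ j < k, ω ∉ chosen g s q (addCopy f k 2) v j) ↔ (fun z => (ω z).1) ∈ S := by
      have e3 : ∀ j < k, (ω ∉ chosen g s q (addCopy f k 2) v j ↔
          out g s q v (fun z => f j (ω z).1) = false) := fun j hj => by
        rw [chosen_addCopy_of_ne g s q f hj.ne]
        simp [chosen]
      simp only [S, Set.mem_compl_iff]
      constructor
      · intro h hne
        exact hne (funext fun j => (e3 j j.2).1 (h j j.2))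
      · intro h j hj
        refine (e3 j hj).2 ?_
        by_contra hcon
        exact h fun heq => hcon (congrFun heq ⟨j, hj⟩)
    change (_ ∧ _) ↔ (_ ∧ _)
    rw [e1, e2, and_comm]
    rfl
  rw [hset, harr.measureReal_preimage ((hSm.compl).prod hTm).nullMeasurableSet,
    measureReal_prod_prod]
  change (siteLaw n ρ).real S * (siteLaw n (volume : Measure (I × I))).real T = _
  rw [hS, hT, mul_comm]

end BipLocal

namespace BipLocal

/-- There are correlated copies each of which, after the first, newly chooses a prescribed density
`θ` of vertices. -/
lemma exists_copies (gl gr : LocalFunction) (s : ℕ) {n : ℕ} (hn : 0 < n) (q : ℝ) {θ p A : ℝ}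
    (hθ : 0 ≤ θ) (hp0 : 0 ≤ p) (hθp : θ ≤ p / 2)
    (hp : ∀ i, p ≤ (siteLaw n volume).real {ξ | out gl s q (false, i) ξ = true})
    (hA : avgChosen gl s n q false ≤ A) (m : ℕ) (hm : A + m * θ ≤ 1 / 2) :
    ∃ (Y : Type) (_ : MeasurableSpace Y) (ρ : Measure Y) (_ : IsProbabilityMeasure ρ)
      (f : ℕ → Y → I), (∀ k, MeasurePreserving (f k) ρ volume) ∧
      ∀ k, 0 < k → k < m → avgNew gl s n q ρ f false k + avgNew gr s n q ρ f true k = θ := by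
  induction m with
  | zero =>
    exact ⟨I, inferInstance, volume, inferInstance, fun _ => id, fun _ => MeasurePreserving.id _,
      fun k _ hk => (Nat.not_lt_zero k hk).elim⟩
  | succ m ih =>
    obtain ⟨Y, _, ρ, _, f, hf, hval⟩ := ih (by
      push_cast at hm
      linarith)
    -- If the copy being added is copy `0`, no density is prescribed and any family will do.
    rcases Nat.eq_zero_or_pos m with rfl | hm0
    · exact ⟨Y, _, ρ, ‹_›, f, hf, fun k h0 hk => by omega⟩
    have hmeas := fun k => (hf k).measurable
    let h : ℝ → ℝ := fun t =>
      avgNew gl s n q (ρ.prod (volume : Measure (I × I))) (addCopy f m t) false m +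
      avgNew gr s n q (ρ.prod (volume : Measure (I × I))) (addCopy f m t) true m
    have hcont : Continuous h := (continuous_avgNew_addCopy gl s n q ρ f m false).add
      (continuous_avgNew_addCopy gr s n q ρ f m true)
    have hz : h 0 = 0 := by
      simp [h, avgNew, newlyChosen_addCopy_zero _ s q f hm0]
    have hsum : ∑ j ∈ Finset.range m, avgNew gl s n q ρ f false j ≤ A + m * θ := by
      obtain ⟨m', rfl⟩ := Nat.exists_eq_succ_of_ne_zero hm0.ne'
      rw [Finset.sum_range_succ', avgNew_zero gl s n q ρ hf]
      have : ∑ j ∈ Finset.range m', avgNew gl s n q ρ f false (j + 1) ≤ m' * θ := by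
        rw [← nsmul_eq_mul]
        refine (Finset.sum_le_card_nsmul _ _ θ fun j hj => ?_).trans (by simp)
        have := hval (j + 1) (Nat.succ_pos j) (by simpa using hj)
        linarith [avgNew_nonneg gr s n q ρ f true (j + 1)]
      push_cast
      nlinarith
    -- At most half of the left vertices are used up on average, so an independent copy newly
    -- chooses a left density of at least `p / 2`. The right side only adds to it.
    have htwo : θ ≤ h 2 := by
      have hn' : (0 : ℝ) < n := by exact_mod_cast hn
      have h1 : p * (1 - ∑ j ∈ Finset.range m, avgNew gl s n q ρ f false j) ≤
          avgNew gl s n q (ρ.prod (volume : Measure (I × I))) (addCopy f m 2) false m := by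
        rw [avgNew, le_div_iff₀ hn']
        have h2 : ∀ i : Fin n, p * (1 - ∑ j ∈ Finset.range m,
            (siteLaw n ρ).real (newlyChosen gl s q f (false, i) j)) ≤
            (siteLaw n (ρ.prod (volume : Measure (I × I)))).real
              (newlyChosen gl s q (addCopy f m 2) (false, i) m) := fun i => by
          rw [prob_newlyChosen_addCopy_two gl s q ρ hmeas]
          refine mul_le_mul_of_nonneg_right (hp i) ?_
          rw [← prob_pattern_ne gl s q ρ hmeas m (false, i), sub_nonneg]
          exact measureReal_le_one
        refine le_trans (le_of_eq ?_) (Finset.sum_le_sum fun i _ => h2 i)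
        rw [← Finset.mul_sum, Finset.sum_sub_distrib, Finset.sum_comm]
        simp only [avgNew, ← Finset.sum_div, Finset.sum_const, Finset.card_univ, Fintype.card_fin,
          nsmul_eq_mul]
        field_simp
      have h3 : 0 ≤ avgNew gr s n q (ρ.prod (volume : Measure (I × I))) (addCopy f m 2) true m :=
        avgNew_nonneg _ _ _ _ _ _ _ _
      have h4 : A + m * θ ≤ 1 / 2 := by
        push_cast at hm
        linarith
      have h5 : p * (1 / 2) ≤ p * (1 - ∑ j ∈ Finset.range m, avgNew gl s n q ρ f false j) :=
        mul_le_mul_of_nonneg_left (by linarith) hp0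
      simp only [h]
      linarith
    obtain ⟨t, -, ht⟩ := intermediate_value_Icc (by norm_num : (0 : ℝ) ≤ 2) hcont.continuousOn
      (show θ ∈ Set.Icc (h 0) (h 2) from ⟨hz.trans_le hθ, htwo⟩)
    refine ⟨Y × I × I, inferInstance, ρ.prod volume, inferInstance, addCopy f m t,
      measurePreserving_addCopy ρ hf m t, fun k hk0 hk => ?_⟩
    rcases Nat.lt_succ_iff_lt_or_eq.1 hk with hk | rfl
    · rw [avgNew_addCopy_of_lt gl s n q ρ hmeas hk, avgNew_addCopy_of_lt gr s n q ρ hmeas hk]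
      exact hval k hk0 hk
    · exact ht

end BipLocal

/-! ### Placing a tree in the random graph -/

namespace BipLocal

lemma inTree_cons {N : List ℕ → ℕ} {i : ℕ} {w : List ℕ} :
    InTree N (i :: w) ↔ InTree N w ∧ i < N w := Iff.rfl

lemma finite_tree (N : List ℕ → ℕ) (s : ℕ) : {w | InTree N w ∧ w.length < s}.Finite := by
  induction s with
  | zero => simp
  | succ s ih =>
    refine ((ih.biUnion fun w _ => (Set.finite_Iio (N w)).image (· :: w)).union
      (Set.finite_singleton [])).subset ?_
    rintro w ⟨hw, hlen⟩
    cases w with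
    | nil => exact Or.inr rfl
    | cons i w =>
      left
      simp only [Set.mem_iUnion]
      exact ⟨w, ⟨hw.1, by simpa using hlen⟩, i, hw.2, rfl⟩

/-- The vertices of depth less than `s` of the tree with offspring numbers `N`. -/
noncomputable def interior (N : List ℕ → ℕ) (s : ℕ) : Finset (List ℕ) := (finite_tree N s).toFinset

lemma mem_interior {N : List ℕ → ℕ} {s : ℕ} {w : List ℕ} :
    w ∈ interior N s ↔ InTree N w ∧ w.length < s := by
  simp [interior]

lemma gwTree_adj {N : List ℕ → ℕ} {u v : List ℕ} :
    (gwTree N).Adj u v ↔ (InTree N v ∧ ∃ i, v = i :: u) ∨ (InTree N u ∧ ∃ i, u = i :: v) := by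
  rw [gwTree, SimpleGraph.fromRel_adj]
  refine ⟨fun h => h.2, fun h => ⟨?_, h⟩⟩
  rintro rfl
  rcases h with ⟨-, i, hi⟩ | ⟨-, i, hi⟩ <;> simpa using congrArg List.length hi

lemma mem_ball_gwTree {N : List ℕ → ℕ} {r : ℕ} {w : List ℕ} :
    w ∈ ball (gwTree N) r [] ↔ InTree N w ∧ w.length ≤ r := by
  induction r generalizing w with
  | zero =>
    rw [ball_zero]
    constructor
    · rintro rfl
      exact ⟨trivial, le_rfl⟩
    · rintro ⟨-, h⟩
      exact List.eq_nil_of_length_eq_zero (Nat.le_zero.1 h)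
  | succ r ih =>
    rw [mem_ball_succ, ih]
    constructor
    · rintro (h | ⟨u, hu, hadj⟩)
      · exact ⟨h.1, h.2.trans (Nat.le_succ r)⟩
      · rw [ih] at hu
        rcases gwTree_adj.1 hadj with ⟨hw, i, rfl⟩ | ⟨-, i, rfl⟩
        · exact ⟨hw, by simpa using hu.2⟩
        · exact ⟨hu.1.1, by
            have := hu.2
            simp at this
            omega⟩
    · rintro ⟨hw, hlen⟩
      cases w with
      | nil => exact Or.inl ⟨hw, by simp⟩
      | cons i w =>
        refine Or.inr ⟨w, ih.2 ⟨hw.1, by simpa using hlen⟩, gwTree_adj.2 (Or.inl ⟨hw, i, rfl⟩)⟩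

instance finite_ball_gwTree (N : List ℕ → ℕ) (s : ℕ) : Finite (ball (gwTree N) s []) :=
  ((finite_tree N (s + 1)).subset fun _ h =>
    ⟨(mem_ball_gwTree.1 h).1, Nat.lt_succ_iff.2 (mem_ball_gwTree.1 h).2⟩).to_subtype

/-- The side of a vertex of the tree, if the root is on side `c`. -/
def side (c : Bool) : List ℕ → Bool
  | [] => c
  | _ :: w => !side c w

lemma side_eq (c : Bool) (w : List ℕ) : side c w = xor c (decide (w.length % 2 = 1)) := by
  induction w with
  | nil => simp [side]
  | cons i w ih =>
    rw [side, ih, List.length_cons]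
    rcases Nat.mod_two_eq_zero_or_one w.length with h | h <;>
      simp [Nat.add_mod, h]

/-- Place the words in the two copies of `Fin n`, the root on side `c`. -/
def place {n : ℕ} (c : Bool) (φ : List ℕ → Fin n) (w : List ℕ) : Bool × Fin n := (side c w, φ w)

lemma place_fst_ne {n : ℕ} (c : Bool) (φ : List ℕ → Fin n) (i : ℕ) (w : List ℕ) :
    (place c φ w).1 ≠ (place c φ (i :: w)).1 := by
  simp [place, side]

/-- The edges at the places of the interior vertices are those of the tree. -/
def Realizes {n : ℕ} (ν : List ℕ → ℕ) (s : ℕ) (c : Bool) (φ : List ℕ → Fin n)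
    (E : Fin n × Fin n → Prop) : Prop :=
  ∀ w ∈ interior ν s, ∀ j : Fin n, E (pairSite (place c φ w) (!side c w, j)) ↔
    (∃ i < ν w, j = φ (i :: w)) ∨ ∃ i v, w = i :: v ∧ j = φ v

/-- The indices of the vertices of depth at most `s` are distinct, and increasing among siblings. -/
structure Ordered {n : ℕ} (ν : List ℕ → ℕ) (s : ℕ) (φ : List ℕ → Fin n) : Prop where
  injOn : Set.InjOn φ {w | InTree ν w ∧ w.length ≤ s}
  strictMono : ∀ w ∈ interior ν s, ∀ i j, i < j → j < ν w → φ (i :: w) < φ (j :: w)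

/-- The placement is a local isomorphism from the ball of the tree. Adjacency is prescribed only at
interior vertices; between two vertices at depth `s` it fails on both sides, because equal depth
means the same side of the bipartition. -/
lemma eval_of_realizes (g : LocalFunction) {n s : ℕ} {ν : List ℕ → ℕ} {c : Bool}
    {φ : List ℕ → Fin n} {E : Fin n × Fin n → Prop} (hφ : Ordered ν s φ)
    (hE : Realizes ν s c φ E) (x : Bool × Fin n → I) :
    g.eval s (bipGraph E) (c, φ []) x =
      g.eval s (gwTree ν) [] fun w => x (place c φ w) := by
  symm
  have hadj1 : ∀ u ∈ ball (gwTree ν) s [], ∀ u' ∈ ball (gwTree ν) s [], u.length < s →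
      (bipGraph E).Adj (place c φ u) (place c φ u') → (gwTree ν).Adj u u' := by
    intro u hu u' hu' hlt h
    rw [mem_ball_gwTree] at hu hu'
    have hui : u ∈ interior ν s := mem_interior.2 ⟨hu.1, hlt⟩
    have hpl : place c φ u' = (!side c u, φ u') := by
      have := h.1
      simp only [place, ne_eq] at this ⊢
      rw [Prod.mk.injEq]
      exact ⟨by cases h1 : side c u <;> cases h2 : side c u' <;> simp_all, rfl⟩
    have h2 := h.2
    rw [hpl] at h2
    rcases (hE u hui (φ u')).1 h2 with ⟨i, hi, he⟩ | ⟨i, w', rfl, he⟩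
    · have : InTree ν (i :: u) := ⟨hu.1, hi⟩
      have := hφ.injOn hu' ⟨this, by simpa using hlt⟩ he
      subst this
      exact gwTree_adj.2 (Or.inl ⟨hu'.1, i, rfl⟩)
    · have := hφ.injOn hu' ⟨hu.1.1, by
        have := hu.2
        simp at this
        omega⟩ he
      subst this
      exact gwTree_adj.2 (Or.inr ⟨hu.1, i, rfl⟩)
  have hadj2 : ∀ u ∈ ball (gwTree ν) s [], ∀ u' ∈ ball (gwTree ν) s [], ∀ i, u' = i :: u →
      (bipGraph E).Adj (place c φ u) (place c φ u') := by
    rintro u hu u' hu' i rfl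
    rw [mem_ball_gwTree] at hu hu'
    refine ⟨place_fst_ne c φ i u, ?_⟩
    have hui : u ∈ interior ν s := mem_interior.2 ⟨hu.1, by simpa using hu'.2⟩
    exact (hE u hui (φ (i :: u))).2 (Or.inl ⟨i, hu'.1.2, rfl⟩)
  refine g.eval_eq_of_localIso (G := gwTree ν) (H := bipGraph E) (ψ := place c φ) (v := [])
    ?_ ?_ ?_ fun _ _ => rfl
  · intro u hu u' hu' h
    exact hφ.injOn (mem_ball_gwTree.1 hu) (mem_ball_gwTree.1 hu') (Prod.ext_iff.1 h).2
  · intro r hr u hu w hw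
    rw [mem_ball_gwTree] at hu
    have hui : u ∈ interior ν s := mem_interior.2 ⟨hu.1, by omega⟩
    have hpl : w = (!side c u, w.2) := by
      have := hw.1
      simp only [place, ne_eq] at this
      refine Prod.ext ?_ rfl
      change w.1 = !side c u
      cases h1 : side c u <;> cases h2 : w.1 <;> simp_all
    have h2 := hw.2
    rw [hpl] at h2
    rcases (hE u hui w.2).1 h2 with ⟨i, hi, he⟩ | ⟨i, w', rfl, he⟩
    · refine ⟨i :: u, gwTree_adj.2 (Or.inl ⟨⟨hu.1, hi⟩, i, rfl⟩), ?_⟩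
      rw [hpl, he]
      rfl
    · refine ⟨w', gwTree_adj.2 (Or.inr ⟨hu.1, i, rfl⟩), ?_⟩
      rw [hpl, he]
      simp [place, side]
  · intro u hu u' hu'
    constructor
    · intro h
      rcases gwTree_adj.1 h with ⟨-, i, hi⟩ | ⟨-, i, hi⟩
      · exact hadj2 u hu u' hu' i hi
      · exact (hadj2 u' hu' u hu i hi).symm
    · intro h
      by_cases hlt : u.length < s
      · exact hadj1 u hu u' hu' hlt h
      by_cases hlt' : u'.length < s
      · exact (hadj1 u' hu' u hu hlt' h.symm).symm
      exfalso
      have e1 : u.length = s := le_antisymm (mem_ball_gwTree.1 hu).2 (not_lt.1 hlt)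
      have e2 : u'.length = s := le_antisymm (mem_ball_gwTree.1 hu').2 (not_lt.1 hlt')
      have := h.1
      simp [place, side_eq, e1, e2] at this

lemma strictMonoOn_unique {n k l : ℕ} {a b : ℕ → Fin n}
    (ha : ∀ i j, i < j → j < k → a i < a j) (hb : ∀ i j, i < j → j < l → b i < b j)
    (hab : ∀ x, (∃ i < k, x = a i) ↔ ∃ i < l, x = b i) : k = l ∧ ∀ i < k, a i = b i := by
  classical
  let A : Fin k → Fin n := fun i => a i
  let B : Fin l → Fin n := fun i => b i
  have hA : StrictMono A := fun i j hij => ha i j hij j.2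
  have hB : StrictMono B := fun i j hij => hb i j hij j.2
  let S : Finset (Fin n) := Finset.univ.image A
  have hS : S.card = k := by
    rw [Finset.card_image_of_injective _ hA.injective, Finset.card_univ, Fintype.card_fin]
  have hS' : S = Finset.univ.image B := by
    ext x
    simp only [S, Finset.mem_image, Finset.mem_univ, true_and]
    constructor
    · rintro ⟨i, rfl⟩
      obtain ⟨j, hj, e⟩ := (hab (A i)).1 ⟨i, i.2, rfl⟩
      exact ⟨⟨j, hj⟩, e.symm⟩
    · rintro ⟨i, rfl⟩
      obtain ⟨j, hj, e⟩ := (hab (B i)).2 ⟨i, i.2, rfl⟩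
      exact ⟨⟨j, hj⟩, e.symm⟩
  have hkl : k = l := by
    rw [← hS, hS', Finset.card_image_of_injective _ hB.injective, Finset.card_univ,
      Fintype.card_fin]
  subst hkl
  refine ⟨rfl, fun i hi => ?_⟩
  have h1 := Finset.orderEmbOfFin_unique hS (fun i => Finset.mem_image_of_mem A (Finset.mem_univ i))
    hA
  have h2 := Finset.orderEmbOfFin_unique hS (fun i => by
    rw [hS']
    exact Finset.mem_image_of_mem B (Finset.mem_univ i)) hB
  exact congrFun (h1.trans h2.symm) ⟨i, hi⟩

/-- The neighbours of an interior vertex are its children and its parent, and distinct indices keep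
the parent from being a child. -/
lemma children_eq_of_realizes {n s : ℕ} {ν : List ℕ → ℕ} {c : Bool}
    {φ : List ℕ → Fin n} {E : Fin n × Fin n → Prop} (hφ : Ordered ν s φ)
    (hE : Realizes ν s c φ E) {w : List ℕ} (hw : w ∈ interior ν s) (j : Fin n) :
    (∃ i < ν w, j = φ (i :: w)) ↔
      E (pairSite (place c φ w) (!side c w, j)) ∧ ¬ ∃ i v, w = i :: v ∧ j = φ v := by
  rw [hE w hw j]
  constructor
  · rintro ⟨i, hi, rfl⟩
    refine ⟨Or.inl ⟨i, hi, rfl⟩, ?_⟩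
    rintro ⟨i', w', rfl, he⟩
    obtain ⟨hw1, hw2⟩ := mem_interior.1 hw
    have h1 : InTree ν (i :: i' :: w') := ⟨hw1, hi⟩
    simp only [List.length_cons] at hw2
    have := hφ.injOn (x₁ := i :: i' :: w') (x₂ := w') ⟨h1, by simp; omega⟩ ⟨hw1.1, by omega⟩ he
    have := congrArg List.length this
    simp at this
    omega
  · rintro ⟨h | h, hn⟩
    · exact h
    · exact (hn h).elim

/-- The graph determines the tree and its placement: going down from the root, the children are the
neighbours other than the parent, and listing siblings in increasing order leaves no freedom. Hence
different trees or placements are realized on disjoint events. -/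
lemma realizes_unique {n s : ℕ} {ν ν' : List ℕ → ℕ} {c : Bool}
    {φ φ' : List ℕ → Fin n} {E : Fin n × Fin n → Prop} (hφ : Ordered ν s φ) (hφ' : Ordered ν' s φ')
    (hE : Realizes ν s c φ E) (hE' : Realizes ν' s c φ' E) (h0 : φ [] = φ' []) (w : List ℕ)
    (hw : InTree ν w) (hs : w.length ≤ s) :
    InTree ν' w ∧ φ w = φ' w ∧
      (w.length < s → ν w = ν' w ∧ ∀ i < ν w, φ (i :: w) = φ' (i :: w)) := by
  have key : ∀ w, InTree ν w → InTree ν' w → φ w = φ' w →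
      (∀ i w', w = i :: w' → φ w' = φ' w') → w.length < s →
      ν w = ν' w ∧ ∀ i < ν w, φ (i :: w) = φ' (i :: w) := by
    intro w hw hw' hww hpar hlt
    have hi : w ∈ interior ν s := mem_interior.2 ⟨hw, hlt⟩
    have hi' : w ∈ interior ν' s := mem_interior.2 ⟨hw', hlt⟩
    refine strictMonoOn_unique (a := fun i => φ (i :: w)) (b := fun i => φ' (i :: w))
      (hφ.strictMono w hi) (hφ'.strictMono w hi') fun j => ?_
    rw [children_eq_of_realizes hφ hE hi j, children_eq_of_realizes hφ' hE' hi' j]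
    have hpl : place c φ w = place c φ' w := by simp [place, hww]
    rw [hpl]
    refine and_congr_right fun _ => not_congr ?_
    constructor
    · rintro ⟨i, w', h, rfl⟩
      exact ⟨i, w', h, hpar i w' h⟩
    · rintro ⟨i, w', h, rfl⟩
      exact ⟨i, w', h, (hpar i w' h).symm⟩
  induction w with
  | nil => exact ⟨trivial, h0, key [] trivial trivial h0 (by simp)⟩
  | cons i w ih =>
    simp only [List.length_cons] at hs
    obtain ⟨h1, h2, h3⟩ := ih hw.1 (by omega)
    obtain ⟨h4, h5⟩ := h3 (by omega)
    have hw' : InTree ν' (i :: w) := ⟨h1, h4 ▸ hw.2⟩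
    refine ⟨hw', h5 i hw.2, key _ hw hw' (h5 i hw.2) ?_⟩
    intro i' w' h
    obtain ⟨-, rfl⟩ := List.cons.inj h
    exact h2

end BipLocal

/-! ### Counting placements and estimating their probabilities -/

namespace BipLocal

/-- The indices of the children of the interior vertices. -/
abbrev ChildIndices (ν : List ℕ → ℕ) (s n : ℕ) : Type :=
  ∀ w : interior ν s, Fin (ν w) → Fin n

/-- Indices of the children that are all distinct and different from the index `i₀` of the root. -/
def Distinct {ν : List ℕ → ℕ} {s n : ℕ} (i₀ : Fin n) (f : ChildIndices ν s n) : Prop :=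
  Function.Injective (fun p : Σ w : interior ν s, Fin (ν w) => f p.1 p.2) ∧ ∀ w i, f w i ≠ i₀

open Classical in
/-- The indices of the vertices of the tree. -/
noncomputable def treeIndex {ν : List ℕ → ℕ} {s n : ℕ} (i₀ : Fin n) (f : ChildIndices ν s n) :
    List ℕ → Fin n
  | [] => i₀
  | i :: w => if h : w ∈ interior ν s ∧ i < ν w then f ⟨w, h.1⟩ ⟨i, h.2⟩ else i₀

lemma treeIndex_cons {ν : List ℕ → ℕ} {s n : ℕ} (i₀ : Fin n) (f : ChildIndices ν s n) {i : ℕ}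
    {w : List ℕ} (hw : w ∈ interior ν s) (hi : i < ν w) :
    treeIndex i₀ f (i :: w) = f ⟨w, hw⟩ ⟨i, hi⟩ := by
  rw [treeIndex, dif_pos ⟨hw, hi⟩]

lemma ordered_treeIndex {ν : List ℕ → ℕ} {s n : ℕ} {i₀ : Fin n} {f : ChildIndices ν s n}
    (hf : Distinct i₀ f) (hmono : ∀ w, StrictMono (f w)) : Ordered ν s (treeIndex i₀ f) := by
  have hcons : ∀ {i : ℕ} {w : List ℕ}, InTree ν (i :: w) → (i :: w).length ≤ s →
      w ∈ interior ν s ∧ i < ν w := fun h hs =>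
    ⟨mem_interior.2 ⟨h.1, by simpa using hs⟩, h.2⟩
  constructor
  · rintro w ⟨hw, hws⟩ w' ⟨hw', hws'⟩ h
    cases w with
    | nil =>
      cases w' with
      | nil => rfl
      | cons i' w' =>
        obtain ⟨a, b⟩ := hcons hw' hws'
        rw [treeIndex_cons i₀ f a b] at h
        exact (hf.2 _ _ h.symm).elim
    | cons i w =>
      obtain ⟨a, b⟩ := hcons hw hws
      rw [treeIndex_cons i₀ f a b] at h
      cases w' with
      | nil => exact (hf.2 _ _ h).elim
      | cons i' w' =>
        obtain ⟨a', b'⟩ := hcons hw' hws'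
        rw [treeIndex_cons i₀ f a' b'] at h
        have := hf.1 (a₁ := ⟨⟨w, a⟩, ⟨i, b⟩⟩) (a₂ := ⟨⟨w', a'⟩, ⟨i', b'⟩⟩) h
        rw [Sigma.mk.injEq] at this
        obtain ⟨h1, h2⟩ := this
        have h1 : w = w' := congrArg Subtype.val h1
        subst h1
        have h2 := congrArg Fin.val (eq_of_heq h2)
        simp only at h2
        rw [h2]
  · intro w hw i j hij hj
    rw [treeIndex_cons i₀ f hw (hij.trans hj), treeIndex_cons i₀ f hw hj]
    exact hmono ⟨w, hw⟩ hij

open Classical in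
/-- The admissible choices of indices for the vertices of the tree. -/
noncomputable def orderedIndices (ν : List ℕ → ℕ) (s : ℕ) {n : ℕ} (i₀ : Fin n) :
    Finset (ChildIndices ν s n) :=
  Finset.univ.filter fun f => Distinct i₀ f ∧ ∀ w, StrictMono (f w)

lemma mem_orderedIndices {ν : List ℕ → ℕ} {s n : ℕ} {i₀ : Fin n} {f : ChildIndices ν s n} :
    f ∈ orderedIndices ν s i₀ ↔ Distinct i₀ f ∧ ∀ w, StrictMono (f w) := by
  simp [orderedIndices]

/-- Sorting the siblings turns any injective indexing of the non-root vertices by the `n - 1`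
remaining indices into an increasing one, together with one permutation for each sibling group. -/
lemma descFactorial_le_card_orderedIndices (ν : List ℕ → ℕ) (s : ℕ) {n : ℕ} (i₀ : Fin n) :
    (n - 1).descFactorial (∑ w ∈ interior ν s, ν w) ≤
      (orderedIndices ν s i₀).card * ∏ w ∈ interior ν s, (ν w).factorial := by
  classical
  let D := (Σ w : interior ν s, Fin (ν w)) ↪ {j : Fin n // j ≠ i₀}
  have hD : Fintype.card D = (n - 1).descFactorial (∑ w ∈ interior ν s, ν w) := by
    rw [Fintype.card_embedding_eq, Fintype.card_sigma]
    simp only [Fintype.card_fin]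
    rw [Finset.sum_coe_sort (interior ν s) fun w => ν w]
    congr 1
    simp [Fintype.card_subtype_compl]
  let T := {f // f ∈ orderedIndices ν s i₀} × (∀ w : interior ν s, Equiv.Perm (Fin (ν w)))
  have hT : Fintype.card T =
      (orderedIndices ν s i₀).card * ∏ w ∈ interior ν s, (ν w).factorial := by
    rw [Fintype.card_prod, Fintype.card_coe, Fintype.card_pi]
    simp only [Fintype.card_perm, Fintype.card_fin]
    rw [Finset.prod_coe_sort (interior ν s) fun w => (ν w).factorial]
  rw [← hD, ← hT]
  let val : D → ChildIndices ν s n := fun e w i => (e ⟨w, i⟩ : Fin n)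
  let π : D → ∀ w : interior ν s, Equiv.Perm (Fin (ν w)) := fun e w => Tuple.sort (val e w)
  have hmem : ∀ e, (fun w => val e w ∘ π e w) ∈ orderedIndices ν s i₀ := by
    intro e
    rw [mem_orderedIndices]
    have hinj : Function.Injective
        (fun p : Σ w : interior ν s, Fin (ν w) => (val e p.1 ∘ π e p.1) p.2) := by
      rintro ⟨w, i⟩ ⟨w', i'⟩ h
      have := e.injective (Subtype.ext h)
      rw [Sigma.mk.injEq] at this
      obtain ⟨h1, h2⟩ := this
      change w = w' at h1
      subst h1
      have h3 : i = i' := (π e w).injective (eq_of_heq h2)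
      rw [h3]
    refine ⟨⟨hinj, fun w i => (e ⟨w, π e w i⟩).2⟩, fun w => ?_⟩
    refine (Tuple.monotone_sort (val e w)).strictMono_of_injective fun i i' h => ?_
    have := hinj (a₁ := ⟨w, i⟩) (a₂ := ⟨w, i'⟩) h
    simpa using this
  refine Fintype.card_le_of_injective (fun e : D => ((⟨_, hmem e⟩, π e) : T)) fun e e' h => ?_
  obtain ⟨h1, h2⟩ := Prod.mk.inj h
  have h1 := Subtype.mk.inj h1
  ext ⟨w, i⟩
  have h3 := congrFun (congrFun h1 w) ((π e w).symm i)
  have h4 : π e' w = π e w := by rw [h2]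
  simp only [Function.comp_apply, h4, Equiv.apply_symm_apply] at h3
  exact congrArg Fin.val h3

/-- Prescribe all pairs at interior vertices (`J`): tree edges (`K`) are present and the others
absent. The exponents only bound the numbers of such pairs from above, which suffices since `q` and
`1 - q` are at most `1`. -/
lemma prob_realizes_ge {n s : ℕ} {ν : List ℕ → ℕ} {φ : List ℕ → Fin n} (hφ : Ordered ν s φ)
    (c : Bool) {q : ℝ} (h0 : 0 ≤ q) (h1 : q ≤ 1) :
    q ^ (∑ w ∈ interior ν s, ν w) * (1 - q) ^ (n * (interior ν s).card) ≤
      (Measure.pi fun _ : Fin n × Fin n => (volume : Measure I)).real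
        {ε | Realizes ν s c φ fun p => (ε p : ℝ) < q} := by
  classical
  let J : Finset (Fin n × Fin n) := (interior ν s).biUnion fun w =>
    Finset.univ.image fun j => pairSite (place c φ w) (!side c w, j)
  let K : Finset (Fin n × Fin n) := (interior ν s).biUnion fun w =>
    (Finset.range (ν w)).image fun i => pairSite (place c φ w) (place c φ (i :: w))
  let t : Fin n × Fin n → Set I := fun p =>
    if p ∈ K then {x | (x : ℝ) < q} else {x | ¬ (x : ℝ) < q}
  have hKcard : K.card ≤ ∑ w ∈ interior ν s, ν w :=
    Finset.card_biUnion_le.trans (Finset.sum_le_sum fun w _ =>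
      Finset.card_image_le.trans (Finset.card_range _).le)
  have hJcard : J.card ≤ n * (interior ν s).card := by
    refine (Finset.card_biUnion_le_card_mul _ _ n fun w _ =>
      Finset.card_image_le.trans (by simp)).trans (mul_comm _ _).le
  have hsub : {ε : Fin n × Fin n → I | ∀ p ∈ J, ε p ∈ t p} ⊆
      {ε | Realizes ν s c φ fun p => (ε p : ℝ) < q} := by
    intro ε hε w hw j
    have hpJ : pairSite (place c φ w) (!side c w, j) ∈ J :=
      Finset.mem_biUnion.2 ⟨w, hw, Finset.mem_image_of_mem _ (Finset.mem_univ j)⟩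
    have hiff : (ε (pairSite (place c φ w) (!side c w, j)) : ℝ) < q ↔
        pairSite (place c φ w) (!side c w, j) ∈ K := by
      have := hε _ hpJ
      by_cases hK : pairSite (place c φ w) (!side c w, j) ∈ K
      · simp only [t, hK, if_true] at this
        exact iff_of_true this hK
      · simp only [t, hK, if_false] at this
        exact iff_of_false this hK
    change (ε (pairSite (place c φ w) (!side c w, j)) : ℝ) < q ↔ _
    rw [hiff]
    obtain ⟨hw1, hw2⟩ := mem_interior.1 hw
    constructor
    · intro h
      obtain ⟨w₁, hw₁, h⟩ := Finset.mem_biUnion.1 h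
      obtain ⟨i, hi, h⟩ := Finset.mem_image.1 h
      rw [Finset.mem_range] at hi
      obtain ⟨a1, a2⟩ := mem_interior.1 hw₁
      have hside : (place c φ w).1 ≠ ((!side c w, j) : Bool × Fin n).1 := by simp [place]
      rcases eq_or_eq_of_pairSite_eq (place_fst_ne c φ i w₁) hside h with ⟨e1, e2⟩ | ⟨e1, e2⟩
      · have : w₁ = w := hφ.injOn ⟨a1, a2.le⟩ ⟨hw1, hw2.le⟩ (Prod.ext_iff.1 e1).2
        subst this
        exact Or.inl ⟨i, hi, (Prod.ext_iff.1 e2).2.symm⟩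
      · have : i :: w₁ = w := hφ.injOn ⟨inTree_cons.2 ⟨a1, hi⟩, a2⟩ ⟨hw1, hw2.le⟩ (Prod.ext_iff.1 e2).2
        exact Or.inr ⟨i, w₁, this.symm, (Prod.ext_iff.1 e1).2.symm⟩
    · rintro (⟨i, hi, rfl⟩ | ⟨i, w', rfl, rfl⟩)
      · exact Finset.mem_biUnion.2 ⟨w, hw, Finset.mem_image.2 ⟨i, Finset.mem_range.2 hi, rfl⟩⟩
      · have hw' : w' ∈ interior ν s := mem_interior.2 ⟨hw1.1, by
          simp only [List.length_cons] at hw2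
          omega⟩
        refine Finset.mem_biUnion.2 ⟨w', hw', Finset.mem_image.2
          ⟨i, Finset.mem_range.2 hw1.2, ?_⟩⟩
        rw [pairSite_comm (place_fst_ne c φ i w')]
        simp [place, side]
  refine le_trans ?_ (measureReal_mono hsub (measure_ne_top _ _))
  rw [pi_real_box]
  have ht : ∀ p ∈ J, (volume : Measure I).real (t p) = if p ∈ K then q else 1 - q := by
    intro p _
    by_cases hp : p ∈ K
    · simp only [t, hp, if_true]
      exact volume_real_lt h0 h1
    · simp only [t, hp, if_false]
      exact volume_real_not_lt h0 h1
  rw [Finset.prod_congr rfl ht, Finset.prod_ite, Finset.prod_const, Finset.prod_const]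
  refine mul_le_mul (pow_le_pow_of_le_one h0 h1 ?_)
    (pow_le_pow_of_le_one (by linarith) (by linarith) ?_) (pow_nonneg (by linarith) _)
    (pow_nonneg h0 _)
  · exact (Finset.card_le_card fun p hp => (Finset.mem_filter.1 hp).2).trans hKcard
  · exact (Finset.card_le_card (Finset.filter_subset _ _)).trans hJcard

/-- The probability that `g` chooses the root of the tree with offspring numbers `ν`. -/
noncomputable def treeProb (g : LocalFunction) (s : ℕ) (ν : List ℕ → ℕ) : ℝ :=
  (Measure.infinitePi fun _ : List ℕ => (volume : Measure I)).real
    {x | g.eval s (gwTree ν) [] x = true}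

lemma map_comp_pi {ι κ : Type} [Fintype ι] [Fintype κ] {ψ : κ → ι} (hψ : Function.Injective ψ) :
    (Measure.pi fun _ : ι => (volume : Measure I)).map (fun x k => x (ψ k)) =
      Measure.pi fun _ : κ => (volume : Measure I) := by
  have h : iIndepFun (fun (i : ι) (x : ι → I) => x i)
      (Measure.pi fun _ : ι => (volume : Measure I)) :=
    iIndepFun_pi (X := fun _ => id) (fun _ => aemeasurable_id)
  have h2 := h.precomp hψ
  rw [iIndepFun_iff_map_fun_eq_pi_map fun k => (measurable_pi_apply (ψ k)).aemeasurable] at h2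
  rw [h2]
  congr 1
  funext k
  exact (measurePreserving_eval (fun _ : ι => (volume : Measure I)) (ψ k)).map_eq

/-- The output depends only on the labels in the ball, and an injective selection of independent
uniform labels is again independent and uniform. -/
lemma prob_eval_comp (g : LocalFunction) (s : ℕ) (ν : List ℕ → ℕ) {ι : Type} [Fintype ι]
    {ψ : List ℕ → ι} (hψ : Set.InjOn ψ {w | InTree ν w ∧ w.length ≤ s}) :
    (Measure.pi fun _ : ι => (volume : Measure I)).real
      {x | g.eval s (gwTree ν) [] (fun w => x (ψ w)) = true} = treeProb g s ν := by
  classical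
  let B := ball (gwTree ν) s []
  have : Fintype B := Fintype.ofFinite _
  let h : (B → I) → Bool := fun y => g.toFun ((gwTree ν).induce B) ⟨[], mem_ball_self _ s []⟩ y
  have hm : MeasurableSet {y | h y = true} := g.measurable_toFun _ _ (measurableSet_singleton true)
  have e1 : treeProb g s ν =
      (Measure.pi fun _ : B => (volume : Measure I)).real {y | h y = true} := by
    have h1 : (Measure.infinitePi fun _ : List ℕ => (volume : Measure I)).map (Set.domRestrict B) =
        Measure.infinitePi fun _ : B => (volume : Measure I) :=
      Measure.infinitePi_map_restrict' _
    rw [Measure.infinitePi_eq_pi (μ := fun _ : B => (volume : Measure I))] at h1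
    rw [← h1, map_measureReal_apply (by fun_prop) hm]
    rfl
  have e2 := map_comp_pi (ψ := fun w : B => ψ w) fun w w' hw =>
    Subtype.ext (hψ (mem_ball_gwTree.1 w.2) (mem_ball_gwTree.1 w'.2) hw)
  rw [e1, ← e2, map_measureReal_apply (by fun_prop) hm]
  rfl

lemma measurableSet_eval_comp (g : LocalFunction) (s : ℕ) (ν : List ℕ → ℕ) {ι : Type}
    (ψ : List ℕ → ι) : MeasurableSet {x : ι → I | g.eval s (gwTree ν) [] (fun w => x (ψ w)) = true} :=
  ((g.measurable_eval s (gwTree ν) []).comp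
    (measurable_pi_lambda (fun (x : ι → I) w => x (ψ w)) fun w => measurable_pi_apply (ψ w)))
    (measurableSet_singleton true)

lemma measurableSet_realizes {n s : ℕ} (ν : List ℕ → ℕ) (φ : List ℕ → Fin n) (c : Bool) (q : ℝ) :
    MeasurableSet {ε : Fin n × Fin n → I | Realizes ν s c φ fun p => (ε p : ℝ) < q} := by
  have h : Measurable fun (ε : Fin n × Fin n → I) (p : Fin n × Fin n) => (ε p : ℝ) < q :=
    measurable_pi_lambda _ fun p => measurableSet_setOfPred.1
      (measurableSet_lt (measurable_subtype_coe.comp (measurable_pi_apply p)) measurable_const)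
  exact h ((Set.toFinite {E : Fin n × Fin n → Prop | Realizes ν s c φ E}).measurableSet)

/-- The event that the tree is realized at the root with the given indices, and that `g` chooses
the root. -/
def realizedChosen (g : LocalFunction) {n : ℕ} (s : ℕ) (q : ℝ) (c : Bool) (ν : List ℕ → ℕ)
    (φ : List ℕ → Fin n) : Set (Site n → I) :=
  {ξ | (Realizes ν s c φ fun p => (ξ (.inl p) : ℝ) < q) ∧
    g.eval s (gwTree ν) [] (fun w => ξ (.inr (place c φ w))) = true}

lemma realizedChosen_eq_preimage (g : LocalFunction) {n : ℕ} (s : ℕ) (q : ℝ) (c : Bool)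
    (ν : List ℕ → ℕ) (φ : List ℕ → Fin n) :
    realizedChosen g s q c ν φ = MeasurableEquiv.sumPiEquivProdPi (fun _ : Site n => I) ⁻¹'
      ({ε | Realizes ν s c φ fun p => (ε p : ℝ) < q} ×ˢ
        {x | g.eval s (gwTree ν) [] (fun w => x (place c φ w)) = true}) := rfl

lemma measurableSet_realizedChosen (g : LocalFunction) {n : ℕ} (s : ℕ) (q : ℝ) (c : Bool)
    (ν : List ℕ → ℕ) (φ : List ℕ → Fin n) : MeasurableSet (realizedChosen g s q c ν φ) := by
  rw [realizedChosen_eq_preimage]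
  exact (MeasurableEquiv.measurable _)
    ((measurableSet_realizes ν φ c q).prod (measurableSet_eval_comp g s ν (place c φ)))

lemma prob_realizedChosen_ge (g : LocalFunction) {n s : ℕ} {ν : List ℕ → ℕ} {φ : List ℕ → Fin n}
    (hφ : Ordered ν s φ) (c : Bool) {q : ℝ} (h0 : 0 ≤ q) (h1 : q ≤ 1) :
    q ^ (∑ w ∈ interior ν s, ν w) * (1 - q) ^ (n * (interior ν s).card) * treeProb g s ν ≤
      (siteLaw n volume).real (realizedChosen g s q c ν φ) := by
  rw [realizedChosen_eq_preimage,
    (measurePreserving_sumPiEquivProdPi fun _ : Site n => (volume : Measure I)).measureReal_preimage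
      ((measurableSet_realizes ν φ c q).prod
        (measurableSet_eval_comp g s ν (place c φ))).nullMeasurableSet,
    measureReal_prod_prod, prob_eval_comp g s ν]
  · exact mul_le_mul_of_nonneg_right (prob_realizes_ge hφ c h0 h1) measureReal_nonneg
  · intro w hw w' hw' h
    exact hφ.injOn hw hw' (Prod.ext_iff.1 h).2

lemma realizedChosen_subset (g : LocalFunction) {n s : ℕ} {ν : List ℕ → ℕ} {φ : List ℕ → Fin n}
    (hφ : Ordered ν s φ) (c : Bool) (q : ℝ) :
    realizedChosen g s q c ν φ ⊆ {ξ | out g s q (c, φ []) ξ = true} := fun ξ hξ => by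
  have := eval_of_realizes g hφ hξ.1 (fun v => ξ (.inr v))
  change g.eval s (siteGraph q ξ) (c, φ []) (fun v => ξ (.inr v)) = true
  exact this.trans hξ.2

/-- The offspring numbers vanish outside the interior. -/
def Truncated (s : ℕ) (ν : List ℕ → ℕ) : Prop := ∀ w, w ∉ interior ν s → ν w = 0

/-- By `realizes_unique` the events over all trees in `F` and all admissible indices are disjoint
parts of the event that the vertex is chosen. Truncation makes the offspring numbers equal as
functions once they agree on the interior. -/
lemma prob_out_ge_sum (g : LocalFunction) {n s : ℕ} (c : Bool) (i₀ : Fin n) {q : ℝ} (h0 : 0 ≤ q)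
    (h1 : q ≤ 1) (F : Finset (List ℕ → ℕ)) (hF : ∀ ν ∈ F, Truncated s ν) :
    ∑ ν ∈ F, (orderedIndices ν s i₀).card *
        (q ^ (∑ w ∈ interior ν s, ν w) * (1 - q) ^ (n * (interior ν s).card) * treeProb g s ν) ≤
      (siteLaw n volume).real {ξ | out g s q (c, i₀) ξ = true} := by
  classical
  let R : ∀ ν, ChildIndices ν s n → Set (Site n → I) := fun ν f =>
    realizedChosen g s q c ν (treeIndex i₀ f)
  have hord : ∀ ν, ∀ f ∈ orderedIndices ν s i₀, Ordered ν s (treeIndex i₀ f) := fun ν f hf =>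
    ordered_treeIndex (mem_orderedIndices.1 hf).1 (mem_orderedIndices.1 hf).2
  have hdisj1 : ∀ ν, (orderedIndices ν s i₀ : Set (ChildIndices ν s n)).PairwiseDisjoint (R ν) := by
    intro ν f hf f' hf' hne
    refine Set.disjoint_left.2 fun ξ h h' => hne ?_
    have key := realizes_unique (hord ν f hf) (hord ν f' hf') h.1 h'.1 rfl
    funext w i
    obtain ⟨hw1, hw2⟩ := mem_interior.1 w.2
    have := ((key w hw1 hw2.le).2.2 hw2).2 i i.2
    rw [treeIndex_cons i₀ f w.2 i.2, treeIndex_cons i₀ f' w.2 i.2] at this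
    exact this
  have hdisj2 : (F : Set (List ℕ → ℕ)).PairwiseDisjoint
      fun ν => ⋃ f ∈ orderedIndices ν s i₀, R ν f := by
    intro ν hν ν' hν' hne
    refine Set.disjoint_left.2 fun ξ h h' => hne ?_
    simp only [Set.mem_iUnion] at h h'
    obtain ⟨f, hf, h⟩ := h
    obtain ⟨f', hf', h'⟩ := h'
    have key := realizes_unique (hord ν f hf) (hord ν' f' hf') h.1 h'.1 rfl
    have key' := realizes_unique (hord ν' f' hf') (hord ν f hf) h'.1 h.1 rfl
    funext w
    by_cases hw : w ∈ interior ν s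
    · obtain ⟨hw1, hw2⟩ := mem_interior.1 hw
      exact ((key w hw1 hw2.le).2.2 hw2).1
    · have hw' : w ∉ interior ν' s := fun hw' => by
        obtain ⟨hw1, hw2⟩ := mem_interior.1 hw'
        exact hw (mem_interior.2 ⟨(key' w hw1 hw2.le).1, hw2⟩)
      rw [hF ν hν w hw, hF ν' hν' w hw']
  have hsub : (⋃ ν ∈ F, ⋃ f ∈ orderedIndices ν s i₀, R ν f) ⊆
      {ξ | out g s q (c, i₀) ξ = true} := by
    intro ξ h
    simp only [Set.mem_iUnion] at h
    obtain ⟨ν, -, f, hf, h⟩ := h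
    exact realizedChosen_subset g (hord ν f hf) c q h
  refine le_trans ?_ (measureReal_mono hsub (measure_ne_top _ _))
  rw [measureReal_biUnion_finset hdisj2 (fun ν _ => Finset.measurableSet_biUnion _ fun f _ =>
    measurableSet_realizedChosen g s q c ν _) (fun _ _ => measure_ne_top _ _)]
  refine Finset.sum_le_sum fun ν _ => ?_
  rw [measureReal_biUnion_finset (hdisj1 ν) fun f _ => measurableSet_realizedChosen g s q c ν _,
    ← nsmul_eq_mul]
  exact Finset.card_nsmul_le_sum _ _ _ fun f hf => prob_realizedChosen_ge g (hord ν f hf) c h0 h1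

end BipLocal

/-! ### Truncated Galton–Watson trees and the local limit -/

namespace BipLocal

open Classical in
/-- The offspring numbers of the tree cut at depth `s`. -/
noncomputable def trunc (s : ℕ) (N : List ℕ → ℕ) (w : List ℕ) : ℕ :=
  if InTree N w ∧ w.length < s then N w else 0

lemma inTree_trunc {s : ℕ} {N : List ℕ → ℕ} {w : List ℕ} (hw : w.length ≤ s) :
    InTree (trunc s N) w ↔ InTree N w := by
  induction w with
  | nil => exact Iff.rfl
  | cons i w ih =>
    simp only [List.length_cons] at hw
    rw [inTree_cons, inTree_cons, ih (by omega)]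
    refine and_congr_right fun h => ?_
    rw [trunc, if_pos ⟨h, by omega⟩]

lemma truncated_trunc (s : ℕ) (N : List ℕ → ℕ) : Truncated s (trunc s N) := by
  intro w hw
  rw [mem_interior] at hw
  rw [trunc, if_neg]
  rintro ⟨h1, h2⟩
  exact hw ⟨(inTree_trunc h2.le).2 h1, h2⟩

lemma eval_trunc (g : LocalFunction) (s : ℕ) (N : List ℕ → ℕ) (x : List ℕ → I) :
    g.eval s (gwTree N) [] x = g.eval s (gwTree (trunc s N)) [] x := by
  have hadj : ∀ u w : List ℕ, u.length ≤ s → w.length ≤ s →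
      ((gwTree N).Adj u w ↔ (gwTree (trunc s N)).Adj u w) := fun u w hu hw => by
    rw [gwTree_adj, gwTree_adj, inTree_trunc hu, inTree_trunc hw]
  refine g.eval_eq_of_localIso (ψ := id) (v := []) Function.injective_id.injOn ?_ ?_ fun _ _ => rfl
  · intro r hr u hu w hw
    refine ⟨w, ?_, rfl⟩
    have hlu := (mem_ball_gwTree.1 hu).2
    refine (hadj u w (by omega) ?_).2 hw
    rcases gwTree_adj.1 hw with ⟨-, i, rfl⟩ | ⟨-, i, rfl⟩
    · simp only [id_eq, List.length_cons]
      omega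
    · simp only [List.length_cons] at hlu
      omega
  · intro u hu w hw
    exact hadj u w (mem_ball_gwTree.1 hu).2 (mem_ball_gwTree.1 hw).2

lemma measurableSet_inTree (w : List ℕ) : MeasurableSet {N : List ℕ → ℕ | InTree N w} := by
  induction w with
  | nil => exact MeasurableSet.univ
  | cons i w ih =>
    exact ih.inter (measurableSet_lt measurable_const (measurable_pi_apply w))

lemma measurableSet_trunc_eq (s : ℕ) (ν : List ℕ → ℕ) :
    MeasurableSet {N : List ℕ → ℕ | trunc s N = ν} := by
  have : {N : List ℕ → ℕ | trunc s N = ν} = ⋂ w, {N | trunc s N w = ν w} := by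
    ext N
    simp [funext_iff]
  rw [this]
  refine MeasurableSet.iInter fun w => ?_
  have hm : Measurable fun N : List ℕ → ℕ => trunc s N w := by
    classical
    by_cases hw : w.length < s
    · simp only [trunc, hw, and_true]
      exact Measurable.ite (measurableSet_inTree w) (measurable_pi_apply w) measurable_const
    · simp only [trunc, hw, and_false, if_false]
      exact measurable_const
  exact hm (measurableSet_singleton (ν w))

/-- Finitely supported functions form a countable type, so events and probabilities can be split
over the possible truncated trees. -/
lemma exists_finsupp_trunc (s : ℕ) (N : List ℕ → ℕ) :
    ∃ a : List ℕ →₀ ℕ, trunc s N = a := by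
  refine ⟨Finsupp.ofSupportFinite (trunc s N) ((finite_tree N s).subset fun w hw => ?_), rfl⟩
  by_contra h
  exact hw (if_neg h)

lemma measurableSet_gwEval (g : LocalFunction) (s : ℕ) :
    MeasurableSet {ω : (List ℕ → ℕ) × (List ℕ → I) | g.eval s (gwTree ω.1) [] ω.2 = true} := by
  have : {ω : (List ℕ → ℕ) × (List ℕ → I) | g.eval s (gwTree ω.1) [] ω.2 = true} =
      ⋃ a : List ℕ →₀ ℕ, {N | trunc s N = a} ×ˢ {x | g.eval s (gwTree a) [] x = true} := by
    ext ⟨N, x⟩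
    simp only [Set.mem_iUnion, Set.mem_prod]
    constructor
    · intro h
      obtain ⟨a, ha⟩ := exists_finsupp_trunc s N
      refine ⟨a, ha, ?_⟩
      change g.eval s (gwTree a) [] x = true
      rw [← ha, ← eval_trunc]
      exact h
    · rintro ⟨a, ha, hx⟩
      change g.eval s (gwTree N) [] x = true
      rw [eval_trunc, show trunc s N = a from ha]
      exact hx
  rw [this]
  exact MeasurableSet.iUnion fun a => (measurableSet_trunc_eq s a).prod
    (measurableSet_eval_comp g s a id)

instance isProbabilityMeasure_gwMeasure (d : ℝ≥0) : IsProbabilityMeasure (gwMeasure d) := by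
  unfold gwMeasure
  infer_instance

lemma gwExp_eq (d : ℝ≥0) (s : ℕ) (g : LocalFunction) :
    gwExp d s g = (gwMeasure d).real {ω | g.eval s (gwTree ω.1) [] ω.2 = true} := by
  rw [gwExp, ← integral_indicator_one (measurableSet_gwEval g s)]
  refine integral_congr_ae (Eventually.of_forall fun ω => ?_)
  by_cases h : g.eval s (gwTree ω.1) [] ω.2 = true <;> simp [h, Set.indicator]

/-- The truncated tree fixes the offspring numbers at the interior vertices, and these are
independent Poisson variables. -/
lemma prob_trunc_eq_le (d : ℝ≥0) (s : ℕ) (ν : List ℕ → ℕ) :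
    (Measure.infinitePi fun _ : List ℕ => poissonMeasure d).real {N | trunc s N = ν} ≤
      ∏ w ∈ interior ν s, (Real.exp (-d) * d ^ ν w / (ν w).factorial) := by
  have h := Measure.infinitePi_pi (μ := fun _ : List ℕ => poissonMeasure d) (s := interior ν s)
    (t := fun w => {ν w}) fun w _ => measurableSet_singleton _
  have hsub : {N : List ℕ → ℕ | trunc s N = ν} ⊆
      Set.pi (interior ν s : Set (List ℕ)) fun w => {ν w} := by
    rintro N rfl w hw
    obtain ⟨h1, h2⟩ := mem_interior.1 hw
    rw [inTree_trunc h2.le] at h1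
    change N w = trunc s N w
    rw [trunc, if_pos ⟨h1, h2⟩]
  refine (measureReal_mono hsub (measure_ne_top _ _)).trans (le_of_eq ?_)
  rw [Measure.real, h, ENNReal.toReal_prod]
  refine Finset.prod_congr rfl fun w _ => ?_
  rw [← poissonMeasure_real_singleton]
  rfl

/-- Countably many truncated trees carry all the mass, so finitely many carry at least `1 - δ`. This
avoids interchanging the limit in `n` with an infinite sum. -/
lemma exists_finset_gwExp_le (g : LocalFunction) (s : ℕ) (d : ℝ≥0) {δ : ℝ} (hδ : 0 < δ) :
    ∃ F : Finset (List ℕ → ℕ), (∀ ν ∈ F, Truncated s ν) ∧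
      gwExp d s g ≤ ∑ ν ∈ F, (∏ w ∈ interior ν s,
        (Real.exp (-d) * d ^ ν w / (ν w).factorial)) * treeProb g s ν + δ := by
  classical
  set P := Measure.infinitePi fun _ : List ℕ => poissonMeasure d
  let C : (List ℕ →₀ ℕ) → Set (List ℕ → ℕ) := fun a => {N | trunc s N = a}
  have hCm : ∀ a, MeasurableSet (C a) := fun a => measurableSet_trunc_eq s a
  have hCd : Pairwise (Function.onFun Disjoint C) := fun a b hab =>
    Set.disjoint_left.2 fun N ha hb => hab (DFunLike.coe_injective
      ((show trunc s N = a from ha).symm.trans hb))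
  have hCu : ⋃ a, C a = Set.univ := Set.eq_univ_of_forall fun N => by
    obtain ⟨a, ha⟩ := exists_finsupp_trunc s N
    exact Set.mem_iUnion.2 ⟨a, ha⟩
  have hsum : ∑' a, P (C a) = 1 := by
    rw [← measure_iUnion hCd hCm, hCu, measure_univ]
  have hlim : Tendsto (fun F : Finset (List ℕ →₀ ℕ) => ∑ a ∈ F, P (C a)) atTop (𝓝 1) := by
    rw [← hsum]
    exact ENNReal.summable.hasSum
  have hlt : ENNReal.ofReal (1 - δ) < 1 := by
    rw [← ENNReal.ofReal_one]
    exact (ENNReal.ofReal_lt_ofReal_iff one_pos).2 (by linarith)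
  obtain ⟨F₀, hF₀⟩ := (hlim.eventually (lt_mem_nhds hlt)).exists
  have hF₀' : 1 - δ ≤ P.real (⋃ a ∈ F₀, C a) := by
    rw [← measure_biUnion_finset (fun a _ b _ h => hCd h) fun a _ => hCm a] at hF₀
    exact (ENNReal.ofReal_le_iff_le_toReal (measure_ne_top _ _)).1 hF₀.le
  let F₁ : Finset (List ℕ →₀ ℕ) := F₀.filter fun a => Truncated s a
  refine ⟨F₁.image (fun a : List ℕ →₀ ℕ => (a : List ℕ → ℕ)), ?_, ?_⟩
  · intro ν hν
    obtain ⟨a, ha, rfl⟩ := Finset.mem_image.1 hν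
    exact (Finset.mem_filter.1 ha).2
  rw [Finset.sum_image fun a _ b _ h => DFunLike.coe_injective h, gwExp_eq]
  have hsub : {ω : (List ℕ → ℕ) × (List ℕ → I) | g.eval s (gwTree ω.1) [] ω.2 = true} ⊆
      (⋃ a ∈ F₁, C a ×ˢ {x | g.eval s (gwTree a) [] x = true}) ∪
        ((⋃ a ∈ F₀, C a)ᶜ ×ˢ Set.univ) := by
    rintro ⟨N, x⟩ h
    by_cases hN : N ∈ ⋃ a ∈ F₀, C a
    · left
      simp only [Set.mem_iUnion] at hN ⊢
      obtain ⟨a, ha, hNa⟩ := hN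
      have hNa : trunc s N = a := hNa
      refine ⟨a, Finset.mem_filter.2 ⟨ha, hNa ▸ truncated_trunc s N⟩, hNa, ?_⟩
      change g.eval s (gwTree a) [] x = true
      rw [← hNa, ← eval_trunc]
      exact h
    · exact Or.inr ⟨hN, trivial⟩
  refine (measureReal_mono hsub (measure_ne_top _ _)).trans ((measureReal_union_le _ _).trans
    (add_le_add ?_ ?_))
  · refine (measureReal_biUnion_finset_le _ _).trans (Finset.sum_le_sum fun a _ => ?_)
    rw [gwMeasure, measureReal_prod_prod]
    exact mul_le_mul_of_nonneg_right (prob_trunc_eq_le d s a) measureReal_nonneg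
  · rw [gwMeasure, measureReal_prod_prod, probReal_univ, mul_one,
      probReal_compl_eq_one_sub (Finset.measurableSet_biUnion _ fun a _ => hCm a)]
    linarith

/-- Here `K` is the number of edges and `M` the number of interior vertices; `(n - K)^K` is the
lower bound for the falling factorial that counts the placements. -/
lemma tendsto_realization_weight (d : ℝ) (K M : ℕ) :
    Tendsto (fun n : ℕ => ((n - K : ℝ) * (d / n)) ^ K * (1 - d / n) ^ (n * M)) atTop
      (𝓝 (d ^ K * Real.exp (-d) ^ M)) := by
  have h1 : Tendsto (fun n : ℕ => (n - K : ℝ) * (d / n)) atTop (𝓝 d) := by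
    have h : Tendsto (fun n : ℕ => d - K * d / n) atTop (𝓝 (d - 0)) :=
      tendsto_const_nhds.sub (tendsto_const_div_atTop_nhds_zero_nat _)
    rw [sub_zero] at h
    refine h.congr' ?_
    filter_upwards [eventually_gt_atTop 0] with n hn
    have : (n : ℝ) ≠ 0 := by positivity
    field_simp
  have h2 : Tendsto (fun n : ℕ => (1 - d / n) ^ n) atTop (𝓝 (Real.exp (-d))) := by
    refine (Real.tendsto_one_add_div_pow_exp (-d)).congr fun n => ?_
    rw [neg_div, ← sub_eq_add_neg]
  refine (h1.pow K).mul ?_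
  simp only [pow_mul]
  exact h2.pow M

/-- The random graph around a vertex looks like the Galton–Watson tree. -/
lemma local_limit (g : LocalFunction) (s : ℕ) (d : ℝ≥0) {δ : ℝ} (hδ : 0 < δ) :
    ∀ᶠ n : ℕ in atTop, ∀ (c : Bool) (i : Fin n),
      gwExp d s g - δ ≤ (siteLaw n volume).real {ξ | out g s (d / n) (c, i) ξ = true} := by
  obtain ⟨F, hF, hgw⟩ := exists_finset_gwExp_le g s d (half_pos hδ)
  let K : (List ℕ → ℕ) → ℕ := fun ν => ∑ w ∈ interior ν s, ν w
  let Φ : (List ℕ → ℕ) → ℕ := fun ν => ∏ w ∈ interior ν s, (ν w).factorial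
  have hΦ : ∀ ν, (0 : ℝ) < Φ ν := fun ν => by
    exact_mod_cast Finset.prod_pos fun w _ => (ν w).factorial_pos
  have hlim : Tendsto (fun n : ℕ => ∑ ν ∈ F, (((n - K ν : ℝ) * (d / n)) ^ K ν *
      -- The factorials of the sibling groups are exactly the denominators of the Poisson weights,
      -- so each term tends to the Galton–Watson probability of the tree. Only a lower bound is
      -- needed later.
      (1 - d / n) ^ (n * (interior ν s).card)) / Φ ν * treeProb g s ν) atTop
      (𝓝 (∑ ν ∈ F, ((d : ℝ) ^ K ν * Real.exp (-d) ^ (interior ν s).card) / Φ ν *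
        treeProb g s ν)) :=
    tendsto_finsetSum _ fun ν _ =>
      ((tendsto_realization_weight d (K ν) (interior ν s).card).div_const _).mul_const _
  have hval : ∀ ν, (d : ℝ) ^ K ν * Real.exp (-d) ^ (interior ν s).card / Φ ν =
      ∏ w ∈ interior ν s, (Real.exp (-d) * d ^ ν w / (ν w).factorial) := fun ν => by
    rw [Finset.prod_div_distrib, Finset.prod_mul_distrib, Finset.prod_const,
      Finset.prod_pow_eq_pow_sum]
    simp only [K, Φ]
    push_cast
    ring
  simp only [hval] at hlim
  have hev := hlim.eventually (lt_mem_nhds (sub_lt_self _ (half_pos hδ)))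
  have hKn : ∀ᶠ n : ℕ in atTop, ∀ ν ∈ F, K ν ≤ n :=
    (Finset.eventually_all F).2 fun ν _ => eventually_ge_atTop _
  have hdn : ∀ᶠ n : ℕ in atTop, (d : ℝ) ≤ n :=
    tendsto_natCast_atTop_atTop.eventually (eventually_ge_atTop (d : ℝ))
  filter_upwards [hev, hKn, hdn, eventually_gt_atTop 0] with n hn hKn hdn hn0 c i
  have hn0' : (0 : ℝ) < n := by exact_mod_cast hn0
  have h0 : (0 : ℝ) ≤ d / n := by positivity
  have h1 : (d : ℝ) / n ≤ 1 := div_le_one_of_le₀ hdn hn0'.le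
  have hge := prob_out_ge_sum g c i h0 h1 F hF
  refine le_trans ?_ hge
  have hcmp : ∑ ν ∈ F, (((n - K ν : ℝ) * (d / n)) ^ K ν *
      (1 - d / n) ^ (n * (interior ν s).card)) / Φ ν * treeProb g s ν ≤
      ∑ ν ∈ F, (orderedIndices ν s i).card * (((d : ℝ) / n) ^ (∑ w ∈ interior ν s, ν w) *
        (1 - d / n) ^ (n * (interior ν s).card) * treeProb g s ν) := by
    refine Finset.sum_le_sum fun ν hν => ?_
    have hc : ((n - K ν : ℝ)) ^ K ν ≤ (orderedIndices ν s i).card * Φ ν := by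
      have e1 := Nat.pow_sub_le_descFactorial (n - 1) (K ν)
      rw [Nat.sub_add_cancel hn0] at e1
      have e2 := e1.trans (descFactorial_le_card_orderedIndices ν s i)
      rw [← Nat.cast_sub (hKn ν hν)]
      exact_mod_cast e2
    have hT : 0 ≤ treeProb g s ν := measureReal_nonneg
    have h1' : 0 ≤ 1 - (d : ℝ) / n := by linarith
    calc _ = ((n - K ν : ℝ)) ^ K ν / Φ ν * (((d : ℝ) / n) ^ K ν *
          (1 - d / n) ^ (n * (interior ν s).card) * treeProb g s ν) := by
          rw [mul_pow]
          ring
      _ ≤ _ := by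
          refine mul_le_mul_of_nonneg_right ?_ (by positivity)
          rwa [div_le_iff₀ (hΦ ν)]
  linarith

end BipLocal

/-! ### Numerical contradiction and the upper bound -/

namespace BipLocal

lemma tendsto_log_coe_atTop : Tendsto (fun d : ℝ≥0 => Real.log d) atTop atTop :=
  Real.tendsto_log_atTop.comp (NNReal.tendsto_coe_atTop.2 tendsto_id)

lemma tendsto_log_div_coe : Tendsto (fun d : ℝ≥0 => Real.log d / d) atTop (𝓝 0) :=
  (Real.isLittleO_log_id_atTop.tendsto_div_nhds_zero).comp (NNReal.tendsto_coe_atTop.2 tendsto_id)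

lemma le_avgChosen (g : LocalFunction) (s : ℕ) {n : ℕ} (hn : 0 < n) (q : ℝ) (c : Bool) {p : ℝ}
    (h : ∀ i : Fin n, p ≤ (siteLaw n volume).real {ξ | out g s q (c, i) ξ = true}) :
    p ≤ avgChosen g s n q c := by
  have hn' : (0 : ℝ) < n := by exact_mod_cast hn
  rw [avgChosen, le_div_iff₀ hn', mul_comm, ← nsmul_eq_mul]
  simpa using Finset.card_nsmul_le_sum Finset.univ _ _ fun i _ => h i

/-- If the right density exceeds the threshold, then the left density is small. -/
lemma left_density_le {α β d l e : ℝ} (hd : 0 < d) (he : 0 < e) (he1 : e ≤ 1 / 2) (hl : 1 ≤ l)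
    (hlog : Real.log 2 ≤ e / 4 * l) (hκ : l / d ≤ e / 48)
    (hβ : (1 + e) * (l / d) ≤ β)
    (h : d * (α * β) ≤ (α + β) * (l + Real.log 2) + 5 / d) : α ≤ 1 / 4 := by
  by_contra hα
  push Not at hα
  set κ := l / d with hκdef
  have hlκ : l = d * κ := by rw [hκdef]; field_simp
  have hκ0 : 0 < κ := by positivity
  have hlog0 : 0 ≤ Real.log 2 := Real.log_nonneg (by norm_num)
  set L := l + Real.log 2
  have hL : L ≤ (1 + e / 4) * l := by simp only [L]; linarith
  have hL' : L ≤ (1 + e / 4) * (d * κ) := by rwa [← hlκ]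
  have h5 : 5 / d ≤ 5 * κ := by
    rw [hκdef, mul_div_assoc']
    gcongr
    linarith
  have hLd : L ≤ d * (2 * κ) := by nlinarith [mul_pos hd hκ0]
  have hpos : 0 ≤ d * α - L := by nlinarith
  have h1 : β * (d * α - L) ≤ α * L + 5 / d := by nlinarith
  have h2 : (1 + e) * κ * (d * α - L) ≤ β * (d * α - L) := mul_le_mul_of_nonneg_right hβ hpos
  have h3 : α * L ≤ α * ((1 + e / 4) * (d * κ)) := mul_le_mul_of_nonneg_left hL' (by linarith)
  have h4 : (1 + e) * κ * L ≤ (1 + e) * κ * (d * (2 * κ)) :=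
    mul_le_mul_of_nonneg_left hLd (by positivity)
  have hd5 : 5 / d ≤ 5 * (d * κ) * κ := by
    rw [← hlκ]
    nlinarith
  have h6 : 3 / 4 * e * (d * κ) * α ≤ (1 + e) * κ * (d * (2 * κ)) + 5 * (d * κ) * κ := by nlinarith
  have h7 : (d * κ) * (3 / 4 * e * α) ≤ (d * κ) * ((1 + e) * 2 * κ + 5 * κ) := by nlinarith
  -- Since `2 (1 + e) + 5 ≤ 8`, this gives `3/4 * e * α ≤ 8 κ`; with `κ ≤ e / 48` it follows that `α
  -- ≤ 2/9`.
  have h8 := le_of_mul_le_mul_left h7 (mul_pos hd hκ0)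
  nlinarith

/-- The final contradiction between the densities of the copies. -/
lemma density_contradiction {m : ℕ} {d l e α β : ℝ} {x y : ℕ → ℝ} (hd : 0 < d) (he : 0 < e)
    (he1 : e ≤ 1 / 2) (hl : 1 < l) (hlog : (m + 1 : ℕ) * Real.log 2 ≤ e / 4 * l)
    (hm : 18 / e ^ 2 ≤ m) (hα : (1 + e) * (l / d) ≤ α) (hβ : (1 + e) * (l / d) ≤ β)
    (hx0 : x 0 = α) (hy0 : y 0 = β) (hx : ∀ k, 0 ≤ x k) (hy : ∀ k, 0 ≤ y k)
    (hxy : ∀ k, 0 < k → k < m + 1 → x k + y k = e * (l / d))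
    (h : d * (∑ k ∈ Finset.range (m + 1), (x k * β + α * y k - x k * y k)) ≤
      (∑ k ∈ Finset.range (m + 1), (x k + y k)) * (l + (m + 1 : ℕ) * Real.log 2) + 5 / d) :
    False := by
  set κ := l / d with hκdef
  have hlκ : l = d * κ := by rw [hκdef]; field_simp
  have hκ0 : 0 < κ := by positivity
  set L := l + (m + 1 : ℕ) * Real.log 2
  have hL : L ≤ (1 + e / 4) * (d * κ) := by
    simp only [L]
    rw [← hlκ]
    linarith
  -- In units of `d κ^2`, the clashes are at least `(1 + e) e - e^2 / 4`, by the
  -- arithmetic–geometric mean inequality for `x y`, and the entropy is at most `e (1 + e / 4)`. The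
  -- difference is `e^2 / 2`.
  have hterm : ∀ k ∈ Finset.range m, d * κ ^ 2 * e ^ 2 / 2 ≤
      d * (x (k + 1) * β + α * y (k + 1) - x (k + 1) * y (k + 1)) -
        (x (k + 1) + y (k + 1)) * L := by
    intro k hk
    have hk' := hxy (k + 1) (Nat.succ_pos k) (by simpa using hk)
    have hx' := hx (k + 1)
    have hy' := hy (k + 1)
    set a := x (k + 1)
    set b := y (k + 1)
    have h1 : a * ((1 + e) * κ) ≤ a * β := mul_le_mul_of_nonneg_left hβ hx'
    have h2 : (1 + e) * κ * b ≤ α * b := mul_le_mul_of_nonneg_right hα hy'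
    have h3 : a * b ≤ (e * κ) ^ 2 / 4 := by
      rw [← hk']
      nlinarith [sq_nonneg (a - b)]
    have h4 : (a + b) * L ≤ (a + b) * ((1 + e / 4) * (d * κ)) :=
      mul_le_mul_of_nonneg_left hL (by linarith)
    have h5 : (1 + e) * κ * (a + b) - (e * κ) ^ 2 / 4 ≤ a * β + α * b - a * b := by linarith
    have h6 := mul_le_mul_of_nonneg_left h5 hd.le
    rw [hk'] at h4 h6 ⊢
    nlinarith
  -- With `c = (1 + e / 4) κ`, expand `(α - c) (β - c) ≥ 0` and use `c^2 ≤ 4 κ^2`. The loss is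
  -- bounded however large `α` and `β` are.
  have hfirst : -(4 * (d * κ ^ 2)) ≤ d * (x 0 * β + α * y 0 - x 0 * y 0) - (x 0 + y 0) * L := by
    rw [hx0, hy0]
    have hαβ : 0 ≤ α + β := by
      have : 0 ≤ (1 + e) * κ := by positivity
      linarith
    have h4 : (α + β) * L ≤ (α + β) * ((1 + e / 4) * (d * κ)) := mul_le_mul_of_nonneg_left hL hαβ
    have h5 : 0 ≤ (α - (1 + e / 4) * κ) * (β - (1 + e / 4) * κ) := by
      refine mul_nonneg ?_ ?_ <;> nlinarith
    have h6 : (1 + e / 4) ^ 2 * κ ^ 2 ≤ 4 * κ ^ 2 :=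
      mul_le_mul_of_nonneg_right (by nlinarith) (by positivity)
    have h7 : 0 ≤ d * ((α - (1 + e / 4) * κ) * (β - (1 + e / 4) * κ) +
        (4 * κ ^ 2 - (1 + e / 4) ^ 2 * κ ^ 2)) := mul_nonneg hd.le (by linarith)
    nlinarith
  have hsum := Finset.card_nsmul_le_sum _ _ _ hterm
  rw [Finset.card_range, nsmul_eq_mul, Finset.sum_sub_distrib, ← Finset.mul_sum, ← Finset.sum_mul]
    at hsum
  rw [Finset.sum_range_succ', Finset.sum_range_succ'] at h
  -- The `m` extra copies gain at least `9 d κ^2`. After the loss `4 d κ^2` of copy `0`, the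
  -- remaining `5 d κ^2` would be at most `5 / d`, which contradicts `l > 1`.
  have h9 : 9 ≤ m * e ^ 2 / 2 := by
    rw [div_le_iff₀ (by positivity)] at hm
    linarith
  have h10 : d * κ ^ 2 * 9 ≤ m * (d * κ ^ 2 * e ^ 2 / 2) := by
    have := mul_le_mul_of_nonneg_left h9 (show 0 ≤ d * κ ^ 2 by positivity)
    linarith
  have h11 : d * κ ^ 2 * 5 ≤ 5 / d := by linarith
  rw [le_div_iff₀ hd] at h11
  have h12 : d * κ ^ 2 * 5 * d = 5 * l ^ 2 := by rw [hlκ]; ring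
  rw [h12] at h11
  nlinarith

/-- No compatible pair of local functions exceeds the threshold on both sides. -/
lemma not_both_dense {ε : ℝ} (hε : 0 < ε) : ∀ᶠ d : ℝ≥0 in atTop,
    ∀ (s : ℕ) (gl gr : LocalFunction), Compatible s gl gr →
      ¬ ((1 + ε) * (Real.log d / d) ≤ gwExp d s gl ∧
        (1 + ε) * (Real.log d / d) ≤ gwExp d s gr) := by
  -- Keeping `e` strictly below `ε` leaves a surplus `(ε - e) * (l / d)` that absorbs the error of
  -- the local limit.
  set e := min ε 1 / 2 with he_def
  have he : 0 < e := by positivity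
  have he1 : e ≤ 1 / 2 := by
    have := min_le_right ε 1
    linarith
  have heε : e < ε := by
    have := min_le_left ε 1
    linarith
  -- The number of copies is fixed before `d`, so `(m + 1) log 2` is negligible against `log d`.
  obtain ⟨m, hm⟩ := exists_nat_ge (18 / e ^ 2)
  have hev1 := tendsto_log_coe_atTop.eventually
    (eventually_ge_atTop ((m + 1 : ℕ) * Real.log 2 / (e / 4)))
  have hev2 := tendsto_log_coe_atTop.eventually (eventually_gt_atTop 1)
  have hev3 := tendsto_log_div_coe.eventually (ge_mem_nhds (show 0 < e / 48 by positivity))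
  have hev4 := tendsto_log_div_coe.eventually
    (ge_mem_nhds (show 0 < 1 / (4 * ((m + 1 : ℕ) * e)) by positivity))
  filter_upwards [hev1, hev2, hev3, hev4, eventually_ge_atTop 2] with d h1 hl h3 h4 hd2 s gl gr hc
  rintro ⟨hgl, hgr⟩
  have hd2' : (2 : ℝ) ≤ d := by exact_mod_cast hd2
  have hd : (0 : ℝ) < d := by linarith
  set l := Real.log d with hl_def
  have hκ : 0 < l / d := by positivity
  have hlog : (m + 1 : ℕ) * Real.log 2 ≤ e / 4 * l := by
    rw [div_le_iff₀ (by positivity)] at h1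
    linarith
  have hlog2 : 0 ≤ Real.log 2 := Real.log_nonneg (by norm_num)
  have hlog1 : Real.log 2 ≤ e / 4 * l := by
    refine le_trans ?_ hlog
    push_cast
    nlinarith [(Nat.cast_nonneg m : (0 : ℝ) ≤ m)]
  have hmθ : (m + 1 : ℕ) * (e * (l / d)) ≤ 1 / 4 := by
    rw [le_div_iff₀ (by positivity)] at h4
    linarith
  have hδ : 0 < (ε - e) * (l / d) := mul_pos (by linarith) hκ
  -- The error from meeting balls vanishes as `n` grows with `d`, `m` and `s` fixed; bounded by `1 /
  -- d`, it turns `4 / d` into `5 / d`.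
  have hsmall : ∀ E : ℝ, ∀ᶠ n : ℕ in atTop, (d : ℝ) * (2 * E ^ 2 / n) ≤ 1 / d := fun E => by
    have ht : Tendsto (fun n : ℕ => (d : ℝ) * (2 * E ^ 2 / n)) atTop (𝓝 ((d : ℝ) * 0)) :=
      (tendsto_const_div_atTop_nhds_zero_nat _).const_mul _
    rw [mul_zero] at ht
    exact ht.eventually (ge_mem_nhds (by positivity))
  obtain ⟨n, hn1, hn2, hn3, hn4, hdn, hn0⟩ := ((local_limit gl s d hδ).and
    ((local_limit gr s d hδ).and
    ((hsmall (∑ k ∈ Finset.range (s + 2), (2 * (1 : ℕ) * (d : ℝ)) ^ k)).and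
    ((hsmall (∑ k ∈ Finset.range (s + 2), (2 * (m + 1 : ℕ) * (d : ℝ)) ^ k)).and
    ((tendsto_natCast_atTop_atTop.eventually (eventually_ge_atTop (d : ℝ))).and
    (eventually_gt_atTop 0)))))).exists
  have hpl : ∀ i : Fin n, (1 + e) * (l / d) ≤
      (siteLaw n volume).real {ξ | out gl s (d / n) (false, i) ξ = true} := fun i => by
    have := hn1 false i
    linarith
  have hpr : ∀ i : Fin n, (1 + e) * (l / d) ≤
      (siteLaw n volume).real {ξ | out gr s (d / n) (true, i) ξ = true} := fun i => by
    have := hn2 true i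
    linarith
  have hα := le_avgChosen gl s hn0 (d / n) false hpl
  have hβ := le_avgChosen gr s hn0 (d / n) true hpr
  have hfour : 4 / (d : ℝ) + 1 / d = 5 / d := by ring
  -- A single copy already bounds the left density, which leaves room for the new copies to find
  -- vertices not chosen before.
  have hA : avgChosen gl s n (d / n) false ≤ 1 / 4 := by
    have hone := density_inequality hc hn0 hd2' hdn (volume : Measure I) (f := fun _ => id)
      (fun _ => MeasurePreserving.id _) 1
    simp only [Finset.range_one, Finset.sum_singleton,
      avgNew_zero _ _ _ _ (volume : Measure I) (f := fun _ => id)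
        (fun _ => MeasurePreserving.id _)] at hone
    refine left_density_le hd he he1 hl.le hlog1 h3 hβ ?_
    rw [add_sub_cancel_right] at hone
    push_cast at hone hn3
    rw [one_mul] at hone
    linarith
  obtain ⟨Y, _, ρ, _, f, hf, hval⟩ := exists_copies gl gr s hn0 (d / n) (θ := e * (l / d))
    (p := (1 + e) * (l / d)) (A := 1 / 4) (by positivity) (by positivity) (by nlinarith) hpl hA
    (m + 1) (by linarith)
  have hmain := density_inequality hc hn0 hd2' hdn ρ hf (m + 1)
  exact density_contradiction hd he he1 hl hlog hm hα hβ (avgNew_zero gl s n _ ρ hf false)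
    (avgNew_zero gr s n _ ρ hf true) (avgNew_nonneg gl s n _ ρ f false)
    (avgNew_nonneg gr s n _ ρ f true) hval (by linarith)

end BipLocal

/-! ### The simple algorithm and the comparison of balanced values -/

namespace BipLocal

lemma eval_simpleLeft (p : I) (s : ℕ) {V : Type} (G : SimpleGraph V) (v : V) (x : V → I) :
    (simpleLeft p).eval s G v x = true ↔ x v ≤ p := by
  simp [LocalFunction.eval, simpleLeft]

lemma eval_simpleRight (p : I) {V : Type} (G : SimpleGraph V) (v : V) (x : V → I) :
    (simpleRight p).eval 1 G v x = true ↔ ∀ u, G.Adj v u → p < x u := by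
  simp only [LocalFunction.eval, simpleRight, decide_eq_true_eq]
  constructor
  · intro h u hu
    exact h ⟨u, mem_ball_succ.2 (Or.inr ⟨v, mem_ball_self G 0 v, hu⟩)⟩ hu
  · intro h u hu
    exact h u hu

lemma compatible_simple (p : I) : Compatible 1 (simpleLeft p) (simpleRight p) := by
  intro V G L _ hL x
  have key : ∀ a ∈ output 1 (simpleLeft p) (simpleRight p) G L x,
      ∀ b ∈ output 1 (simpleLeft p) (simpleRight p) G L x, a ∈ L → b ∈ Lᶜ → ¬ G.Adj a b := by
    intro a ha b hb haL hbL hab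
    have h1 : x a ≤ p := by
      rcases ha with ⟨-, h⟩ | ⟨h, -⟩
      · exact (eval_simpleLeft p 1 G a x).1 h
      · exact (h haL).elim
    have h2 : p < x a := by
      rcases hb with ⟨h, -⟩ | ⟨-, h⟩
      · exact (hbL h).elim
      · exact (eval_simpleRight p G b x).1 h a hab.symm
    exact (h1.trans_lt h2).false
  intro a ha b hb _ hab
  rcases hL.mem_of_adj hab with ⟨h1, h2⟩ | ⟨h1, h2⟩
  · exact key a ha b hb h1 h2 hab
  · exact key b hb a ha h2 h1 hab.symm

lemma gwExp_simpleLeft (d : ℝ≥0) (s : ℕ) (p : I) : gwExp d s (simpleLeft p) = p := by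
  have hset : {ω : (List ℕ → ℕ) × (List ℕ → I) |
      (simpleLeft p).eval s (gwTree ω.1) [] ω.2 = true} =
      Set.univ ×ˢ {x | x [] ∈ Set.Iic p} := by
    ext ω
    simp [eval_simpleLeft]
  rw [gwExp_eq, hset, gwMeasure, measureReal_prod_prod, probReal_univ, one_mul]
  have h := measurePreserving_eval_infinitePi (fun _ : List ℕ => (volume : Measure I)) []
  have := h.measureReal_preimage (s := Set.Iic p) measurableSet_Iic.nullMeasurableSet
  refine this.trans ?_
  rw [Measure.real, unitInterval.volume_Iic, ENNReal.toReal_ofReal p.2.1]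

lemma gwTree_adj_root {N : List ℕ → ℕ} {u : List ℕ} :
    (gwTree N).Adj [] u ↔ ∃ i < N [], u = [i] := by
  rw [gwTree_adj]
  constructor
  · rintro (⟨h, i, rfl⟩ | ⟨-, i, hi⟩)
    · exact ⟨i, h.2, rfl⟩
    · cases hi
  · rintro ⟨i, hi, rfl⟩
    exact Or.inl ⟨⟨trivial, hi⟩, i, rfl⟩

/-- Split by the root degree `k`: the neighbours all exceed `p` with probability `(1 - p)^k`, and
the Poisson generating function gives `exp (-d) * exp (d (1 - p))`. -/
lemma gwExp_simpleRight (d : ℝ≥0) (p : I) :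
    gwExp d 1 (simpleRight p) = Real.exp (-(d * p)) := by
  let A : ℕ → Set (List ℕ → ℕ) := fun k => {N | N [] ∈ ({k} : Set ℕ)}
  let B : ℕ → Set (List ℕ → I) := fun k =>
    Set.pi ((Finset.range k).map ⟨fun i => [i], fun i j h => by simpa using h⟩ : Finset (List ℕ))
      fun _ => Set.Ioi p
  have hset : {ω : (List ℕ → ℕ) × (List ℕ → I) |
      (simpleRight p).eval 1 (gwTree ω.1) [] ω.2 = true} = ⋃ k, A k ×ˢ B k := by
    ext ⟨N, x⟩
    simp only [Set.mem_iUnion]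
    change (simpleRight p).eval 1 (gwTree N) [] x = true ↔ _
    rw [eval_simpleRight]
    constructor
    · intro h
      refine ⟨N [], rfl, fun u hu => ?_⟩
      obtain ⟨i, hi, rfl⟩ := Finset.mem_map.1 (Finset.mem_coe.1 hu)
      exact h _ (gwTree_adj_root.2 ⟨i, Finset.mem_range.1 hi, rfl⟩)
    · rintro ⟨k, hk, hx⟩ u hu
      have hk : N [] = k := hk
      obtain ⟨i, hi, rfl⟩ := gwTree_adj_root.1 hu
      exact hx _ (Finset.mem_coe.2 (Finset.mem_map.2 ⟨i, Finset.mem_range.2 (hk ▸ hi), rfl⟩))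
  have hA : ∀ k, (Measure.infinitePi fun _ : List ℕ => poissonMeasure d) (A k) =
      ENNReal.ofReal (Real.exp (-d) * d ^ k / k.factorial) := fun k => by
    rw [← poissonMeasure_singleton]
    exact (measurePreserving_eval_infinitePi (fun _ : List ℕ => poissonMeasure d) []).measure_preimage
      (measurableSet_singleton k).nullMeasurableSet
  have hp : (0 : ℝ) ≤ 1 - p := by linarith [p.2.2]
  have hB : ∀ k, (Measure.infinitePi fun _ : List ℕ => (volume : Measure I)) (B k) =
      ENNReal.ofReal ((1 - p) ^ k) := fun k => by
    rw [Measure.infinitePi_pi _ fun _ _ => measurableSet_Ioi, Finset.prod_const, Finset.card_map,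
      Finset.card_range, unitInterval.volume_Ioi, ENNReal.ofReal_pow hp]
  have hAm : ∀ k, MeasurableSet (A k) := fun k =>
    measurable_pi_apply ([] : List ℕ) (measurableSet_singleton k)
  have hBm : ∀ k, MeasurableSet (B k) := fun k =>
    MeasurableSet.pi (Finset.countable_toSet _) fun _ _ => measurableSet_Ioi
  have hdisj : Pairwise (Function.onFun Disjoint fun k => A k ×ˢ B k) := fun k l hkl =>
    Set.disjoint_left.2 fun ω hk hl => hkl
      ((show ω.1 [] = k from hk.1).symm.trans (show ω.1 [] = l from hl.1))
  rw [gwExp_eq, hset, Measure.real, measure_iUnion hdisj fun k => (hAm k).prod (hBm k)]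
  have hterm : ∀ k, gwMeasure d (A k ×ˢ B k) =
      ENNReal.ofReal (Real.exp (-d) * ((d * (1 - p)) ^ k / k.factorial)) := fun k => by
    rw [gwMeasure, Measure.prod_prod, hA, hB, ← ENNReal.ofReal_mul (by positivity)]
    congr 1
    rw [mul_pow]
    ring
  have hsum : HasSum (fun k : ℕ => Real.exp (-d) * ((d * (1 - p)) ^ k / k.factorial))
      (Real.exp (-d) * Real.exp (d * (1 - p))) := by
    refine HasSum.mul_left _ ?_
    rw [Real.exp_eq_exp_ℝ]
    exact NormedSpace.expSeries_div_hasSum_exp _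
  simp only [hterm]
  rw [← ENNReal.ofReal_tsum_of_nonneg (fun k => by positivity) hsum.summable, hsum.tsum_eq,
    ENNReal.toReal_ofReal (by positivity), ← Real.exp_add]
  congr 1
  ring

lemma gwExp_le_one (d : ℝ≥0) (s : ℕ) (g : LocalFunction) : gwExp d s g ≤ 1 := by
  rw [gwExp_eq]
  exact measureReal_le_one

lemma tendsto_log_log_div_log :
    Tendsto (fun d : ℝ≥0 => Real.log (Real.log d) / Real.log d) atTop (𝓝 0) :=
  (Real.isLittleO_log_id_atTop.tendsto_div_nhds_zero).comp tendsto_log_coe_atTop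

/-- The label threshold `(log d - 2 log log d) / d` for the simple algorithm. -/
noncomputable def simpleThreshold (d : ℝ≥0) : I :=
  Set.projIcc 0 1 zero_le_one ((Real.log d - 2 * Real.log (Real.log d)) / d)

/-- For large `d` the threshold lies in `[0, 1]`, so the projection does nothing. The right density
is `(log d)^2 / d`, so once `log d ≥ (1 - γ) / γ` the left term is the minimum, and the subtracted
`2 log log d` is the whole error. -/
lemma eventually_balValue_simple {γ : ℝ} (hγ : γ ∈ Set.Ioc (0 : ℝ) (1 / 2)) :
    ∀ᶠ d : ℝ≥0 in atTop,
      balValue d γ 1 (simpleLeft (simpleThreshold d)) (simpleRight (simpleThreshold d)) =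
        (1 / (2 * γ) + -(1 / γ) * (Real.log (Real.log d) / Real.log d)) * (Real.log d / d) := by
  have hγ0 := hγ.1
  have hγ1 : 0 < 1 - γ := by linarith [hγ.2]
  have hev1 := tendsto_log_coe_atTop.eventually (eventually_ge_atTop (max 1 ((1 - γ) / γ)))
  have hev2 := tendsto_log_log_div_log.eventually (ge_mem_nhds (show (0 : ℝ) < 1 / 2 by norm_num))
  have hev3 := tendsto_log_div_coe.eventually (ge_mem_nhds (show (0 : ℝ) < 1 by norm_num))
  filter_upwards [hev1, hev2, hev3, eventually_gt_atTop 0] with d h1 h2 h3 hd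
  have hd : (0 : ℝ) < d := by exact_mod_cast hd
  set l := Real.log d
  have hl1 : 1 ≤ l := (le_max_left _ _).trans h1
  have hl : 0 < l := by linarith
  have hlγ : (1 - γ) / γ ≤ l := (le_max_right _ _).trans h1
  set ll := Real.log l
  have hll : 0 ≤ ll := Real.log_nonneg hl1
  rw [div_le_iff₀ hl] at h2
  have hmem : (l - 2 * ll) / d ∈ Set.Icc (0 : ℝ) 1 := by
    refine ⟨div_nonneg (by linarith) hd.le, le_trans ?_ h3⟩
    exact div_le_div_of_nonneg_right (by linarith) hd.le
  have hp : ((simpleThreshold d : I) : ℝ) = (l - 2 * ll) / d := by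
    rw [simpleThreshold, Set.projIcc_of_mem zero_le_one hmem]
  have hexp : Real.exp (-(d * ((l - 2 * ll) / d))) = l ^ 2 / d := by
    rw [mul_div_cancel₀ _ hd.ne', neg_sub, Real.exp_sub, Real.exp_log hd, two_mul, Real.exp_add,
      Real.exp_log hl, sq]
  rw [balValue, gwExp_simpleLeft, gwExp_simpleRight, hp, hexp, min_eq_left]
  · field_simp
    ring
  · rw [one_div_mul_eq_div, one_div_mul_eq_div, div_le_div_iff₀ hγ0 hγ1]
    rw [div_le_iff₀ hγ0] at hlγ
    rw [div_mul_eq_mul_div, div_mul_eq_mul_div]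
    refine div_le_div_of_nonneg_right ?_ hd.le
    calc (l - 2 * ll) * (1 - γ) ≤ l * (1 - γ) := by gcongr; linarith
      _ ≤ l * (l * γ) := by gcongr
      _ = l ^ 2 * γ := by ring

/-- One of the two expectations is below `t`. Either way the minimum is at most `t / γ`, because `1
/ (1 - γ) ≤ 1 / γ` for `γ ≤ 1/2`. -/
lemma balValue_le {γ : ℝ} (hγ : γ ∈ Set.Ioc (0 : ℝ) (1 / 2)) {d : ℝ≥0} {s : ℕ}
    {gl gr : LocalFunction} {t : ℝ} (ht : 0 ≤ t)
    (h : ¬ (t ≤ gwExp d s gl ∧ t ≤ gwExp d s gr)) :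
    balValue d γ s gl gr ≤ 1 / (2 * γ) * t := by
  have hγ0 := hγ.1
  have hγ1 : 0 < 1 - γ := by linarith [hγ.2]
  have key : min (1 / γ * gwExp d s gl) (1 / (1 - γ) * gwExp d s gr) ≤ 1 / γ * t := by
    by_cases hl : t ≤ gwExp d s gl
    · have hr : gwExp d s gr ≤ t := (not_le.1 fun hr => h ⟨hl, hr⟩).le
      refine (min_le_right _ _).trans ?_
      have h1 : 1 / (1 - γ) ≤ 1 / γ := one_div_le_one_div_of_le hγ0 (by linarith [hγ.2])
      calc 1 / (1 - γ) * gwExp d s gr ≤ 1 / (1 - γ) * t := by gcongr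
        _ ≤ 1 / γ * t := by gcongr
    · refine (min_le_left _ _).trans ?_
      have := (not_le.1 hl).le
      gcongr
  calc balValue d γ s gl gr ≤ 1 / 2 * (1 / γ * t) := by
        unfold balValue
        gcongr
    _ = _ := by
        field_simp

lemma optBalValue_le {γ : ℝ} (hγ : γ ∈ Set.Ioc (0 : ℝ) (1 / 2)) {d : ℝ≥0} {t : ℝ} (ht : 0 ≤ t)
    (h : ∀ (s : ℕ) (gl gr : LocalFunction), Compatible s gl gr →
      ¬ (t ≤ gwExp d s gl ∧ t ≤ gwExp d s gr)) :
    optBalValue d γ ≤ 1 / (2 * γ) * t := by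
  refine csSup_le ⟨_, 1, _, _, compatible_simple 0, rfl⟩ ?_
  rintro _ ⟨s, gl, gr, hc, rfl⟩
  exact balValue_le hγ ht (h s gl gr hc)

lemma le_optBalValue {γ : ℝ} (hγ : γ ∈ Set.Ioc (0 : ℝ) (1 / 2)) (d : ℝ≥0) {s : ℕ}
    {gl gr : LocalFunction} (hc : Compatible s gl gr) :
    balValue d γ s gl gr ≤ optBalValue d γ := by
  -- The set is bounded above because no expectation reaches `t = 2`.
  refine le_csSup ⟨1 / (2 * γ) * 2, ?_⟩ ⟨s, gl, gr, hc, rfl⟩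
  rintro _ ⟨s, gl, gr, -, rfl⟩
  exact balValue_le hγ zero_le_two fun h => by linarith [gwExp_le_one d s gl, h.1]

end BipLocal

theorem theorem1p5 (γ : ℝ) (hγ : γ ∈ Set.Ioc (0 : ℝ) (1 / 2)) :
    -- the optimal value is `(1/(2γ) + o_d(1)) log d / d`
    (∃ e : ℝ≥0 → ℝ, Tendsto e atTop (𝓝 0) ∧
      ∀ᶠ d : ℝ≥0 in atTop,
        BipLocal.optBalValue d γ = (1 / (2 * γ) + e d) * (Real.log d / d)) ∧
    -- the lower bound is attained by the simple `1`-local algorithm with a suitable `p = p(d)`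
    (∀ p : I, BipLocal.Compatible 1 (BipLocal.simpleLeft p) (BipLocal.simpleRight p)) ∧
    (∃ (p : ℝ≥0 → I) (e : ℝ≥0 → ℝ), Tendsto e atTop (𝓝 0) ∧
      ∀ᶠ d : ℝ≥0 in atTop,
        BipLocal.balValue d γ 1 (BipLocal.simpleLeft (p d)) (BipLocal.simpleRight (p d)) =
          (1 / (2 * γ) + e d) * (Real.log d / d)) ∧
    -- no local algorithm reaches `(1 + ε) log d / d` on both sides
    (∀ ε : ℝ, 0 < ε → ∀ᶠ d : ℝ≥0 in atTop,
      ∀ (s : ℕ) (gl gr : BipLocal.LocalFunction), BipLocal.Compatible s gl gr →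
        ¬ ((1 + ε) * (Real.log d / d) ≤ BipLocal.gwExp d s gl ∧
           (1 + ε) * (Real.log d / d) ≤ BipLocal.gwExp d s gr)) := by
  have hpos : ∀ᶠ d : ℝ≥0 in atTop, 0 < Real.log d / d := by
    filter_upwards [eventually_gt_atTop 1] with d hd
    have hd' : (1 : ℝ) < d := by exact_mod_cast hd
    exact div_pos (Real.log_pos hd') (by linarith)
  have hγ0 := hγ.1
  have hlim : Tendsto (fun d : ℝ≥0 => -(1 / γ) * (Real.log (Real.log d) / Real.log d))
      atTop (𝓝 0) := by
    simpa using BipLocal.tendsto_log_log_div_log.const_mul (-(1 / γ))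
  refine ⟨⟨fun d => BipLocal.optBalValue d γ / (Real.log d / d) - 1 / (2 * γ), ?_, ?_⟩,
    BipLocal.compatible_simple,
    ⟨BipLocal.simpleThreshold, _, hlim, BipLocal.eventually_balValue_simple hγ⟩,
    fun ε hε => BipLocal.not_both_dense hε⟩
  · refine tendsto_order.2 ⟨fun a ha => ?_, fun a ha => ?_⟩
    · filter_upwards [hpos, BipLocal.eventually_balValue_simple hγ,
        (tendsto_order.1 hlim).1 a ha] with d hd hval hlt
      refine hlt.trans_le (le_sub_iff_add_le'.2 ((le_div_iff₀ hd).2 ?_))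
      rw [← hval]
      exact BipLocal.le_optBalValue hγ d (BipLocal.compatible_simple _)
    -- With `ε = a γ` the bound `(1 + ε) / (2γ)` exceeds `1 / (2γ)` by `a / 2 < a`.
    · have hε : 0 < a * γ := mul_pos ha hγ0
      filter_upwards [hpos, BipLocal.not_both_dense hε] with d hd hdense
      have hle := BipLocal.optBalValue_le hγ (by positivity) hdense
      have hbound : BipLocal.optBalValue d γ / (Real.log d / d) ≤ 1 / (2 * γ) + a / 2 := by
        refine (div_le_iff₀ hd).2 (hle.trans_eq ?_)
        rw [← mul_assoc]
        congr 1
        field_simp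
      linarith
  · filter_upwards [hpos] with d hd
    rw [add_sub_cancel, div_mul_cancel₀ _ hd.ne']
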